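/- For $n\ge 0$ let $U_n$ be the set of partitions with at most $n$ parts, i.e. sequences $\lambda=(\lambda_1\ge\dots\ge\lambda_n\ge 0)$ of integers, let $|\lambda|=\lambda_1+\dots+\lambda_n$, and let $U_{n,k}=\{\lambda\in U_n : |\lambda|=k\}$. For $\lambda,\mu\in U_n$ let the Kostka number $K_{\lambda\mu}$ be the number of semistandard Young tableaux of shape $\lambda$ and content $\mu$. Let $m_\mu(x_1,\dots,x_n)$ be the monomial symmetric polynomials and $s_\lambda=\sum_{\mu\in U_{n,|\lambda|}}K_{\lambda\mu}\,m_\mu\in\mathbb C[x_1,\dots,x_n]$ the Schur polynomials. Let $W=\{0,1\}^*$. A function $g:W\to\mathbb N$ is in $\#\mathsf P$ if there are a set $B\subseteq W^2$, whose membership problem is decided by a Turing machine in polynomial time, and a polynomial $q$ such that $(w,u)\in B$ implies $|u|\le q(|w|)$, and $g(w)=\#\{u : (w,u)\in B\}$ for all $w\in W$. A function $f:W\to\mathbb Z$ is in $\mathsf{GapP}$ if $f=g-h$ with $g,h\in\#\mathsf P$. Tuples of elements of $U_n$ are encoded as words in unary: the numbers $n,\lambda_1,\dots,\lambda_n,\mu_1,\dots,\mu_n,\dots$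 are written one after the other, a number $a$ being written as $1^a0$; here $n$ is not fixed, but is part of the input. An integer function of such tuples is regarded as a function on $W$, with value $0$ on words that encode no tuple. **Proposition.** 1. For all $n,k$ the Kostka matrix $(K_{\lambda\mu})_{\lambda,\mu\in U_{n,k}}$ is invertible over $\mathbb Z$. Let $K^{-1}_{\lambda\mu}$ be the entries of its inverse, with $K^{-1}_{\lambda\mu}=0$ if $|\lambda|\ne|\mu|$. Then the function $(\lambda,\mu)\mapsto K^{-1}_{\lambda\mu}$ is in $\mathsf{GapP}$. 2. For every $n$ the Schur polynomials $s_\lambda$, $\lambda\in U_n$, are linearly independent over $\mathbb C$, and there are integers $c^\lambda_{\mu\nu}$ (the Littlewood–Richardson coefficients; they are then unique), for $\lambda,\mu,\nu\in U_n$, with $$s_\mu\cdot s_\nu=\sum_{\lambda\in U_n}c^\lambda_{\mu\nu}\,s_\lambda ,$$ where for each pair $\mu,\nu$ only finitely many $c^\lambda_{\mu\nu}$ are nonzero. The function $(\lambda,\mu,\nu)\mapsto c^\lambda_{\mu\nu}$ is in $\mathsf{GapP}$. -/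

import Mathlib

namespace KostkaLR

/-! ### Counting classes -/

/-- Words over `{0, 1}`. -/
abbrev Word : Type := List Bool

/-- A pair of words as an input string of a Turing machine: the two words, separated by the extra
symbol `none`. -/
def pairInput (p : Word × Word) : List (Option Bool) :=
  p.1.map some ++ none :: p.2.map some

/-- A set of pairs of words is decidable in polynomial time: some Turing machine computes its
indicator function within a number of steps that is polynomial in the length of the input.
(The machines are Mathlib's multi-stack machines. They have finitely many labels and internal
states, hence only ever write finitely many different symbols.) -/
def PolyTimeDecidable (B : Set (Word × Word)) : Prop :=
  ∃ b : Word × Word → Bool, (∀ p, b p = true ↔ p ∈ B) ∧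
    Nonempty (Turing.TM2ComputableInPolyTime pairInput Computability.encodeBool b)

/-- The class `#P`: `f w` is the number of words `u` with `(w, u) ∈ B`, where `B` is decidable in
polynomial time and only relates `w` to words of length polynomially bounded in the length
of `w`. -/
def IsSharpP (f : Word → ℕ) : Prop :=
  ∃ B : Set (Word × Word), PolyTimeDecidable B ∧
    (∃ q : Polynomial ℕ, ∀ w u : Word, (w, u) ∈ B → u.length ≤ q.eval w.length) ∧
    ∀ w : Word, f w = Nat.card {u : Word // (w, u) ∈ B}

/-- The class `GapP = #P - #P`. -/
def IsGapP (f : Word → ℤ) : Prop :=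
  ∃ g h : Word → ℕ, IsSharpP g ∧ IsSharpP h ∧ ∀ w, f w = (g w : ℤ) - (h w : ℤ)

/-- An integer function on combinatorial objects, encoded as words by `e`, is in `GapP`: the
function on all words obtained by transport along `e`, with value `0` on the words that encode no
object, is in `GapP`. -/
def InGapP {α : Type} (e : α ↪ Word) (f : α → ℤ) : Prop :=
  ∃ F : Word → ℤ, IsGapP F ∧ (∀ a, F (e a) = f a) ∧ ∀ w, w ∉ Set.range e → F w = 0

/-! ### Partitions and their unary encoding -/

/-- Partitions with at most `n` parts: weakly decreasing sequences of `n` nonnegative integers. -/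
abbrev PartSeq (n : ℕ) : Type := {a : Fin n → ℕ // Antitone a}

/-- The integer of which `κ` is a partition. -/
def PartSeq.size {n : ℕ} (κ : PartSeq n) : ℕ := ∑ i, κ.1 i

/-- Partitions of `k` with at most `n` parts. -/
abbrev PartSeqOf (n k : ℕ) : Type := {κ : PartSeq n // κ.size = k}

instance (n k : ℕ) : Finite (PartSeqOf n k) :=
  Finite.of_injective
    (fun κ : PartSeqOf n k => fun i : Fin n =>
      (⟨κ.1.1 i, Nat.lt_succ_of_le ((Finset.single_le_sum (f := κ.1.1)
        (fun _ _ => Nat.zero_le _) (Finset.mem_univ i)).trans_eq κ.2)⟩ : Fin (k + 1)))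
    (fun _ _ h => Subtype.ext (Subtype.ext (funext fun i => congrArg Fin.val (congrFun h i))))

noncomputable instance (n k : ℕ) : Fintype (PartSeqOf n k) := Fintype.ofFinite _

/-- A list of natural numbers in unary: `a₁, a₂, …` is written as `1…101…10…` with blocks
of `a₁, a₂, …` ones, each followed by a zero. -/
def unary : List ℕ → Word
  | [] => []
  | a :: l => List.replicate a true ++ false :: unary l

theorem unary_injective : Function.Injective unary := by
  have key : ∀ (a b : ℕ) (s t : Word),
      List.replicate a true ++ false :: s = List.replicate b true ++ false :: t →
        a = b ∧ s = t := by
    intro a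
    induction a with
    | zero =>
      intro b s t h
      cases b with
      | zero => simpa using h
      | succ b => simp [List.replicate_succ] at h
    | succ a ih =>
      intro b s t h
      cases b with
      | zero => simp [List.replicate_succ] at h
      | succ b =>
        simp only [List.replicate_succ, List.cons_append, List.cons.injEq, true_and] at h
        simpa using ih b s t h
  intro l
  induction l with
  | nil =>
    intro m h
    cases m with
    | nil => rfl
    | cons b m => simp [unary] at h
  | cons a l ih =>
    intro m h
    cases m with
    | nil => simp [unary] at h
    | cons b m =>
      obtain ⟨h1, h2⟩ := key _ _ _ _ h
      rw [h1, ih h2]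

/-- The numbers `n, κ₁, …, κₙ, μ₁, …, μₙ, …` for an `r`-tuple `(κ, μ, …)` of partitions with at
most `n` parts. -/
def tupleList {r : ℕ} (x : Σ n : ℕ, Fin r → PartSeq n) : List ℕ :=
  x.1 :: (List.ofFn fun j : Fin r => List.ofFn (x.2 j).1).flatten

theorem tupleList_injective (r : ℕ) :
    Function.Injective (tupleList : (Σ n : ℕ, Fin r → PartSeq n) → List ℕ) := by
  rintro ⟨n, x⟩ ⟨m, y⟩ h
  simp only [tupleList, List.cons.injEq] at h
  obtain ⟨rfl, h⟩ := h
  have h' := List.eq_iff_flatten_eq.2 ⟨h, by simp [List.map_ofFn, Function.comp_def]⟩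
  have hxy : x = y := funext fun j =>
    Subtype.ext (List.ofFn_injective (congrFun (List.ofFn_injective h') j))
  rw [hxy]

/-- The unary encoding of `r`-tuples of partitions with at most `n` parts, where `n` is arbitrary
and part of the input. -/
def tupleCode (r : ℕ) : (Σ n : ℕ, Fin r → PartSeq n) ↪ Word :=
  ⟨fun x => unary (tupleList x), unary_injective.comp (tupleList_injective r)⟩

/-! ### Kostka numbers and Schur polynomials -/

/-- The Young diagram with rows of lengths `κ₁, κ₂, …`. -/
def PartSeq.diagram {n : ℕ} (κ : PartSeq n) : YoungDiagram :=
  YoungDiagram.ofRowLens (List.ofFn κ.1) (List.sortedGE_ofFn_iff.2 κ.2)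

/-- The Kostka number: the number of semistandard Young tableaux of shape `κ` and content `μ`.
Rows, columns and entries are numbered from `0`, so `μ i` is the number of entries equal to `i`,
and no entry is `n` or larger. -/
noncomputable def kostka {n : ℕ} (κ μ : PartSeq n) : ℕ :=
  Nat.card {T : SemistandardYoungTableau κ.diagram //
    ∀ i : ℕ, (κ.diagram.cells.filter fun c => T c.1 c.2 = i).card =
      if h : i < n then μ.1 ⟨i, h⟩ else 0}

/-- The Kostka matrix, indexed by the partitions of `k` with at most `n` parts. -/
noncomputable def kostkaMatrix (n k : ℕ) : Matrix (PartSeqOf n k) (PartSeqOf n k) ℤ :=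
  Matrix.of fun κ μ => (kostka κ.1 μ.1 : ℤ)

/-- The inverse Kostka number: the entry of the inverse Kostka matrix; it is `0` for partitions of
different integers (the full Kostka matrix is block diagonal). -/
noncomputable def invKostka {n : ℕ} (κ μ : PartSeq n) : ℤ :=
  if h : κ.size = μ.size then (kostkaMatrix n μ.size)⁻¹ ⟨κ, h⟩ ⟨μ, rfl⟩ else 0

/-- The monomial symmetric polynomial: the sum of `x ^ a` over the different rearrangements `a`
of `μ`. -/
noncomputable def monomialSymm {n : ℕ} (μ : PartSeq n) : MvPolynomial (Fin n) ℂ :=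
  ∑ a ∈ Finset.univ.image (fun w : Equiv.Perm (Fin n) => μ.1 ∘ w),
    MvPolynomial.monomial (Finsupp.equivFunOnFinite.symm a) 1

/-- The Schur polynomial in `n` variables. -/
noncomputable def schur {n : ℕ} (κ : PartSeq n) : MvPolynomial (Fin n) ℂ :=
  ∑ μ : PartSeqOf n κ.size, (kostka κ μ.1 : ℂ) • monomialSymm μ.1

/-- `c n κ μ ν` are Littlewood–Richardson coefficients: `s_μ s_ν = ∑ κ, c n κ μ ν • s_κ` for all
partitions `μ, ν` with at most `n` parts, where the sum runs over the partitions `κ` with at most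
`n` parts and has finitely many nonzero terms. -/
def IsLittlewoodRichardson (c : ∀ n : ℕ, PartSeq n → PartSeq n → PartSeq n → ℤ) : Prop :=
  ∀ (n : ℕ) (μ ν : PartSeq n), ∃ hfin : (Function.support fun κ => c n κ μ ν).Finite,
    schur μ * schur ν = ∑ κ ∈ hfin.toFinset, (c n κ μ ν : ℂ) • schur κ

end KostkaLR

open KostkaLR

/-!
Both parts rest on signed formulas that come from the bialternant `s_κ · a_δ = a_(κ+δ)`, where
`a_e = det (xᵢ ^ eⱼ)` and `δ = (n - 1, …, 1, 0)`. Since the coefficient of `x ^ (κ+δ)` in `a_(ν+δ)`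
is `1` for `κ = ν` and `0` otherwise, the coefficient of `s_κ` in a linear combination of Schur
polynomials is the coefficient of `x ^ (κ+δ)` in its product with `a_δ` (`schurCoeff_schur`). Hence

* the Schur polynomials are linearly independent;
* the coefficients `D_μκ` of `x ^ (κ+δ)` in `m_μ · a_δ` satisfy `∑ μ, K_νμ D_μκ = [ν = κ]`, so that
  the matrix `D` is the inverse of the Kostka matrix (`kostkaMatrix_mul_monomialToSchur`);
* products of Schur polynomials are integral combinations of Schur polynomials, and the coefficient
  of `s_κ` in `s_μ · s_ν` is the coefficient of `x ^ (κ+δ)` in `s_μ · a_(ν+δ)` (`schurCoeff_mul`).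

Both kinds of coefficients are differences of two `#P` functions. A Schur polynomial is a sum over
chains of partitions: for each variable in turn a horizontal strip is removed, and the number of its
cells is the exponent of the variable. If the strips have to arise by the deletion of a part, the sum
is a monomial symmetric polynomial instead (`monomialSymm_eq_stripPoly`). The Laplace expansion of
the alternant chooses for each variable one of the remaining exponents, with a sign. So the
coefficient of a monomial in the product is the number of sequences of strips and positions in which
the exponents add up to the right values, counted with the sign of the choices
(`coeff_stripPoly_mul_alternant`). Partitions are represented by the differences of consecutive
parts (gaps), because the admissible strips are then given by bounds on single numbers.

That the polynomials of horizontal strips are quotients of alternants follows from the branching rule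
for alternants (`alternant_branch`), and so they are symmetric. That they are the Schur polynomials,
which are defined by tableaux, is seen by removing the largest entries of a tableau, which form a
horizontal strip (`isTab_succ_iff`, `kostka_eq_coeff`).

The sequences of choices are verified by a program in a small loop language on stacks. Its programs
run in polynomial time provided that no loop makes the weighted size of the stacks grow
(`Prog.polyBounded_cost`), which is decidable, and they are compiled to Mathlib's multi-stack Turing
machines (`Prog.polyTimeDecidable`).
-/

namespace KostkaLR

/-! ### A loop language on stacks -/

/-- Programs acting on stacks of bits that are indexed by `ι`: `pop r a b c` removes the top of
stack `r` and continues with `a` if there was none, with `b` if it was `true`, with `c` if it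
was `false`; `drain r a b` pops `r` until it is empty, running `a` after each `true` and `b` after
each `false`; `num r a` pops `r` up to and including the first `false` (or until it is empty),
running `a` after each `true`. -/
inductive Prog (ι : Type) : Type
  | skip : Prog ι
  | push (r : ι) (b : Bool) : Prog ι
  | pop (r : ι) (a b c : Prog ι) : Prog ι
  | seq (a b : Prog ι) : Prog ι
  | drain (r : ι) (a b : Prog ι) : Prog ι
  | num (r : ι) (a : Prog ι) : Prog ι

namespace Prog

section Semantics

variable {ι : Type} [DecidableEq ι]

/-- The loop of `drain r`, where the last argument but one is the content of the stack `r`. -/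
def drainLoop (r : ι) (f g : (ι → List Bool) → ι → List Bool) :
    List Bool → (ι → List Bool) → ι → List Bool
  | [], s => Function.update s r []
  | true :: l, s => drainLoop r f g l (f (Function.update s r l))
  | false :: l, s => drainLoop r f g l (g (Function.update s r l))

/-- The loop of `num r`, where the last argument but one is the content of the stack `r`. -/
def numLoop (r : ι) (f : (ι → List Bool) → ι → List Bool) :
    List Bool → (ι → List Bool) → ι → List Bool
  | [], s => Function.update s r []
  | true :: l, s => numLoop r f l (f (Function.update s r l))
  | false :: l, s => Function.update s r l

/-- The effect of a program on the stacks. This is the intended semantics provided that the body of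
a loop does not touch the stack that controls the loop; see `Prog.wf`. -/
def eval : Prog ι → (ι → List Bool) → ι → List Bool
  | skip, s => s
  | push r b, s => Function.update s r (b :: s r)
  | pop r a b c, s => match s r with
    | [] => eval a (Function.update s r [])
    | true :: l => eval b (Function.update s r l)
    | false :: l => eval c (Function.update s r l)
  | seq a b, s => eval b (eval a s)
  | drain r a b, s => drainLoop r (eval a) (eval b) (s r) s
  | num r a, s => numLoop r (eval a) (s r) s

/-- The cost of the loop of `drain r`, given the effects and the costs of the bodies. -/
def drainCost (r : ι) (f g : (ι → List Bool) → ι → List Bool) (cf cg : (ι → List Bool) → ℕ) :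
    List Bool → (ι → List Bool) → ℕ
  | [], _ => 1
  | true :: l, s => 1 + cf (Function.update s r l) +
      drainCost r f g cf cg l (f (Function.update s r l))
  | false :: l, s => 1 + cg (Function.update s r l) +
      drainCost r f g cf cg l (g (Function.update s r l))

/-- The cost of the loop of `num r`, given the effect and the cost of the body. -/
def numCost (r : ι) (f : (ι → List Bool) → ι → List Bool) (cf : (ι → List Bool) → ℕ) :
    List Bool → (ι → List Bool) → ℕ
  | [], _ => 1
  | true :: l, s => 1 + cf (Function.update s r l) + numCost r f cf l (f (Function.update s r l))
  | false :: _, _ => 1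

/-- The running time of a program; it counts pushes as well, so that it also bounds the growth of
the stacks. -/
def cost : Prog ι → (ι → List Bool) → ℕ
  | skip, _ => 0
  | push _ _, _ => 1
  | pop r a b c, s => match s r with
    | [] => cost a (Function.update s r [])
    | true :: l => cost b (Function.update s r l)
    | false :: l => cost c (Function.update s r l)
  | seq a b, s => cost a s + cost b (eval a s)
  | drain r a b, s => drainCost r (eval a) (eval b) (cost a) (cost b) (s r) s
  | num r a, s => numCost r (eval a) (cost a) (s r) s

/-- The program does not touch the stack `r`. -/
def avoids (r : ι) : Prog ι → Bool
  | skip => true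
  | push q _ => decide (q ≠ r)
  | pop q a b c => decide (q ≠ r) && avoids r a && avoids r b && avoids r c
  | seq a b => avoids r a && avoids r b
  | drain q a b => decide (q ≠ r) && avoids r a && avoids r b
  | num q a => decide (q ≠ r) && avoids r a

/-- The body of a loop does not touch the stack that controls the loop. -/
def wf : Prog ι → Bool
  | skip => true
  | push _ _ => true
  | pop _ a b c => wf a && wf b && wf c
  | seq a b => wf a && wf b
  | drain r a b => avoids r a && avoids r b && wf a && wf b
  | num r a => avoids r a && wf a

theorem eval_of_avoids {r : ι} : ∀ {p : Prog ι}, p.avoids r = true → ∀ s, p.eval s r = s r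
  | skip, _, _ => rfl
  | push q b, h, s => by
    have : r ≠ q := fun e => by simp [avoids, e] at h
    simp [eval, this]
  | pop q a b c, h, s => by
    simp only [avoids, Bool.and_eq_true, decide_eq_true_eq] at h
    obtain ⟨⟨⟨h0, ha⟩, hb⟩, hc⟩ := h
    rcases hq : s q with _ | ⟨_ | _, l⟩
    · simp only [eval, hq, eval_of_avoids ha, Function.update_of_ne (Ne.symm h0)]
    · simp only [eval, hq, eval_of_avoids hc, Function.update_of_ne (Ne.symm h0)]
    · simp only [eval, hq, eval_of_avoids hb, Function.update_of_ne (Ne.symm h0)]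
  | seq a b, h, s => by
    simp only [avoids, Bool.and_eq_true] at h
    rw [eval, eval_of_avoids h.2, eval_of_avoids h.1]
  | drain q a b, h, s => by
    simp only [avoids, Bool.and_eq_true, decide_eq_true_eq] at h
    obtain ⟨⟨h0, ha⟩, hb⟩ := h
    have key : ∀ l s, drainLoop q (eval a) (eval b) l s r = s r := by
      intro l
      induction l with
      | nil => intro s; simp [drainLoop, Ne.symm h0]
      | cons x l ih =>
        intro s
        cases x
        · rw [drainLoop, ih, eval_of_avoids hb, Function.update_of_ne (Ne.symm h0)]
        · rw [drainLoop, ih, eval_of_avoids ha, Function.update_of_ne (Ne.symm h0)]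
    exact key _ _
  | num q a, h, s => by
    simp only [avoids, Bool.and_eq_true, decide_eq_true_eq] at h
    obtain ⟨h0, ha⟩ := h
    have key : ∀ l s, numLoop q (eval a) l s r = s r := by
      intro l
      induction l with
      | nil => intro s; simp [numLoop, Ne.symm h0]
      | cons x l ih =>
        intro s
        cases x
        · simp [numLoop, Ne.symm h0]
        · rw [numLoop, ih, eval_of_avoids ha, Function.update_of_ne (Ne.symm h0)]
    exact key _ _

end Semantics

/-! ### Running time -/

section PolyBounded

variable {ι : Type} [Fintype ι]

/-- The total size of the stacks, where a symbol on stack `r` has weight `ω r`. -/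
def wsize (ω : ι → ℕ) (s : ι → List Bool) : ℕ := ∑ r, ω r * (s r).length

theorem length_le_wsize {ω : ι → ℕ} {r : ι} (h : 1 ≤ ω r) (s : ι → List Bool) :
    (s r).length ≤ wsize ω s :=
  (Nat.le_mul_of_pos_left _ h).trans
    (Finset.single_le_sum (f := fun r => ω r * (s r).length) (fun _ _ => Nat.zero_le _)
      (Finset.mem_univ r))

/-- The function is bounded by a polynomial in the weighted size. -/
def PolyBounded (ω : ι → ℕ) (f : (ι → List Bool) → ℕ) : Prop :=
  ∃ c k : ℕ, ∀ s, f s ≤ c * (wsize ω s + 1) ^ k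

theorem PolyBounded.add {ω : ι → ℕ} {f g : (ι → List Bool) → ℕ} (hf : PolyBounded ω f)
    (hg : PolyBounded ω g) : PolyBounded ω (fun s => f s + g s) := by
  obtain ⟨c, k, hf⟩ := hf
  obtain ⟨c', k', hg⟩ := hg
  refine ⟨c + c', k + k', fun s => ?_⟩
  have h1 : (wsize ω s + 1) ^ k ≤ (wsize ω s + 1) ^ (k + k') :=
    Nat.pow_le_pow_right (Nat.succ_pos _) (Nat.le_add_right _ _)
  have h2 : (wsize ω s + 1) ^ k' ≤ (wsize ω s + 1) ^ (k + k') :=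
    Nat.pow_le_pow_right (Nat.succ_pos _) (Nat.le_add_left _ _)
  calc f s + g s ≤ c * (wsize ω s + 1) ^ k + c' * (wsize ω s + 1) ^ k' := add_le_add (hf s) (hg s)
    _ ≤ c * (wsize ω s + 1) ^ (k + k') + c' * (wsize ω s + 1) ^ (k + k') := by gcongr
    _ = _ := by ring

theorem PolyBounded.mono {ω : ι → ℕ} {f g : (ι → List Bool) → ℕ} (hf : PolyBounded ω f)
    (h : ∀ s, g s ≤ f s) : PolyBounded ω g := by
  obtain ⟨c, k, hf⟩ := hf
  exact ⟨c, k, fun s => (h s).trans (hf s)⟩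

/-- Composition of a polynomial bound with a map that increases the size at most polynomially. -/
theorem PolyBounded.comp {ω ω' : ι → ℕ} {f : (ι → List Bool) → ℕ} (hf : PolyBounded ω' f)
    {g : (ι → List Bool) → ι → List Bool} (hg : PolyBounded ω (fun s => wsize ω' (g s))) :
    PolyBounded ω (fun s => f (g s)) := by
  obtain ⟨c, k, hf⟩ := hf
  obtain ⟨c', k', hg⟩ := hg
  refine ⟨c * (c' + 1) ^ k, k' * k, fun s => ?_⟩
  have h : wsize ω' (g s) + 1 ≤ (c' + 1) * (wsize ω s + 1) ^ k' := by
    have h1 := hg s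
    have h2 : 1 ≤ (wsize ω s + 1) ^ k' := Nat.one_le_pow _ _ (Nat.succ_pos _)
    simp only at h1
    rw [add_mul, one_mul]
    omega
  calc f (g s) ≤ c * (wsize ω' (g s) + 1) ^ k := hf _
    _ ≤ c * ((c' + 1) * (wsize ω s + 1) ^ k') ^ k := by gcongr
    _ = _ := by rw [mul_pow, ← pow_mul, mul_assoc]

end PolyBounded

variable {ι : Type} [DecidableEq ι]

theorem numCost_le {r : ι} {f : (ι → List Bool) → ι → List Bool} {cf : (ι → List Bool) → ℕ} :
    ∀ l s, numCost r f cf l s ≤ drainCost r f f cf cf l s := by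
  intro l
  induction l with
  | nil => intro s; simp [numCost, drainCost]
  | cons x l ih =>
    intro s
    cases x
    · simp only [numCost, drainCost]; omega
    · have := ih (f (Function.update s r l))
      simp only [numCost, drainCost]; omega

variable [Fintype ι]

/-- The largest amount by which a program can increase the weighted size of the stacks, if its
loops do not increase it. -/
def delta (ω : ι → ℕ) : Prog ι → ℤ
  | skip => 0
  | push r _ => ω r
  | pop r a b c => max (delta ω a) (max (delta ω b) (delta ω c) - ω r)
  | seq a b => delta ω a + delta ω b
  | drain _ _ _ => 0
  | num _ _ => 0

/-- In each loop the body increases the weighted size at most by the weight of the symbol that was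
popped from the stack that controls the loop. Hence loops do not increase the weighted size. -/
def frugal (ω : ι → ℕ) : Prog ι → Bool
  | skip => true
  | push _ _ => true
  | pop _ a b c => frugal ω a && frugal ω b && frugal ω c
  | seq a b => frugal ω a && frugal ω b
  | drain r a b => decide (1 ≤ ω r) && decide (delta ω a ≤ ω r) && decide (delta ω b ≤ ω r) &&
      frugal ω a && frugal ω b
  | num r a => decide (1 ≤ ω r) && decide (delta ω a ≤ ω r) && frugal ω a

theorem wsize_update (ω : ι → ℕ) (s : ι → List Bool) (r : ι) (l : List Bool) :
    (wsize ω (Function.update s r l) : ℤ) =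
      wsize ω s - ω r * (s r).length + ω r * l.length := by
  unfold wsize
  rw [← Finset.add_sum_erase _ _ (Finset.mem_univ r),
    ← Finset.add_sum_erase _ (fun r => ω r * (s r).length) (Finset.mem_univ r),
    Finset.sum_congr rfl (g := fun r => ω r * (s r).length)]
  · push_cast
    simp
    ring
  · intro x hx
    rw [Function.update_of_ne (Finset.ne_of_mem_erase hx)]

theorem drainLoop_length_le {ω : ι → ℕ} {r : ι} {f g : (ι → List Bool) → ι → List Bool}
    (hf : ∀ s, (wsize ω (f s) : ℤ) ≤ wsize ω s + ω r) (hfr : ∀ s, f s r = s r)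
    (hg : ∀ s, (wsize ω (g s) : ℤ) ≤ wsize ω s + ω r) (hgr : ∀ s, g s r = s r) :
    ∀ l s, s r = l → wsize ω (drainLoop r f g l s) ≤ wsize ω s := by
  intro l
  induction l with
  | nil =>
    intro s hs
    have := wsize_update ω s r []
    simp [hs] at this
    simp [drainLoop, this]
  | cons x l ih =>
    intro s hs
    have h0 := wsize_update ω s r l
    rw [hs] at h0
    push_cast [List.length_cons] at h0
    cases x
    · have h1 := ih (g (Function.update s r l)) (by simp [hgr])
      have h2 := hg (Function.update s r l)
      rw [drainLoop]
      zify at h1 ⊢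
      linarith
    · have h1 := ih (f (Function.update s r l)) (by simp [hfr])
      have h2 := hf (Function.update s r l)
      rw [drainLoop]
      zify at h1 ⊢
      linarith

theorem numLoop_length_le {ω : ι → ℕ} {r : ι} {f : (ι → List Bool) → ι → List Bool}
    (hf : ∀ s, (wsize ω (f s) : ℤ) ≤ wsize ω s + ω r) (hfr : ∀ s, f s r = s r) :
    ∀ l s, s r = l → wsize ω (numLoop r f l s) ≤ wsize ω s := by
  intro l
  induction l with
  | nil =>
    intro s hs
    have := wsize_update ω s r []
    simp [hs] at this
    simp [numLoop, this]
  | cons x l ih =>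
    intro s hs
    have h0 := wsize_update ω s r l
    rw [hs] at h0
    push_cast [List.length_cons] at h0
    cases x
    · rw [numLoop]
      zify
      have : (0 : ℤ) ≤ ω r := by positivity
      linarith
    · have h1 := ih (f (Function.update s r l)) (by simp [hfr])
      have h2 := hf (Function.update s r l)
      rw [numLoop]
      zify at h1 ⊢
      linarith

/-- A frugal program increases the weighted size at most by its `delta`. -/
theorem wsize_eval_le (ω : ι → ℕ) : ∀ {p : Prog ι}, p.wf = true → p.frugal ω = true →
    ∀ s, (wsize ω (p.eval s) : ℤ) ≤ wsize ω s + p.delta ω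
  | skip, _, _, s => by simp [eval, delta]
  | push r b, _, _, s => by
    rw [eval, wsize_update, delta]
    push_cast [List.length_cons]
    linarith
  | pop r a b c, hw, hf, s => by
    simp only [wf, frugal, Bool.and_eq_true] at hw hf
    have h1 := le_max_left (delta ω a) (max (delta ω b) (delta ω c) - ω r)
    have h2 := le_max_right (delta ω a) (max (delta ω b) (delta ω c) - ω r)
    have h3 := le_max_left (delta ω b) (delta ω c)
    have h4 := le_max_right (delta ω b) (delta ω c)
    rw [eval, delta]
    split
    · next h =>
      have h5 := wsize_eval_le ω hw.1.1 hf.1.1 (Function.update s r [])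
      rw [wsize_update, h] at h5
      push_cast [List.length_nil] at h5
      linarith
    · next l h =>
      have h5 := wsize_eval_le ω hw.1.2 hf.1.2 (Function.update s r l)
      rw [wsize_update, h] at h5
      push_cast [List.length_cons] at h5
      linarith
    · next l h =>
      have h5 := wsize_eval_le ω hw.2 hf.2 (Function.update s r l)
      rw [wsize_update, h] at h5
      push_cast [List.length_cons] at h5
      linarith
  | seq a b, hw, hf, s => by
    simp only [wf, frugal, Bool.and_eq_true] at hw hf
    have h1 := wsize_eval_le ω hw.1 hf.1 s
    have h2 := wsize_eval_le ω hw.2 hf.2 (eval a s)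
    rw [eval, delta]
    linarith
  | drain r a b, hw, hf, s => by
    simp only [wf, frugal, Bool.and_eq_true, decide_eq_true_eq] at hw hf
    obtain ⟨⟨⟨hra, hrb⟩, hwa⟩, hwb⟩ := hw
    obtain ⟨⟨⟨⟨_, hda⟩, hdb⟩, hfa⟩, hfb⟩ := hf
    have := drainLoop_length_le (ω := ω) (r := r) (f := eval a) (g := eval b)
      (fun s => by have := wsize_eval_le ω hwa hfa s; linarith) (eval_of_avoids hra)
      (fun s => by have := wsize_eval_le ω hwb hfb s; linarith) (eval_of_avoids hrb) _ s rfl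
    rw [eval, delta, add_zero]
    exact_mod_cast this
  | num r a, hw, hf, s => by
    simp only [wf, frugal, Bool.and_eq_true, decide_eq_true_eq] at hw hf
    obtain ⟨hra, hwa⟩ := hw
    obtain ⟨⟨_, hda⟩, hfa⟩ := hf
    have := numLoop_length_le (ω := ω) (r := r) (f := eval a)
      (fun s => by have := wsize_eval_le ω hwa hfa s; linarith) (eval_of_avoids hra) _ s rfl
    rw [eval, delta, add_zero]
    exact_mod_cast this

theorem drainCost_le {ω : ι → ℕ} {r : ι} {f g : (ι → List Bool) → ι → List Bool}
    {cf cg : (ι → List Bool) → ℕ}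
    (hf : ∀ s, (wsize ω (f s) : ℤ) ≤ wsize ω s + ω r) (hfr : ∀ s, f s r = s r)
    (hg : ∀ s, (wsize ω (g s) : ℤ) ≤ wsize ω s + ω r) (hgr : ∀ s, g s r = s r)
    {c k : ℕ} (hcf : ∀ s, cf s ≤ c * (wsize ω s + 1) ^ k)
    (hcg : ∀ s, cg s ≤ c * (wsize ω s + 1) ^ k) (n : ℕ) :
    ∀ l s, s r = l → wsize ω s ≤ n →
      drainCost r f g cf cg l s ≤ (1 + c * (n + 1) ^ k) * l.length + 1 := by
  intro l
  induction l with
  | nil => intro s _ _; simp [drainCost]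
  | cons x l ih =>
    intro s hs hn
    have h0 := wsize_update ω s r l
    rw [hs] at h0
    push_cast [List.length_cons] at h0
    have hpos : (0 : ℤ) ≤ ω r := by positivity
    have h4 : wsize ω (Function.update s r l) ≤ n := by zify at hn ⊢; linarith
    have h5 : c * (wsize ω (Function.update s r l) + 1) ^ k ≤ c * (n + 1) ^ k := by gcongr
    cases x
    · have h2 := hg (Function.update s r l)
      have h1 := ih (g (Function.update s r l)) (by simp [hgr]) (by zify at hn ⊢; linarith)
      have h3 := hcg (Function.update s r l)
      rw [drainCost, List.length_cons]
      linarith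
    · have h2 := hf (Function.update s r l)
      have h1 := ih (f (Function.update s r l)) (by simp [hfr]) (by zify at hn ⊢; linarith)
      have h3 := hcf (Function.update s r l)
      rw [drainCost, List.length_cons]
      linarith

theorem polyBounded_drainCost {ω : ι → ℕ} {r : ι} (hr : 1 ≤ ω r)
    {f g : (ι → List Bool) → ι → List Bool} {cf cg : (ι → List Bool) → ℕ}
    (hf : ∀ s, (wsize ω (f s) : ℤ) ≤ wsize ω s + ω r) (hfr : ∀ s, f s r = s r)
    (hg : ∀ s, (wsize ω (g s) : ℤ) ≤ wsize ω s + ω r) (hgr : ∀ s, g s r = s r)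
    (hcf : PolyBounded ω cf) (hcg : PolyBounded ω cg) :
    PolyBounded ω (fun s => drainCost r f g cf cg (s r) s) := by
  obtain ⟨c, k, hck⟩ := hcf.add hcg
  refine ⟨c + 1, k + 1, fun s => ?_⟩
  have h1 := drainCost_le hf hfr hg hgr (fun s => (Nat.le_add_right _ _).trans (hck s))
    (fun s => (Nat.le_add_left _ _).trans (hck s)) (wsize ω s) (s r) s rfl le_rfl
  have h2 := length_le_wsize hr s
  have h3 : 1 ≤ (wsize ω s + 1) ^ k := Nat.one_le_pow _ _ (Nat.succ_pos _)
  calc drainCost r f g cf cg (s r) s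
      ≤ (1 + c * (wsize ω s + 1) ^ k) * (s r).length + 1 := h1
    _ ≤ ((wsize ω s + 1) ^ k + c * (wsize ω s + 1) ^ k) * wsize ω s +
        ((wsize ω s + 1) ^ k + c * (wsize ω s + 1) ^ k) := by gcongr; omega
    _ = _ := by ring

/-- The running time of a frugal program is polynomial. -/
theorem polyBounded_cost (ω : ι → ℕ) : ∀ {p : Prog ι}, p.wf = true → p.frugal ω = true →
    PolyBounded ω p.cost
  | skip, _, _ => ⟨0, 0, fun s => by simp [cost]⟩
  | push r b, _, _ => ⟨1, 0, fun s => by simp [cost]⟩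
  | pop r a b c, hw, hf => by
    simp only [wf, frugal, Bool.and_eq_true] at hw hf
    have hm : ∀ l : (ι → List Bool) → List Bool, (∀ s, (l s).length ≤ (s r).length) →
        PolyBounded ω (fun s => wsize ω (Function.update s r (l s))) := by
      intro l hl
      refine ⟨1, 1, fun s => ?_⟩
      have h1 := wsize_update ω s r (l s)
      have h2 : (ω r * (l s).length : ℤ) ≤ ω r * (s r).length := by
        exact_mod_cast Nat.mul_le_mul_left _ (hl s)
      zify
      simp only [pow_one]
      linarith
    have ha := (polyBounded_cost ω hw.1.1 hf.1.1).comp (hm (fun _ => []) (by simp))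
    have hb := (polyBounded_cost ω hw.1.2 hf.1.2).comp (hm (fun s => (s r).tail) (by simp))
    have hc := (polyBounded_cost ω hw.2 hf.2).comp (hm (fun s => (s r).tail) (by simp))
    refine ((ha.add hb).add hc).mono fun s => ?_
    rw [cost]
    split
    · omega
    · next h => simp only [h, List.tail_cons]; omega
    · next h => simp only [h, List.tail_cons]; omega
  | seq a b, hw, hf => by
    simp only [wf, frugal, Bool.and_eq_true] at hw hf
    refine (polyBounded_cost ω hw.1 hf.1).add ((polyBounded_cost ω hw.2 hf.2).comp ?_)
    refine ⟨(delta ω a).toNat + 1, 1, fun s => ?_⟩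
    have h1 := wsize_eval_le ω hw.1 hf.1 s
    have h2 := Int.self_le_toNat (delta ω a)
    have h3 : wsize ω (a.eval s) ≤ wsize ω s + (delta ω a).toNat := by zify; linarith
    nlinarith
  | drain r a b, hw, hf => by
    simp only [wf, frugal, Bool.and_eq_true, decide_eq_true_eq] at hw hf
    obtain ⟨⟨⟨hra, hrb⟩, hwa⟩, hwb⟩ := hw
    obtain ⟨⟨⟨⟨hr, hda⟩, hdb⟩, hfa⟩, hfb⟩ := hf
    exact polyBounded_drainCost hr
      (fun s => by have := wsize_eval_le ω hwa hfa s; linarith) (eval_of_avoids hra)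
      (fun s => by have := wsize_eval_le ω hwb hfb s; linarith) (eval_of_avoids hrb)
      (polyBounded_cost ω hwa hfa) (polyBounded_cost ω hwb hfb)
  | num r a, hw, hf => by
    simp only [wf, frugal, Bool.and_eq_true, decide_eq_true_eq] at hw hf
    obtain ⟨hra, hwa⟩ := hw
    obtain ⟨⟨hr, hda⟩, hfa⟩ := hf
    have hs := fun s => (by have := wsize_eval_le ω hwa hfa s; linarith :
      (wsize ω (a.eval s) : ℤ) ≤ wsize ω s + ω r)
    exact (polyBounded_drainCost hr hs (eval_of_avoids hra) hs (eval_of_avoids hra)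
      (polyBounded_cost ω hwa hfa) (polyBounded_cost ω hwa hfa)).mono fun s => numCost_le _ _

/-- Every symbol that a program writes is paid for by its cost. -/
theorem wsize_eval_le_add_cost : ∀ {p : Prog ι}, p.wf = true → ∀ s : ι → List Bool,
    wsize (fun _ => 1) (p.eval s) ≤ wsize (fun _ => 1) s + p.cost s := by
  have hu : ∀ (s : ι → List Bool) (r : ι) (l : List Bool), l.length ≤ (s r).length →
      wsize (fun _ => 1) (Function.update s r l) ≤ wsize (fun _ => 1) s := by
    intro s r l hl
    have := wsize_update (fun _ => 1) s r l
    zify at hl ⊢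
    push_cast at this
    linarith
  intro p
  induction p with
  | skip => intro _ s; simp [eval]
  | push r b =>
    intro _ s
    have := wsize_update (fun _ => 1) s r (b :: s r)
    zify
    rw [eval, this, cost]
    push_cast [List.length_cons]
    linarith
  | pop r a b c iha ihb ihc =>
    intro hw s
    simp only [wf, Bool.and_eq_true] at hw
    rw [eval, cost]
    split
    · next h => exact (iha hw.1.1 _).trans (Nat.add_le_add_right (hu _ _ _ (by simp)) _)
    · next h => exact (ihb hw.1.2 _).trans (Nat.add_le_add_right (hu _ _ _ (by simp [h])) _)
    · next h => exact (ihc hw.2 _).trans (Nat.add_le_add_right (hu _ _ _ (by simp [h])) _)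
  | seq a b iha ihb =>
    intro hw s
    simp only [wf, Bool.and_eq_true] at hw
    have h1 := iha hw.1 s
    have h2 := ihb hw.2 (a.eval s)
    rw [eval, cost]
    omega
  | drain r a b iha ihb =>
    intro hw
    simp only [wf, Bool.and_eq_true] at hw
    have key : ∀ l s, s r = l →
        wsize (fun _ => 1) (drainLoop r (eval a) (eval b) l s) ≤
          wsize (fun _ => 1) s + drainCost r (eval a) (eval b) (cost a) (cost b) l s := by
      intro l
      induction l with
      | nil =>
        intro s _
        have := hu s r [] (by simp)
        rw [drainLoop, drainCost]
        omega
      | cons x l ih =>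
        intro s hs
        have h0 := hu s r l (by simp [hs])
        cases x
        · have h1 := ih (b.eval (Function.update s r l)) (by simp [eval_of_avoids hw.1.1.2])
          have h2 := ihb hw.2 (Function.update s r l)
          rw [drainLoop, drainCost]
          omega
        · have h1 := ih (a.eval (Function.update s r l)) (by simp [eval_of_avoids hw.1.1.1])
          have h2 := iha hw.1.2 (Function.update s r l)
          rw [drainLoop, drainCost]
          omega
    exact fun s => key _ s rfl
  | num r a iha =>
    intro hw
    simp only [wf, Bool.and_eq_true] at hw
    have key : ∀ l s, s r = l →
        wsize (fun _ => 1) (numLoop r (eval a) l s) ≤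
          wsize (fun _ => 1) s + numCost r (eval a) (cost a) l s := by
      intro l
      induction l with
      | nil =>
        intro s _
        have := hu s r [] (by simp)
        rw [numLoop, numCost]
        omega
      | cons x l ih =>
        intro s hs
        have h0 := hu s r l (by simp [hs])
        cases x
        · rw [numLoop, numCost]
          omega
        · have h1 := ih (a.eval (Function.update s r l)) (by simp [eval_of_avoids hw.1])
          have h2 := iha hw.2 (Function.update s r l)
          rw [numLoop, numCost]
          omega
    exact fun s => key _ s rfl

end Prog

/-! ### Compilation to Turing machines -/

namespace Prog

open Turing

variable {ι : Type}

/-- The alphabets of the stacks of the machine: the input stack `none` and the stacks of the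
program. -/
abbrev Alph : Option ι → Type
  | none => Option Bool
  | some _ => Bool

/-- The statements of the machine. Its internal state is the symbol that was popped last. -/
abbrev MStmt (ι Λ : Type) : Type := TM2.Stmt (Alph (ι := ι)) Λ (Option (Option Bool))

/-- The contents of all stacks of the machine: the input and the stacks of the program. -/
def stk (inp : List (Option Bool)) (s : ι → List Bool) : ∀ k : Option ι, List (Alph k)
  | none => inp
  | some r => s r

/-- The labels that a program needs: one for each loop. -/
def Lab : Prog ι → Type
  | skip => Empty
  | push _ _ => Empty
  | pop _ a b c => Lab a ⊕ (Lab b ⊕ Lab c)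
  | seq a b => Lab a ⊕ Lab b
  | drain _ a b => Option (Lab a ⊕ Lab b)
  | num _ a => Option (Lab a)

instance finite_lab : ∀ p : Prog ι, Finite (Lab p)
  | skip => inferInstanceAs (Finite Empty)
  | push _ _ => inferInstanceAs (Finite Empty)
  | pop _ a b c =>
    have := finite_lab a
    have := finite_lab b
    have := finite_lab c
    inferInstanceAs (Finite (Lab a ⊕ (Lab b ⊕ Lab c)))
  | seq a b =>
    have := finite_lab a
    have := finite_lab b
    inferInstanceAs (Finite (Lab a ⊕ Lab b))
  | drain _ a b =>
    have := finite_lab a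
    have := finite_lab b
    inferInstanceAs (Finite (Option (Lab a ⊕ Lab b)))
  | num _ a =>
    have := finite_lab a
    inferInstanceAs (Finite (Option (Lab a)))

/-- Pop the stack `r` and branch on the result. -/
def popStmt {Λ : Type} (r : ι) (a b c : MStmt ι Λ) : MStmt ι Λ :=
  TM2.Stmt.pop (some r) (fun _ (o : Option Bool) => o.map some)
    (TM2.Stmt.branch (fun v => v == none) a (TM2.Stmt.branch (fun v => v == some (some true)) b c))

/-- The statement that runs the program up to its first loop and proceeds with `k` after the
program. The labels of the program are embedded into those of the machine by `e`. -/
def code {Λ : Type} : ∀ (p : Prog ι), (Lab p → Λ) → MStmt ι Λ → MStmt ι Λ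
  | skip, _, k => k
  | push r b, _, k => TM2.Stmt.push (some r) (fun _ => (b : Bool)) k
  | pop r a b c, e, k => popStmt r (code a (fun x => e (Sum.inl x)) k)
      (code b (fun x => e (Sum.inr (Sum.inl x))) k) (code c (fun x => e (Sum.inr (Sum.inr x))) k)
  | seq a b, e, k => code a (fun x => e (Sum.inl x)) (code b (fun x => e (Sum.inr x)) k)
  | drain _ _ _, e, _ => TM2.Stmt.goto fun _ => e none
  | num _ _, e, _ => TM2.Stmt.goto fun _ => e none

/-- The statements at the labels of the program. -/
def body {Λ : Type} : ∀ (p : Prog ι), (Lab p → Λ) → MStmt ι Λ → Lab p → MStmt ι Λ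
  | pop _ a _ _, e, k, Sum.inl x => body a (fun x => e (Sum.inl x)) k x
  | pop _ _ b _, e, k, Sum.inr (Sum.inl x) => body b (fun x => e (Sum.inr (Sum.inl x))) k x
  | pop _ _ _ c, e, k, Sum.inr (Sum.inr x) => body c (fun x => e (Sum.inr (Sum.inr x))) k x
  | seq a b, e, k, Sum.inl x =>
    body a (fun x => e (Sum.inl x)) (code b (fun x => e (Sum.inr x)) k) x
  | seq _ b, e, k, Sum.inr x => body b (fun x => e (Sum.inr x)) k x
  | drain r a b, e, k, none => popStmt r k
      (code a (fun x => e (some (Sum.inl x))) (TM2.Stmt.goto fun _ => e none))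
      (code b (fun x => e (some (Sum.inr x))) (TM2.Stmt.goto fun _ => e none))
  | drain _ a _, e, _, some (Sum.inl x) =>
    body a (fun x => e (some (Sum.inl x))) (TM2.Stmt.goto fun _ => e none) x
  | drain _ _ b, e, _, some (Sum.inr x) =>
    body b (fun x => e (some (Sum.inr x))) (TM2.Stmt.goto fun _ => e none) x
  | num r a, e, k, none => popStmt r k
      (code a (fun x => e (some x)) (TM2.Stmt.goto fun _ => e none)) k
  | num _ a, e, _, some x => body a (fun x => e (some x)) (TM2.Stmt.goto fun _ => e none) x

variable [DecidableEq ι]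

/-- The machine gets from the first configuration to the second one in at most `n` steps. -/
def ReachesIn {Λ : Type} (M : Λ → MStmt ι Λ) (n : ℕ)
    (c d : TM2.Cfg (Alph (ι := ι)) Λ (Option (Option Bool))) : Prop :=
  ∃ m ≤ n, (flip bind (TM2.step M))^[m] (some c) = some d

theorem ReachesIn.refl {Λ : Type} (M : Λ → MStmt ι Λ) (n : ℕ)
    (c : TM2.Cfg (Alph (ι := ι)) Λ (Option (Option Bool))) : ReachesIn M n c c :=
  ⟨0, Nat.zero_le _, rfl⟩

theorem ReachesIn.trans {Λ : Type} {M : Λ → MStmt ι Λ} {m n k : ℕ}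
    {c d f : TM2.Cfg (Alph (ι := ι)) Λ (Option (Option Bool))}
    (h1 : ReachesIn M m c d) (h2 : ReachesIn M n d f) (hk : m + n ≤ k) : ReachesIn M k c f := by
  obtain ⟨a, ha, h1⟩ := h1
  obtain ⟨b, hb, h2⟩ := h2
  exact ⟨b + a, by omega, by rw [Function.iterate_add_apply, h1, h2]⟩

theorem reachesIn_step {Λ : Type} (M : Λ → MStmt ι Λ) (l : Λ) (v : Option (Option Bool))
    (S : ∀ k : Option ι, List (Alph k)) :
    ReachesIn M 1 ⟨some l, v, S⟩ (TM2.stepAux (M l) v S) :=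
  ⟨1, le_rfl, rfl⟩

theorem update_stacks (inp : List (Option Bool)) (s : ι → List Bool) (r : ι) (l : List Bool) :
    Function.update (stk inp s) (some r) l = stk inp (Function.update s r l) := by
  funext k
  rcases k with _ | q
  · exact Function.update_of_ne (by simp) _ _
  · by_cases h : q = r
    · subst h
      exact (Function.update_self _ _ _).trans (Function.update_self q l s).symm
    · exact (Function.update_of_ne (by simpa using h) _ _).trans
        (show s q = Function.update s r l q from (Function.update_of_ne h l s).symm)

theorem stepAux_popStmt {Λ : Type} (r : ι) (a b c : MStmt ι Λ) (v : Option (Option Bool))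
    (inp : List (Option Bool)) (s : ι → List Bool) :
    TM2.stepAux (popStmt r a b c) v (stk inp s) = match s r with
      | [] => TM2.stepAux a none (stk inp (Function.update s r []))
      | true :: l => TM2.stepAux b (some (some true)) (stk inp (Function.update s r l))
      | false :: l => TM2.stepAux c (some (some false)) (stk inp (Function.update s r l)) := by
  have h := update_stacks inp s r (s r).tail
  have h0 : stk inp s (some r) = s r := rfl
  simp only [popStmt, TM2.stepAux]
  rw [h0]
  erw [h]
  rcases hs : s r with _ | ⟨_ | _, l⟩ <;> rfl

theorem stepAux_push {Λ : Type} (r : ι) (f : Option (Option Bool) → Bool) (k : MStmt ι Λ)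
    (v : Option (Option Bool)) (inp : List (Option Bool)) (s : ι → List Bool) :
    TM2.stepAux (TM2.Stmt.push (some r) f k : MStmt ι Λ) v (stk inp s) =
      TM2.stepAux k v (stk inp (Function.update s r (f v :: s r))) := by
  simp only [TM2.stepAux]
  exact congrArg _ (update_stacks inp s r (f v :: s r))

/-- The compiled program computes the effect of the program, within its cost. -/
theorem reachesIn_code {Λ : Type} {M : Λ → MStmt ι Λ} {inp : List (Option Bool)} :
    ∀ {p : Prog ι}, p.wf = true → ∀ (e : Lab p → Λ) (k : MStmt ι Λ),
      (∀ x, M (e x) = body p e k x) → ∀ v s, ∃ v',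
        ReachesIn M (p.cost s) (TM2.stepAux (code p e k) v (stk inp s))
          (TM2.stepAux k v' (stk inp (p.eval s)))
  | skip, _, e, k, _, v, s => ⟨v, .refl _ _ _⟩
  | push r b, _, e, k, _, v, s => by
    refine ⟨v, ?_⟩
    rw [code, stepAux_push]
    exact .refl _ _ _
  | pop r a b c, hw, e, k, he, v, s => by
    simp only [wf, Bool.and_eq_true] at hw
    rw [code, stepAux_popStmt]
    rcases hs : s r with _ | ⟨_ | _, l⟩
    · simp only [eval, cost, hs]
      exact reachesIn_code hw.1.1 _ k (fun x => he (Sum.inl x)) _ _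
    · simp only [eval, cost, hs]
      exact reachesIn_code hw.2 _ k (fun x => he (Sum.inr (Sum.inr x))) _ _
    · simp only [eval, cost, hs]
      exact reachesIn_code hw.1.2 _ k (fun x => he (Sum.inr (Sum.inl x))) _ _
  | seq a b, hw, e, k, he, v, s => by
    simp only [wf, Bool.and_eq_true] at hw
    obtain ⟨v1, h1⟩ := reachesIn_code (inp := inp) hw.1 (fun x => e (Sum.inl x))
      (code b (fun x => e (Sum.inr x)) k) (fun x => he (Sum.inl x)) v s
    obtain ⟨v2, h2⟩ := reachesIn_code (inp := inp) hw.2 (fun x => e (Sum.inr x)) k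
      (fun x => he (Sum.inr x)) v1 (a.eval s)
    exact ⟨v2, h1.trans h2 le_rfl⟩
  | drain r a b, hw, e, k, he, v, s => by
    simp only [wf, Bool.and_eq_true] at hw
    obtain ⟨⟨⟨hra, hrb⟩, hwa⟩, hwb⟩ := hw
    have key : ∀ l v s, s r = l → ∃ v', ReachesIn M
        (drainCost r (eval a) (eval b) (cost a) (cost b) l s) ⟨some (e none), v, stk inp s⟩
          (TM2.stepAux k v' (stk inp (drainLoop r (eval a) (eval b) l s))) := by
      intro l
      induction l with
      | nil =>
        intro v s hs
        have h := reachesIn_step M (e none) v (stk inp s)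
        rw [he none, body, stepAux_popStmt, hs] at h
        exact ⟨_, h⟩
      | cons x l ih =>
        intro v s hs
        have h := reachesIn_step M (e none) v (stk inp s)
        rw [he none, body, stepAux_popStmt, hs] at h
        cases x
        · obtain ⟨v1, h1⟩ := reachesIn_code (inp := inp) hwb (fun x => e (some (Sum.inr x)))
            (TM2.Stmt.goto fun _ => e none) (fun x => he (some (Sum.inr x))) (some (some false))
            (Function.update s r l)
          obtain ⟨v2, h2⟩ := ih v1 (b.eval (Function.update s r l)) (by simp [eval_of_avoids hrb])
          exact ⟨v2, (h.trans h1 le_rfl).trans h2 le_rfl⟩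
        · obtain ⟨v1, h1⟩ := reachesIn_code (inp := inp) hwa (fun x => e (some (Sum.inl x)))
            (TM2.Stmt.goto fun _ => e none) (fun x => he (some (Sum.inl x))) (some (some true))
            (Function.update s r l)
          obtain ⟨v2, h2⟩ := ih v1 (a.eval (Function.update s r l)) (by simp [eval_of_avoids hra])
          exact ⟨v2, (h.trans h1 le_rfl).trans h2 le_rfl⟩
    exact key _ v s rfl
  | num r a, hw, e, k, he, v, s => by
    simp only [wf, Bool.and_eq_true] at hw
    obtain ⟨hra, hwa⟩ := hw
    have key : ∀ l v s, s r = l → ∃ v', ReachesIn M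
        (numCost r (eval a) (cost a) l s) ⟨some (e none), v, stk inp s⟩
          (TM2.stepAux k v' (stk inp (numLoop r (eval a) l s))) := by
      intro l
      induction l with
      | nil =>
        intro v s hs
        have h := reachesIn_step M (e none) v (stk inp s)
        rw [he none, body, stepAux_popStmt, hs] at h
        exact ⟨_, h⟩
      | cons x l ih =>
        intro v s hs
        have h := reachesIn_step M (e none) v (stk inp s)
        rw [he none, body, stepAux_popStmt, hs] at h
        cases x
        · exact ⟨_, h⟩
        · obtain ⟨v1, h1⟩ := reachesIn_code (inp := inp) hwa (fun x => e (some x))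
            (TM2.Stmt.goto fun _ => e none) (fun x => he (some x)) (some (some true))
            (Function.update s r l)
          obtain ⟨v2, h2⟩ := ih v1 (a.eval (Function.update s r l)) (by simp [eval_of_avoids hra])
          exact ⟨v2, (h.trans h1 le_rfl).trans h2 le_rfl⟩
    exact key _ v s rfl

/-- The labels of the machine: two for reading the input (before and after the separator), and
those of the program. -/
abbrev MLab (p : Prog ι) : Type := Bool ⊕ Lab p

/-- The machine that moves the two words of the input to the stacks `x` and `y`, runs the program
and halts. -/
def machine (p : Prog ι) (x y : ι) : MLab p → MStmt ι (MLab p)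
  | Sum.inl false => TM2.Stmt.pop none (fun _ (o : Option (Option Bool)) => o)
      (TM2.Stmt.branch (fun v => v == some none) (TM2.Stmt.goto fun _ => Sum.inl true)
        (TM2.Stmt.push (some x) (fun v => (v == some (some true) : Bool))
          (TM2.Stmt.goto fun _ => Sum.inl false)))
  | Sum.inl true => TM2.Stmt.pop none (fun _ (o : Option (Option Bool)) => o)
      (TM2.Stmt.branch (fun v => v == none)
        (code p Sum.inr (TM2.Stmt.load (fun _ => none) TM2.Stmt.halt))
        (TM2.Stmt.push (some y) (fun v => (v == some (some true) : Bool))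
          (TM2.Stmt.goto fun _ => Sum.inl true)))
  | Sum.inr l => body p Sum.inr (TM2.Stmt.load (fun _ => none) TM2.Stmt.halt) l

theorem update_stacks_none (inp inp' : List (Option Bool)) (s : ι → List Bool) :
    Function.update (stk inp s) none inp' = stk inp' s := by
  funext k
  rcases k with _ | q
  · exact Function.update_self _ _ _
  · exact Function.update_of_ne (by simp) _ _

theorem reachesIn_read_fst (p : Prog ι) (x y : ι) (inp : List (Option Bool)) :
    ∀ (w : Word) (v : Option (Option Bool)) (s : ι → List Bool), ∃ v',
      ReachesIn (machine p x y) (w.length + 1)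
        ⟨some (Sum.inl false), v, stk (w.map some ++ none :: inp) s⟩
        ⟨some (Sum.inl true), v', stk inp (Function.update s x (w.reverse ++ s x))⟩ := by
  intro w
  induction w with
  | nil =>
    intro v s
    refine ⟨some none, 1, by simp, ?_⟩
    have h := update_stacks_none (none :: inp) inp s
    have h' : Function.update s x (List.reverse [] ++ s x) = s := by simp
    rw [h']
    exact congrArg (fun S => some (TM2.Cfg.mk (some (Sum.inl true)) (some none) S)) h
  | cons b w ih =>
    intro v s
    obtain ⟨v', h⟩ := ih (some (some b)) (Function.update s x (b :: s x))
    refine ⟨v', ReachesIn.trans (m := 1)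
      (d := ⟨some (Sum.inl false), some (some b), stk (w.map some ++ none :: inp)
        (Function.update s x (b :: s x))⟩)
      ⟨1, le_rfl, ?_⟩ (by simpa using h) (by simp; omega)⟩
    have h1 := update_stacks_none (some b :: (w.map some ++ none :: inp))
      (w.map some ++ none :: inp) s
    have h2 := stepAux_push (Λ := MLab p) x (fun v => (v == some (some true) : Bool))
      (TM2.Stmt.goto fun _ => Sum.inl false) (some (some b)) (w.map some ++ none :: inp) s
    rw [← h1] at h2
    refine (congrArg some h2).trans ?_
    cases b <;> rfl

theorem reachesIn_read_snd (p : Prog ι) (x y : ι) :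
    ∀ (u : Word) (v : Option (Option Bool)) (s : ι → List Bool),
      ReachesIn (machine p x y) (u.length + 1)
        ⟨some (Sum.inl true), v, stk (u.map some) s⟩
        (TM2.stepAux (code p Sum.inr (TM2.Stmt.load (fun _ => none) TM2.Stmt.halt)) none
          (stk [] (Function.update s y (u.reverse ++ s y)))) := by
  intro u
  induction u with
  | nil =>
    intro v s
    refine ⟨1, by simp, ?_⟩
    have h := update_stacks_none [] [] s
    have h' : Function.update s y (List.reverse [] ++ s y) = s := by simp
    rw [h']
    exact congrArg (fun S => some (TM2.stepAux (code p Sum.inr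
      (TM2.Stmt.load (fun _ => none) TM2.Stmt.halt)) none S)) h
  | cons b u ih =>
    intro v s
    have h := ih (some (some b)) (Function.update s y (b :: s y))
    refine ReachesIn.trans (m := 1)
      (d := ⟨some (Sum.inl true), some (some b), stk (u.map some)
        (Function.update s y (b :: s y))⟩)
      ⟨1, le_rfl, ?_⟩ (by simpa using h) (by simp; omega)
    have h1 := update_stacks_none (some b :: u.map some) (u.map some) s
    have h2 := stepAux_push (Λ := MLab p) y (fun v => (v == some (some true) : Bool))
      (TM2.Stmt.goto fun _ => Sum.inl true) (some (some b)) (u.map some) s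
    rw [← h1] at h2
    refine (congrArg some h2).trans ?_
    cases b <;> rfl

/-- The stacks of a program after the input was read: stack `x` contains the first word and stack
`y` the second one, both reversed. -/
def input (x y : ι) (w u : Word) : ι → List Bool :=
  Function.update (Function.update (fun _ => []) x w.reverse) y u.reverse

/-- Empty the given stacks. -/
def clean : List ι → Prog ι
  | [] => skip
  | r :: l => seq (drain r skip skip) (clean l)

theorem drainLoop_skip (r : ι) : ∀ (l : List Bool) (s : ι → List Bool),
    drainLoop r (fun s => s) (fun s => s) l s = Function.update s r [] := by
  intro l
  induction l with
  | nil => intro s; rfl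
  | cons x l ih => intro s; cases x <;> simp [drainLoop, ih]

theorem eval_clean : ∀ (l : List ι) (s : ι → List Bool) (r : ι),
    eval (clean l) s r = if r ∈ l then [] else s r := by
  intro l
  induction l with
  | nil => intro s r; simp [clean, eval]
  | cons q l ih =>
    intro s r
    simp only [clean, eval, ih, drainLoop_skip]
    by_cases h : r ∈ l
    · simp [h]
    · by_cases h' : r = q
      · simp [h']
      · simp [h, h']

theorem wf_clean : ∀ l : List ι, (clean l).wf = true
  | [] => rfl
  | r :: l => by simp [clean, wf, avoids, wf_clean l]

/-- Run the program `p` and then leave `[b]` on stack `f` and nothing on the other stacks, where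
`b` tells whether `f` was empty. -/
noncomputable def decider [Fintype ι] (p : Prog ι) (f : ι) : Prog ι :=
  seq p (seq (clean (Finset.univ.erase f).toList)
    (pop f (push f true) (seq (drain f skip skip) (push f false))
      (seq (drain f skip skip) (push f false))))

theorem eval_decider [Fintype ι] (p : Prog ι) (f : ι) (s : ι → List Bool) :
    (decider p f).eval s = Function.update (fun _ => []) f [decide (p.eval s f = [])] := by
  have h : (clean (Finset.univ.erase f).toList).eval (p.eval s) =
      Function.update (fun _ => []) f (p.eval s f) := by
    funext r
    rw [eval_clean]
    by_cases hr : r = f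
    · subst hr; simp
    · simp [hr]
  simp only [decider, eval, h, Function.update_self]
  rcases p.eval s f with _ | ⟨_ | _, l⟩ <;> simp [drainLoop_skip]

theorem polyBounded_decider [Fintype ι] {p : Prog ι} (hw : p.wf = true) {ω : ι → ℕ}
    (hf : p.frugal ω = true) (f : ι) : PolyBounded (fun _ => 1) (decider p f).cost := by
  have h1 : PolyBounded (fun _ : ι => 1) p.cost := by
    refine (polyBounded_cost ω hw hf).comp (g := id) ⟨∑ r, ω r, 1, fun s => ?_⟩
    simp only [id, wsize, one_mul, pow_one]
    rw [Finset.sum_mul]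
    refine Finset.sum_le_sum fun r _ => Nat.mul_le_mul_left _ (Nat.le_succ_of_le ?_)
    exact Finset.single_le_sum (f := fun r => (s r).length) (fun _ _ => Nat.zero_le _)
      (Finset.mem_univ r)
  have h2 : ∀ (l : List ι), (clean l).frugal (fun _ => 1) = true := by
    intro l
    induction l with
    | nil => rfl
    | cons r l ih => simp [clean, frugal, delta, ih]
  refine h1.add (PolyBounded.comp (ω' := fun _ => 1) (polyBounded_cost _ ?_ ?_) ?_)
  · simp [wf, wf_clean, avoids]
  · simp [frugal, h2, delta]
  · refine PolyBounded.mono (f := fun s => wsize (fun _ => 1) s + p.cost s)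
      (PolyBounded.add ⟨1, 1, fun s => by simp⟩ h1) fun s => wsize_eval_le_add_cost hw s

/-- The pairs of words on which a frugal program leaves the stack `f` empty can be recognized in
polynomial time. -/
theorem polyTimeDecidable [Fintype ι] {p : Prog ι} (hw : p.wf = true) {ω : ι → ℕ}
    (hf : p.frugal ω = true) {x y : ι} (hxy : x ≠ y) (f : ι) :
    PolyTimeDecidable {z | p.eval (input x y z.1 z.2) f = []} := by
  refine ⟨fun z => decide (p.eval (input x y z.1 z.2) f = []), fun z => by simp, ?_⟩
  obtain ⟨c, k, hck⟩ := polyBounded_decider hw hf f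
  let tm : FinTM2 :=
    { K := Option ι
      k₀ := none
      k₁ := some f
      Γ := Alph
      Λ := MLab (decider p f)
      main := Sum.inl false
      ΛFin := Fintype.ofFinite _
      σ := Option (Option Bool)
      initialState := none
      Γk₀Fin := inferInstanceAs (Fintype (Option Bool))
      m := machine (decider p f) x y }
  refine ⟨{ tm := tm
            inputAlphabet := Equiv.refl (Option Bool)
            outputAlphabet := Equiv.refl Bool
            time := Polynomial.X + 1 + (Polynomial.C c * (Polynomial.X + 1) ^ k)
            outputsFun := fun z => ?_ }⟩
  obtain ⟨w, u⟩ := z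
  have hlen : (pairInput (w, u)).length = w.length + (u.length + 1) := by simp [pairInput]
  have hsize : wsize (fun _ => 1) (input x y w u) ≤ w.length + (u.length + 1) := by
    have h1 := wsize_update (fun _ => 1) (Function.update (fun _ => []) x w.reverse) y u.reverse
    have h2 := wsize_update (fun _ => 1) (fun _ => []) x w.reverse
    rw [h2, Function.update_of_ne (Ne.symm hxy)] at h1
    have h0 : wsize (fun _ : ι => 1) (fun _ => []) = 0 := by simp [wsize]
    rw [h0] at h1
    unfold input
    zify
    rw [h1]
    simp
  have hrun : ReachesIn (machine (decider p f) x y)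
      ((Polynomial.X + 1 + (Polynomial.C c * (Polynomial.X + 1) ^ k)).eval
        (pairInput (w, u)).length)
      ⟨some (Sum.inl false), none, stk (pairInput (w, u)) (fun _ => [])⟩
      ⟨none, none, stk [] (Function.update (fun _ => []) f
        [decide (p.eval (input x y w u) f = [])])⟩ := by
    obtain ⟨v1, h1⟩ := reachesIn_read_fst (decider p f) x y (u.map some) w none (fun _ => [])
    have h2 := reachesIn_read_snd (decider p f) x y u v1
      (Function.update (fun _ => []) x (w.reverse ++ []))
    obtain ⟨v3, h3⟩ := reachesIn_code (M := machine (decider p f) x y) (inp := [])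
      (p := decider p f) (by simp [decider, wf, hw, wf_clean, avoids]) Sum.inr
      (TM2.Stmt.load (fun _ => none) TM2.Stmt.halt) (fun _ => rfl) none (input x y w u)
    rw [eval_decider] at h3
    have h4 : Function.update (Function.update (fun _ => []) x (w.reverse ++ [])) y
        (u.reverse ++ Function.update (fun _ => []) x (w.reverse ++ []) y) = input x y w u := by
      rw [Function.update_of_ne (Ne.symm hxy)]
      simp [input]
    rw [h4] at h2
    refine (h1.trans h2 le_rfl).trans h3 ?_
    have h5 := hck (input x y w u)
    have h6 : c * (wsize (fun _ => 1) (input x y w u) + 1) ^ k ≤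
        c * (w.length + (u.length + 1) + 1) ^ k := by gcongr
    simp only [Polynomial.eval_add, Polynomial.eval_X, Polynomial.eval_one, Polynomial.eval_mul,
      Polynomial.eval_C, Polynomial.eval_pow, hlen]
    omega
  have hinit : initList tm (List.map (Equiv.refl (Option Bool)).invFun (pairInput (w, u))) =
      ⟨some (Sum.inl false), none, stk (pairInput (w, u)) (fun _ => [])⟩ := by
    refine congrArg (TM2.Cfg.mk (some (Sum.inl false)) none) (funext fun q => ?_)
    rcases q with _ | q
    · exact (dif_pos rfl).trans (List.map_id _)
    · exact dif_neg (by simp [tm])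
  have hhalt : haltList tm (List.map (Equiv.refl Bool).invFun
      (Computability.encodeBool (decide (p.eval (input x y w u) f = [])))) =
      ⟨none, none, stk [] (Function.update (fun _ => []) f
        [decide (p.eval (input x y w u) f = [])])⟩ := by
    refine congrArg (TM2.Cfg.mk none none) (funext fun q => ?_)
    rcases q with _ | q
    · exact dif_neg (by simp [tm])
    · by_cases hq : q = f
      · subst hq
        exact (dif_pos rfl).trans (Function.update_self q _ (fun _ => [])).symm
      · exact (dif_neg (by simpa [tm] using hq)).trans
          (Function.update_of_ne hq _ (fun _ => [])).symm
  refine Classical.choice ?_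
  obtain ⟨m, hm, hrun⟩ := hrun
  refine ⟨⟨⟨m, ?_⟩, hm⟩⟩
  rw [hinit, Option.map_some, hhalt]
  exact hrun

end Prog

/-! ### Strips, and the signed count of their sequences -/

/-- Let a partition be given by the list `G` of its gaps (the differences of consecutive parts,
the last gap being the last part). `IsStep del a G d` says that the list `d` describes the removal
of a horizontal strip that leaves one part less: part `j` loses `d j` cells, which is at most
gap `j`, and the last part disappears. If `del` is true, the strip has to arise by the deletion of
a part: once some part has lost cells, all further parts lose the whole gap (`a` is the number of
cells that were removed before). -/
def IsStep (del : Bool) : ℕ → List ℕ → List ℕ → Prop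
  | _, [], [] => True
  | a, g :: G, d :: D => d ≤ g ∧ (G = [] → d = g) ∧ (del = true → a + d = 0 ∨ d = g) ∧
      IsStep del (a + d) G D
  | _, [], _ :: _ => False
  | _, _ :: _, [] => False

/-- The gaps after the removal of the strip `d`. -/
def newGaps (G d : List ℕ) : List ℕ :=
  List.zipWith (· + ·) (List.zipWith (· - ·) G d) d.tail

/-- Removal of one entry from a list of exponents. The exponents are recorded relative to the
staircase `(k - 1, …, 1, 0)` of their number `k`, which is why the entries before the removed one
increase by one. -/
def newExps (N : List ℕ) (c : ℕ) : List ℕ :=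
  (N.take c).map (· + 1) ++ N.drop (c + 1)

/-- The strips that can be removed, as a finite set. -/
def steps (del : Bool) : ℕ → List ℕ → Finset (List ℕ)
  | _, [] => {[]}
  | a, g :: G => ((Finset.range (g + 1)).filter fun d =>
      (G = [] → d = g) ∧ (del = true → a + d = 0 ∨ d = g)).biUnion fun d =>
        (steps del (a + d) G).image (d :: ·)

theorem mem_steps {del : Bool} {a : ℕ} {G d : List ℕ} : d ∈ steps del a G ↔ IsStep del a G d := by
  induction G generalizing a d with
  | nil => cases d <;> simp [steps, IsStep]
  | cons g G ih =>
    cases d with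
    | nil => simp [steps, IsStep]
    | cons x D =>
      simp only [steps, Finset.mem_biUnion, Finset.mem_filter, Finset.mem_range, Finset.mem_image,
        IsStep, List.cons.injEq]
      constructor
      · rintro ⟨y, ⟨h1, h2⟩, D', h3, rfl, rfl⟩
        exact ⟨by omega, h2.1, h2.2, ih.1 h3⟩
      · rintro ⟨h1, h2, h3, h4⟩
        exact ⟨x, ⟨by omega, h2, h3⟩, D, ih.2 h4, rfl, rfl⟩

theorem IsStep.length_eq {del : Bool} : ∀ {a : ℕ} {G d : List ℕ}, IsStep del a G d →
    d.length = G.length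
  | _, [], [], _ => rfl
  | _, _ :: _, _ :: _, h => by simp [h.2.2.2.length_eq]
  | _, [], _ :: _, h => h.elim
  | _, _ :: _, [], h => h.elim

theorem length_newGaps {G d : List ℕ} (h : d.length = G.length) :
    (newGaps G d).length = G.length - 1 := by
  simp [newGaps, h]

theorem length_newExps {N : List ℕ} {c : ℕ} (h : c < N.length) :
    (newExps N c).length = N.length - 1 := by
  simp [newExps]
  omega

/-- The sequences of choices in the computation of the coefficient of a monomial in the product of
a polynomial that is given by strips and an alternant: for each variable in turn, a strip `d` and
the position `c` of an exponent, such that the number of removed cells and the exponent add up to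
the exponent of the variable. Here `L` are the exponents of the monomial (again relative to the
staircase), `G` are the gaps, and `N` are the exponents of the alternant. The sum of the positions
is even or odd, according to `odd`. -/
def wits (del : Bool) : Bool → List ℕ → List ℕ → List ℕ → Finset (List ℕ)
  | odd, [], _, _ => if odd then ∅ else {[]}
  | odd, l :: L, G, N => ((steps del 0 G ×ˢ Finset.range N.length).filter fun x =>
      x.1.sum + N.getD x.2 0 = l + x.2).biUnion fun x =>
        (wits del (odd ^^ decide (x.2 % 2 = 1)) L (newGaps G x.1) (newExps N x.2)).image
          fun M => x.1 ++ x.2 :: M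

theorem mem_wits_cons {del odd : Bool} {l : ℕ} {L G N U : List ℕ} :
    U ∈ wits del odd (l :: L) G N ↔ ∃ d c M, U = d ++ c :: M ∧ IsStep del 0 G d ∧ c < N.length ∧
      d.sum + N.getD c 0 = l + c ∧
        M ∈ wits del (odd ^^ decide (c % 2 = 1)) L (newGaps G d) (newExps N c) := by
  simp only [wits, Finset.mem_biUnion, Finset.mem_filter, Finset.mem_product, Finset.mem_image,
    mem_steps, Finset.mem_range, Prod.exists]
  constructor
  · rintro ⟨d, c, ⟨⟨h1, h2⟩, h3⟩, M, h4, rfl⟩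
    exact ⟨d, c, M, rfl, h1, h2, h3, h4⟩
  · rintro ⟨d, c, M, rfl, h1, h2, h3, h4⟩
    exact ⟨d, c, ⟨⟨h1, h2⟩, h3⟩, M, h4, rfl⟩

/-- The signed number of the sequences of choices. -/
def sgnCount (del : Bool) : List ℕ → List ℕ → List ℕ → ℤ
  | [], _, _ => 1
  | l :: L, G, N => ∑ d ∈ steps del 0 G, ∑ c ∈ Finset.range N.length,
      if d.sum + N.getD c 0 = l + c then
        (-1) ^ c * sgnCount del L (newGaps G d) (newExps N c) else 0

theorem card_wits_cons (del odd : Bool) (l : ℕ) (L G N : List ℕ) :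
    (wits del odd (l :: L) G N).card = ∑ d ∈ steps del 0 G, ∑ c ∈ Finset.range N.length,
      if d.sum + N.getD c 0 = l + c then
        (wits del (odd ^^ decide (c % 2 = 1)) L (newGaps G d) (newExps N c)).card else 0 := by
  rw [wits, Finset.card_biUnion, Finset.sum_filter, Finset.sum_product]
  · refine Finset.sum_congr rfl fun d _ => Finset.sum_congr rfl fun c _ => ?_
    have hinj : Function.Injective fun M : List ℕ => d ++ c :: M := fun M M' h => by
      simpa using h
    exact if_congr Iff.rfl (Finset.card_image_of_injective _ hinj) rfl
  · rintro ⟨d, c⟩ h1 ⟨d', c'⟩ h2 hne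
    simp only [Finset.mem_coe, Finset.mem_filter, Finset.mem_product, mem_steps] at h1 h2
    rw [Function.onFun, Finset.disjoint_left]
    intro U hU hU'
    simp only [Finset.mem_image] at hU hU'
    obtain ⟨M, _, rfl⟩ := hU
    obtain ⟨M', _, h⟩ := hU'
    have h3 := List.append_inj h (by rw [h1.1.1.length_eq, h2.1.1.length_eq])
    simp only [List.cons.injEq] at h3
    exact hne (by rw [h3.1, h3.2.1])

theorem card_wits_sub (del : Bool) (L G N : List ℕ) :
    ((wits del false L G N).card : ℤ) - (wits del true L G N).card = sgnCount del L G N := by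
  induction L generalizing G N with
  | nil => simp [wits, sgnCount]
  | cons l L ih =>
    rw [card_wits_cons, card_wits_cons, sgnCount]
    push_cast
    rw [← Finset.sum_sub_distrib]
    refine Finset.sum_congr rfl fun d _ => ?_
    rw [← Finset.sum_sub_distrib]
    refine Finset.sum_congr rfl fun c _ => ?_
    split_ifs with h
    · rw [← ih]
      rcases Nat.even_or_odd c with hc | hc
      · have : c % 2 ≠ 1 := by rw [Nat.even_iff.1 hc]; simp
        simp [this, hc.neg_one_pow]
      · simp [Nat.odd_iff.1 hc, hc.neg_one_pow]
    · simp

/-- The size of the partition with gaps `G`. -/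
def gapSize : List ℕ → ℕ
  | [] => 0
  | g :: G => (g + G.sum) + gapSize G

theorem gapSize_newGaps {del : Bool} : ∀ {a : ℕ} {G d : List ℕ}, IsStep del a G d →
    d.sum + gapSize (newGaps G d) = gapSize G ∧
      (newGaps G d).sum + d.headD 0 = G.sum
  | _, [], [], _ => by simp [newGaps, gapSize]
  | _, [g], [d], h => by
    have := h.2.1 rfl
    subst this
    simp [newGaps, gapSize]
  | a, g :: g' :: G, d :: d' :: D, h => by
    have h1 := gapSize_newGaps h.2.2.2
    have h2 : newGaps (g :: g' :: G) (d :: d' :: D) =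
        (g - d + d') :: newGaps (g' :: G) (d' :: D) := by simp [newGaps]
    have h3 := h.1
    simp only [h2, gapSize, List.sum_cons, List.headD_cons] at h1 ⊢
    omega
  | _, _ :: _ :: _, [_], h => h.2.2.2.elim
  | _, [_], _ :: _ :: _, h => h.2.2.2.elim
  | _, [], _ :: _, h => h.elim
  | _, _ :: _, [], h => h.elim

theorem length_unary (l : List ℕ) : (unary l).length = l.sum + l.length := by
  induction l with
  | nil => rfl
  | cons a l ih => simp [unary, ih]; omega

/-- The sequences of choices are short. -/
theorem wits_bound {del odd : Bool} {L G N U : List ℕ} (h : U ∈ wits del odd L G N) :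
    U.sum + U.length ≤ gapSize G + L.length * (N.length + G.length + 1) := by
  induction L generalizing odd G N U with
  | nil =>
    cases odd <;> simp [wits] at h
    simp [h]
  | cons l L ih =>
    obtain ⟨d, c, M, rfl, h1, h2, h3, h4⟩ := mem_wits_cons.1 h
    have h5 := ih h4
    have h6 := gapSize_newGaps h1
    rw [length_newGaps h1.length_eq, length_newExps h2] at h5
    have h7 : L.length * (N.length - 1 + (G.length - 1) + 1) ≤
        L.length * (N.length + G.length + 1) := Nat.mul_le_mul_left _ (by omega)
    simp only [List.sum_append, List.length_append, List.sum_cons, List.length_cons,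
      h1.length_eq, add_mul, one_mul] at *
    omega

theorem sum_newExps {N : List ℕ} {c : ℕ} (h : c < N.length) :
    (newExps N c).sum + N.getD c 0 = N.sum + c := by
  induction N generalizing c with
  | nil => simp at h
  | cons a N ih =>
    cases c with
    | zero => simp [newExps]; omega
    | succ c =>
      have := ih (c := c) (by simpa using h)
      simp only [newExps, List.take_succ_cons, List.drop_succ_cons, List.map_cons,
        List.cons_append, List.sum_cons, List.getD_cons_succ] at this ⊢
      omega

/-- A monomial can only occur if it has the right degree. -/
theorem sum_eq_of_mem_wits {del odd : Bool} {L G N U : List ℕ} (h : U ∈ wits del odd L G N)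
    (hG : G.length = L.length) (hN : N.length = L.length) : gapSize G + N.sum = L.sum := by
  induction L generalizing odd G N U with
  | nil =>
    rw [List.length_nil, List.length_eq_zero_iff] at hG hN
    simp [hG, hN, gapSize]
  | cons l L ih =>
    obtain ⟨d, c, M, rfl, h1, h2, h3, h4⟩ := mem_wits_cons.1 h
    have h5 := ih h4 (by rw [length_newGaps h1.length_eq, hG]; rfl)
      (by rw [length_newExps h2, hN]; rfl)
    have h6 := gapSize_newGaps h1
    have h7 := sum_newExps h2
    rw [List.sum_cons]
    omega

theorem sgnCount_eq_zero {del : Bool} {L G N : List ℕ} (hG : G.length = L.length)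
    (hN : N.length = L.length) (h : gapSize G + N.sum ≠ L.sum) : sgnCount del L G N = 0 := by
  rw [← card_wits_sub]
  have h1 : ∀ odd, wits del odd L G N = ∅ := fun odd => Finset.eq_empty_of_forall_notMem
    fun U hU => h (sum_eq_of_mem_wits hU hG hN)
  rw [h1, h1]
  simp

/-! ### Partitions as lists -/

/-- The list is weakly decreasing. -/
def Decr : List ℕ → Prop
  | [] => True
  | a :: l => l.headD 0 ≤ a ∧ Decr l

/-- The differences of successive entries of a list that is continued by `0`. -/
def gapsOf : List ℕ → List ℕ
  | [] => []
  | a :: l => (a - l.headD 0) :: gapsOf l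

theorem length_gapsOf (l : List ℕ) : (gapsOf l).length = l.length := by
  induction l with
  | nil => rfl
  | cons a l ih => simp [gapsOf, ih]

theorem Decr.of_append : ∀ {l m : List ℕ}, Decr (l ++ m) → Decr m
  | [], _, h => h
  | _ :: _, _, h => Decr.of_append h.2

theorem decr_ofFn : ∀ {n : ℕ} {a : Fin n → ℕ}, Decr (List.ofFn a) ↔ Antitone a
  | 0, a => by simp [Decr, Subsingleton.antitone]
  | 1, a => by simp [Decr, Subsingleton.antitone]
  | n + 2, a => by
    rw [List.ofFn_succ, Decr, decr_ofFn, List.ofFn_succ, List.headD_cons, Fin.antitone_iff_succ_le,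
      Fin.antitone_iff_succ_le, Fin.forall_fin_succ (n := n)]
    rfl

theorem Decr.exists_ofFn {K : List ℕ} (h : Decr K) {n : ℕ} (hn : K.length = n) :
    ∃ κ : PartSeq n, List.ofFn κ.1 = K := by
  subst hn
  exact ⟨⟨K.get, decr_ofFn.1 (by rwa [List.ofFn_get])⟩, List.ofFn_get K⟩

theorem sum_gapsOf {K : List ℕ} (h : Decr K) : (gapsOf K).sum = K.headD 0 := by
  induction K with
  | nil => rfl
  | cons a l ih =>
    have h1 := h.1
    simp only [gapsOf, List.sum_cons, ih h.2, List.headD_cons]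
    omega

theorem gapSize_gapsOf {K : List ℕ} (h : Decr K) : gapSize (gapsOf K) = K.sum := by
  induction K with
  | nil => rfl
  | cons a l ih =>
    have h1 := h.1
    simp only [gapsOf, gapSize, List.sum_cons, ih h.2, sum_gapsOf h.2]
    omega

/-! ### The verifier: programs -/

/-- The stacks of the verifier: the two input words `w0`, `u0` (reversed) and their copies `w`, `u`;
two counters `c`, `d` for the number of variables; `x`, `y`, `z`, `a`, `b`, `t` for temporary
values; the exponents `l` of the monomial; the gaps `g` of the partition; the exponents `n` of the
alternant; the flag `f` that is nonempty after a failure; and the parity `p`. -/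
inductive Reg : Type
  | w0 | u0 | w | u | c | d | x | y | z | a | b | t | l | g | n | f | p
  deriving DecidableEq

instance : Fintype Reg where
  elems := {.w0, .u0, .w, .u, .c, .d, .x, .y, .z, .a, .b, .t, .l, .g, .n, .f, .p}
  complete r := by cases r <;> decide

/-- The contents of the stacks of the verifier. -/
structure Store : Type where
  w0 : List Bool := []
  u0 : List Bool := []
  w : List Bool := []
  u : List Bool := []
  c : List Bool := []
  d : List Bool := []
  x : List Bool := []
  y : List Bool := []
  z : List Bool := []
  a : List Bool := []
  b : List Bool := []
  t : List Bool := []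
  l : List Bool := []
  g : List Bool := []
  n : List Bool := []
  f : List Bool := []
  p : List Bool := []

namespace Store

/-- The content of a stack. -/
def fn (s : Store) : Reg → List Bool
  | .w0 => s.w0 | .u0 => s.u0 | .w => s.w | .u => s.u | .c => s.c | .d => s.d | .x => s.x
  | .y => s.y | .z => s.z | .a => s.a | .b => s.b | .t => s.t | .l => s.l | .g => s.g | .n => s.n
  | .f => s.f | .p => s.p

/-- Replace the content of a stack. -/
def set (s : Store) : Reg → List Bool → Store
  | .w0, v => { s with w0 := v }
  | .u0, v => { s with u0 := v }
  | .w, v => { s with w := v }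
  | .u, v => { s with u := v }
  | .c, v => { s with c := v }
  | .d, v => { s with d := v }
  | .x, v => { s with x := v }
  | .y, v => { s with y := v }
  | .z, v => { s with z := v }
  | .a, v => { s with a := v }
  | .b, v => { s with b := v }
  | .t, v => { s with t := v }
  | .l, v => { s with l := v }
  | .g, v => { s with g := v }
  | .n, v => { s with n := v }
  | .f, v => { s with f := v }
  | .p, v => { s with p := v }

@[simp]
theorem update_fn (s : Store) (r : Reg) (v : List Bool) :
    Function.update s.fn r v = (s.set r v).fn := by
  funext q
  cases r <;> cases q <;> rfl

attribute [simp] fn set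

end Store

namespace Prog

/-- Record a failure. -/
def fail : Prog Reg := push .f true

/-- Fail if the stack is empty. -/
def peek (r : Reg) : Prog Reg := pop r fail (push r true) (push r false)

/-- Move the content of stack `r` to stack `q`, in reverse order. -/
def pour (r q : Reg) : Prog Reg := drain r (push q true) (push q false)

/-- Empty a stack. -/
def clear (r : Reg) : Prog Reg := drain r skip skip

/-- Empty stack `r` and push its number of symbols in unary to stack `q`. -/
def tally (r q : Reg) : Prog Reg := drain r (push q true) (push q true)

/-- Fail if the stack is nonempty; empty it. -/
def expectEmpty (r : Reg) : Prog Reg := tally r .f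

/-- Copy the input words to `w` and `u`, check that they consist of unary numbers, and move the
first number to the counter `c`. If `del` is true, write as many zeros to `n`. -/
def start (del : Bool) : Prog Reg :=
  seq (pop .w0 fail fail (push .w0 false)) <|
  seq (pop .u0 skip fail (push .u0 false)) <|
  seq (pour .w0 .w) <|
  seq (pour .u0 .u) <|
  num .w (if del then seq (push .c true) (push .n false) else push .c true)

/-- Move as many numbers as `c` tells from `w` to `x`, in reverse order. -/
def blockIn : Prog Reg :=
  seq (drain .c
    (seq (push .d true)
      (pop .w fail (seq (push .x false) (seq (push .x true) (num .w (push .x true))))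
        (push .x false))) skip)
  (tally .d .c)

/-- Move the numbers of `x` to `z`, in reverse order, and write their successive differences
to `y`. Fail if they decrease. -/
def blockOut : Prog Reg :=
  seq (push .z false) <|
  seq (push .y false) <|
  seq (drain .x
    (seq (push .z true) (seq (push .b true) (pop .a (push .y true) skip skip)))
    (seq (expectEmpty .a) (seq (tally .b .a)
      (seq (push .z false) (push .y false))))) <|
  seq (clear .a) <|
  seq (num .z skip) (num .y skip)

/-- Read a partition: its parts go to `z`, its gaps go to `y`. -/
def block : Prog Reg := seq blockIn blockOut

/-- Read a partition and move its parts to the stack `q`. -/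
def readParts (q : Reg) : Prog Reg :=
  seq block (seq (pour .z .t) (seq (pour .t q) (clear .y)))

/-- Read a partition and move its gaps to the stack `g`. -/
def readGaps : Prog Reg :=
  seq block (seq (pour .y .t) (seq (pour .t .g) (clear .z)))

/-- Read the input. -/
def parse (del : Bool) : Prog Reg :=
  seq (start del) <|
  seq (if del then seq readGaps (readParts .l)
    else seq (readParts .l) (seq readGaps (readParts .n))) <|
  expectEmpty .w

/-- A cell of the strip is kept. In deletion mode this must not happen after a removal. -/
def stay (del : Bool) : Prog Reg :=
  if del then pop .z (push .a true) (seq (push .z true) fail) (seq (push .z false) fail)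
  else push .a true

/-- Treat one symbol `true` of the gaps. -/
def rowTrue (del : Bool) : Prog Reg :=
  pop .u fail (seq (push .z true) (push .t true)) (seq (push .u false) (stay del))

/-- Treat one symbol `false` of the gaps. -/
def rowFalse : Prog Reg :=
  pop .u fail fail
    (seq (tally .b .t) (seq (push .t false) (tally .a .b)))

/-- Remove a strip, as told by `u`, and count its cells in `z`. -/
def row (del : Bool) : Prog Reg :=
  seq (drain .g (rowTrue del) rowFalse) <|
  seq (expectEmpty .b) <|
  seq (pour .t .g) (num .g skip)

/-- Change the parity. -/
def toggle : Prog Reg := pop .p (push .p true) skip skip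

/-- Skip an exponent of the alternant, which increases by one. -/
def skipExp : Prog Reg :=
  seq (peek .n) <|
  seq (num .n (push .t true)) <|
  seq (push .t true) <|
  seq (push .t false) <|
  seq (push .y true) toggle

/-- Remove the exponent of the alternant whose position is told by `u`, and add it to `z`. -/
def chooseExp : Prog Reg :=
  seq (peek .u) <|
  seq (num .u skipExp) <|
  seq (peek .n) <|
  seq (num .n (push .z true)) <|
  seq (pour .n .t) (pour .t .n)

/-- Fail if the numbers `y` and `z` are different. -/
def compare : Prog Reg :=
  seq (drain .z (pop .y fail skip skip) skip) (expectEmpty .y)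

/-- Treat one variable. -/
def step (del : Bool) : Prog Reg :=
  seq (peek .l) <|
  seq (num .l (push .y true)) <|
  seq (row del) <|
  seq chooseExp compare

/-- The final check: `u` has to be used up, and the parity has to be right. -/
def finish (odd : Bool) : Prog Reg :=
  seq (expectEmpty .u) (pop .p (if odd then fail else skip) (if odd then skip else fail) fail)

/-- The verifier. -/
def verifier (del odd : Bool) : Prog Reg :=
  seq (parse del) (seq (drain .c (step del) skip) (finish odd))

/-- Weights of the stacks for which the verifier is frugal: a symbol has to pay for the symbols that
are written when it is popped in a loop. A symbol of `x` is replaced by up to three symbols of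
weight `1`, and the first symbol of a number on `w` by two symbols of `x`. The stacks `f` and `p` never control a
loop, so their symbols may be free. -/
def weight : Reg → ℕ
  | .w0 => 6 | .w => 6 | .u0 => 3 | .u => 3 | .x => 3 | .f => 0 | .p => 0 | _ => 1

theorem wf_verifier (del odd : Bool) : (verifier del odd).wf = true := by
  cases del <;> cases odd <;> decide +kernel

theorem frugal_verifier (del odd : Bool) : (verifier del odd).frugal weight = true := by
  cases del <;> cases odd <;> decide +kernel

/-! ### Failures are permanent -/

/-- The program does not remove symbols from the stack `r`. -/
def keeps (r : Reg) : Prog Reg → Bool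
  | skip => true
  | push _ _ => true
  | pop q a b c => decide (q ≠ r) && keeps r a && keeps r b && keeps r c
  | seq a b => keeps r a && keeps r b
  | drain q a b => decide (q ≠ r) && keeps r a && keeps r b
  | num q a => decide (q ≠ r) && keeps r a

theorem drainLoop_ne_nil {r q : Reg} (h : q ≠ r) {f g : (Reg → List Bool) → Reg → List Bool}
    (hf : ∀ s, s r ≠ [] → f s r ≠ []) (hg : ∀ s, s r ≠ [] → g s r ≠ []) :
    ∀ l s, s r ≠ [] → drainLoop q f g l s r ≠ [] := by
  intro l
  induction l with
  | nil => intro s hs; simpa [drainLoop, Ne.symm h] using hs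
  | cons x l ih =>
    intro s hs
    cases x
    · exact ih _ (hg _ (by simpa [Ne.symm h] using hs))
    · exact ih _ (hf _ (by simpa [Ne.symm h] using hs))

/-- In particular, the flag `f` stays nonempty once a failure was recorded. -/
theorem eval_ne_nil {r : Reg} : ∀ {p : Prog Reg}, p.keeps r = true → ∀ s, s r ≠ [] →
    p.eval s r ≠ []
  | skip, _, _, hs => hs
  | push q b, _, s, hs => by
    by_cases h : r = q
    · subst h; simp [eval]
    · simpa [eval, h] using hs
  | pop q a b c, h, s, hs => by
    simp only [keeps, Bool.and_eq_true, decide_eq_true_eq] at h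
    obtain ⟨⟨⟨h0, ha⟩, hb⟩, hc⟩ := h
    have hu : ∀ l, Function.update s q l r ≠ [] := fun l => by simpa [Ne.symm h0] using hs
    rcases hq : s q with _ | ⟨_ | _, l⟩
    · simpa only [eval, hq] using eval_ne_nil ha _ (hu _)
    · simpa only [eval, hq] using eval_ne_nil hc _ (hu _)
    · simpa only [eval, hq] using eval_ne_nil hb _ (hu _)
  | seq a b, h, s, hs => by
    simp only [keeps, Bool.and_eq_true] at h
    exact eval_ne_nil h.2 _ (eval_ne_nil h.1 _ hs)
  | drain q a b, h, s, hs => by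
    simp only [keeps, Bool.and_eq_true, decide_eq_true_eq] at h
    exact drainLoop_ne_nil h.1.1 (eval_ne_nil h.1.2) (eval_ne_nil h.2) _ _ hs
  | num q a, h, s, hs => by
    simp only [keeps, Bool.and_eq_true, decide_eq_true_eq] at h
    have key : ∀ l s, s r ≠ [] → numLoop q (eval a) l s r ≠ [] := by
      intro l
      induction l with
      | nil => intro s hs; simpa [numLoop, Ne.symm h.1] using hs
      | cons x l ih =>
        intro s hs
        have hu : Function.update s q l r ≠ [] := by simpa [Ne.symm h.1] using hs
        cases x
        · exact hu
        · exact ih _ (eval_ne_nil h.2 _ hu)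
    exact key _ _ hs

/-! ### Simple loops -/

theorem drainLoop_update (r : Reg) (f g : (Reg → List Bool) → Reg → List Bool)
    (l m : List Bool) (s : Reg → List Bool) :
    drainLoop r f g l (Function.update s r m) = drainLoop r f g l s := by
  rcases l with _ | ⟨_ | _, l⟩ <;> simp [drainLoop]

theorem numLoop_update (r : Reg) (f : (Reg → List Bool) → Reg → List Bool)
    (l m : List Bool) (s : Reg → List Bool) :
    numLoop r f l (Function.update s r m) = numLoop r f l s := by
  rcases l with _ | ⟨_ | _, l⟩ <;> simp [numLoop]

theorem eval_num_push {r q : Reg} (h : r ≠ q) {b : Bool} {a : ℕ} {l : List Bool}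
    {s : Reg → List Bool} (hs : s r = List.replicate a true ++ false :: l) :
    eval (num r (push q b)) s =
      Function.update (Function.update s r l) q (List.replicate a b ++ s q) := by
  have key : ∀ (a : ℕ) (s : Reg → List Bool),
      numLoop r (eval (push q b)) (List.replicate a true ++ false :: l) s =
        Function.update (Function.update s r l) q (List.replicate a b ++ s q) := by
    intro a
    induction a with
    | zero =>
      intro s
      have : s q = Function.update s r l q := by simp [Ne.symm h]
      simp [numLoop, this]
    | succ a ih =>
      intro s
      rw [List.replicate_succ, List.cons_append, numLoop, eval, ih]
      simp [Function.update_comm h, Ne.symm h, List.replicate_succ']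
  rw [eval, hs, key]

theorem drainLoop_push {r q : Reg} (h : r ≠ q) (b b' : Bool) : ∀ (l : List Bool)
    (s : Reg → List Bool), drainLoop r (eval (push q b)) (eval (push q b')) l s =
      Function.update (Function.update s r []) q
        ((l.map fun x => if x then b else b').reverse ++ s q) := by
  intro l
  induction l with
  | nil => intro s; simp [drainLoop, Ne.symm h]
  | cons x l ih =>
    intro s
    cases x <;> rw [drainLoop, eval, ih] <;> simp [Function.update_comm h, Ne.symm h]

theorem eval_pour {r q : Reg} (h : r ≠ q) (s : Reg → List Bool) :
    eval (pour r q) s = Function.update (Function.update s r []) q ((s r).reverse ++ s q) := by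
  rw [pour, eval, drainLoop_push h]
  simp

theorem eval_tally {r q : Reg} (h : r ≠ q) (s : Reg → List Bool) :
    eval (tally r q) s =
      Function.update (Function.update s r []) q (List.replicate (s r).length true ++ s q) := by
  rw [tally, eval, drainLoop_push h]
  simp

theorem eval_clear (r : Reg) (s : Reg → List Bool) :
    eval (clear r) s = Function.update s r [] := by
  rw [clear, eval]
  exact drainLoop_skip r _ _

/-! ### Removal of a strip -/

/-- The numbers that the loop of `row` writes, when it starts with `e` remaining cells. -/
def rowOut : ℕ → List ℕ → List ℕ → List ℕ
  | e, g :: G, d :: D => (e + d) :: rowOut (g - d) G D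
  | _, _, _ => []

theorem rowOut_eq : ∀ (e : ℕ) (g d : ℕ) (G D : List ℕ), D.length = G.length →
    rowOut e (g :: G) (d :: D) = (e + d) :: newGaps (g :: G) (d :: D)
  | _, _, _, [], [], _ => by simp [rowOut, newGaps]
  | _, g, d, g' :: G, d' :: D, h => by
    rw [rowOut, rowOut_eq _ _ _ _ _ (by simpa using h)]
    simp [newGaps]

theorem replicate_append_true (k : ℕ) (l : List Bool) :
    List.replicate k true ++ true :: l = true :: (List.replicate k true ++ l) := by
  rw [← List.singleton_append, ← List.append_assoc, ← List.replicate_succ', List.replicate_succ,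
    List.cons_append]

/-- Cells that are removed: the certificate `u` offers further symbols `true`. -/
theorem row_moves (del : Bool) (rest u' : List Bool) : ∀ (k : ℕ) (s : Store),
    s.u = List.replicate k true ++ u' →
    drainLoop .g (eval (rowTrue del)) (eval rowFalse) (List.replicate k true ++ rest) s.fn =
      drainLoop .g (eval (rowTrue del)) (eval rowFalse) rest { s with
        u := u', z := List.replicate k true ++ s.z, t := List.replicate k true ++ s.t }.fn := by
  intro k
  induction k with
  | zero =>
    intro s hs
    simp at hs
    simp [← hs]
  | succ k ih =>
    intro s hs
    rw [List.replicate_succ, List.cons_append, drainLoop]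
    have h1 : eval (rowTrue del) (Function.update s.fn .g (List.replicate k true ++ rest)) =
        Function.update (Store.fn { s with
          u := List.replicate k true ++ u', z := true :: s.z, t := true :: s.t }) .g
            (List.replicate k true ++ rest) := by
      simp [rowTrue, eval, hs, List.replicate_succ]
    rw [h1, drainLoop_update, ih _ rfl]
    simp [replicate_append_true]

/-- Cells that are kept: the number on the certificate `u` is used up. -/
theorem row_stays (del : Bool) (rest u' : List Bool) : ∀ (k : ℕ) (s : Store),
    s.u = false :: u' → (del = true → s.z = []) →
    drainLoop .g (eval (rowTrue del)) (eval rowFalse) (List.replicate k true ++ rest) s.fn =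
      drainLoop .g (eval (rowTrue del)) (eval rowFalse) rest
        { s with a := List.replicate k true ++ s.a }.fn := by
  intro k
  induction k with
  | zero => intro s hs _; simp
  | succ k ih =>
    intro s hs hz
    rw [List.replicate_succ, List.cons_append, drainLoop]
    have h1 : eval (rowTrue del) (Function.update s.fn .g (List.replicate k true ++ rest)) =
        Function.update (Store.fn { s with a := true :: s.a }) .g
          (List.replicate k true ++ rest) := by
      cases del
      · simp [rowTrue, stay, eval, hs]
      · simp [rowTrue, stay, eval, hs, hz rfl]
    rw [h1, drainLoop_update, ih { s with a := true :: s.a } hs hz]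
    simp [replicate_append_true]

/-- The end of a gap: the cells that were kept of the gap before, in `b`, join the removed cells of
this gap, in `t`, and form a new gap; the cells that were kept of this gap move from `a` to `b`. -/
theorem row_end (del : Bool) (rest u' : List Bool) (s : Store) (hs : s.u = false :: u') :
    drainLoop .g (eval (rowTrue del)) (eval rowFalse) (false :: rest) s.fn =
      drainLoop .g (eval (rowTrue del)) (eval rowFalse) rest { s with
        u := u', a := [], b := List.replicate s.a.length true,
        t := false :: (List.replicate s.b.length true ++ s.t) }.fn := by
  rw [drainLoop]
  have h1 : eval rowFalse (Function.update s.fn .g rest) =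
      Function.update (Store.fn { s with
        u := u', a := [], b := List.replicate s.a.length true,
        t := false :: (List.replicate s.b.length true ++ s.t) }) .g rest := by
    simp [rowFalse, eval, hs, eval_tally]
  rw [h1, drainLoop_update]

/-- The loop of `row` succeeds if the certificate `u` starts with an admissible strip `D`. -/
theorem rowLoop_ok {del : Bool} {U : List ℕ} : ∀ {G D : List ℕ} {a e : ℕ} {s : Store},
    IsStep del a G D → (G = [] → e = 0) → s.u = unary (D ++ U) → s.z = List.replicate a true →
    s.a = [] → s.b = List.replicate e true →
    drainLoop .g (eval (rowTrue del)) (eval rowFalse) (unary G) s.fn = { s with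
      g := [], u := unary U, z := List.replicate (a + D.sum) true, b := [],
      t := (unary (rowOut e G D)).reverse ++ s.t }.fn := by
  intro G
  induction G with
  | nil =>
    intro D a e s h he hu hz ha hb
    cases D with
    | cons d D => exact h.elim
    | nil =>
      rw [he rfl] at hb
      rw [List.nil_append] at hu
      rw [List.replicate_zero] at hb
      simp [unary, drainLoop, rowOut, ← hu, ← hz]
      simp [hb]
  | cons g G ih =>
    intro D a e s h he hu hz ha hb
    cases D with
    | nil => exact h.elim
    | cons d D =>
      obtain ⟨h1, h2, h3, h4⟩ := h
      have hg : List.replicate g true = List.replicate d true ++ List.replicate (g - d) true := by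
        rw [← List.replicate_add, Nat.add_sub_cancel' h1]
      rw [List.cons_append, unary] at hu
      rw [unary, hg, List.append_assoc, row_moves del _ _ d s hu]
      have hstay : ∀ s' : Store, s'.u = false :: unary (D ++ U) →
          s'.z = List.replicate (a + d) true →
          drainLoop .g (eval (rowTrue del)) (eval rowFalse)
            (List.replicate (g - d) true ++ false :: unary G) s'.fn =
          drainLoop .g (eval (rowTrue del)) (eval rowFalse) (false :: unary G)
            { s' with a := List.replicate (g - d) true ++ s'.a }.fn := by
        intro s' hu' hz'
        by_cases h5 : g - d = 0
        · simp [h5]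
        · refine row_stays del _ _ _ s' hu' fun h6 => ?_
          rcases h3 h6 with h7 | h7
          · rw [hz', h7]; rfl
          · omega
      rw [hstay _ rfl (by simp [hz, Nat.add_comm a]), row_end del _ _ _ rfl,
        ih (e := g - d) h4 (fun h => by have := h2 h; omega) rfl (by simp [hz, Nat.add_comm a]) rfl
          (by simp [ha])]
      have hc : List.replicate e true ++ (List.replicate d true ++ s.t) =
          List.replicate d true ++ (List.replicate e true ++ s.t) := by
        rw [← List.append_assoc, ← List.append_assoc, ← List.replicate_add, ← List.replicate_add,
          Nat.add_comm]
      simp [rowOut, unary, hb, ha, hc, List.replicate_add, -List.replicate_append_replicate]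

/-- The three failures of the loop of `row`: the certificate ends, it asks for more cells than the gap
has, or a cell is kept after a removal in deletion mode. -/
theorem row_fail {del : Bool} {x : Bool} {l : List Bool} {s : Store}
    (h : s.u = [] ∨ x = false ∧ s.u.head? = some true ∨
      x = true ∧ s.u.head? = some false ∧ del = true ∧ s.z ≠ []) :
    drainLoop .g (eval (rowTrue del)) (eval rowFalse) (x :: l) s.fn .f ≠ [] := by
  have h1 : (rowTrue del).keeps .f = true := by cases del <;> decide
  have h2 : rowFalse.keeps .f = true := by decide
  have h3 := drainLoop_ne_nil (r := .f) (q := .g) (by decide) (eval_ne_nil h1) (eval_ne_nil h2) l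
  rcases h with h | ⟨rfl, h⟩ | ⟨rfl, h, rfl, hz⟩
  · cases x
    · exact h3 _ (by simp [rowFalse, fail, eval, h])
    · exact h3 _ (by simp [rowTrue, fail, eval, h])
  · obtain ⟨u', h⟩ := List.head?_eq_some_iff.1 h
    exact h3 _ (by simp [rowFalse, fail, eval, h])
  · obtain ⟨u', h⟩ := List.head?_eq_some_iff.1 h
    refine h3 _ ?_
    rcases hz' : s.z with _ | ⟨_ | _, z'⟩
    · exact absurd hz' hz
    · simp [rowTrue, stay, fail, eval, h, hz']
    · simp [rowTrue, stay, fail, eval, h, hz']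

/-- If the loop of `row` succeeds, then the certificate starts with an admissible strip. -/
theorem rowLoop_isStep {del : Bool} : ∀ {G U : List ℕ} {a e : ℕ} {s : Store},
    s.u = unary U → s.z = List.replicate a true → s.a = [] → s.b = List.replicate e true →
    drainLoop .g (eval (rowTrue del)) (eval rowFalse) (unary G) s.fn .f = [] →
    drainLoop .g (eval (rowTrue del)) (eval rowFalse) (unary G) s.fn .b = [] →
    (G = [] → e = 0) ∧ ∃ D U', U = D ++ U' ∧ IsStep del a G D := by
  intro G
  induction G with
  | nil =>
    intro U a e s hu hz ha hb hf hb'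
    simp [unary, drainLoop, hb] at hb'
    exact ⟨fun _ => hb', [], U, rfl, trivial⟩
  | cons g G ih =>
    intro U a e s hu hz ha hb hf hb'
    refine ⟨fun h => by simp at h, ?_⟩
    cases U with
    | nil =>
      have h1 : unary (g :: G) ≠ [] := by simp [unary]
      obtain ⟨x, l, h1⟩ := List.exists_cons_of_ne_nil h1
      rw [h1] at hf
      exact absurd hf (row_fail (Or.inl hu))
    | cons d U =>
      rw [unary] at hu
      by_cases hd : d ≤ g
      · have hg : List.replicate g true =
            List.replicate d true ++ List.replicate (g - d) true := by
          rw [← List.replicate_add, Nat.add_sub_cancel' hd]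
        rw [unary, hg, List.append_assoc, row_moves del _ _ d s hu] at hf hb'
        by_cases hbad : del = true ∧ a + d ≠ 0 ∧ g - d ≠ 0
        · obtain ⟨h1, h2, h3⟩ := hbad
          obtain ⟨k, hk⟩ := Nat.exists_eq_succ_of_ne_zero h3
          rw [hk, List.replicate_succ, List.cons_append] at hf
          refine absurd hf (row_fail (Or.inr (Or.inr ⟨rfl, rfl, h1, ?_⟩)))
          simp [hz]
          omega
        · have hstay : ∀ s' : Store, s'.u = false :: unary U →
              s'.z = List.replicate (a + d) true →
              drainLoop .g (eval (rowTrue del)) (eval rowFalse)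
                (List.replicate (g - d) true ++ false :: unary G) s'.fn =
              drainLoop .g (eval (rowTrue del)) (eval rowFalse) (false :: unary G)
                { s' with a := List.replicate (g - d) true ++ s'.a }.fn := by
            intro s' hu' hz'
            by_cases h5 : g - d = 0
            · simp [h5]
            · refine row_stays del _ _ _ s' hu' fun h6 => ?_
              have h7 : a + d = 0 := by
                by_contra h7
                exact hbad ⟨h6, h7, h5⟩
              rw [hz', h7]; rfl
          rw [hstay _ rfl (by simp [hz, Nat.add_comm a]), row_end del _ _ _ rfl] at hf hb'
          obtain ⟨h1, D, U', rfl, h2⟩ := ih (U := U) (a := a + d) (e := g - d) rfl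
            (by simp [hz, Nat.add_comm a]) rfl (by simp [ha]) hf hb'
          refine ⟨d :: D, U', rfl, hd, fun h => ?_, fun h => ?_, h2⟩
          · have := h1 h; omega
          · by_contra h3
            exact hbad ⟨h, by omega, by omega⟩
      · have hd' : List.replicate d true =
            List.replicate g true ++ List.replicate (d - g) true := by
          rw [← List.replicate_add, Nat.add_sub_cancel' (by omega)]
        rw [hd', List.append_assoc] at hu
        rw [unary, row_moves del _ _ g s hu] at hf
        refine absurd hf (row_fail (Or.inr (Or.inl ⟨rfl, ?_⟩)))
        obtain ⟨k, hk⟩ := Nat.exists_eq_succ_of_ne_zero (show d - g ≠ 0 by omega)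
        simp [hk, List.replicate_succ]

/-! ### Treatment of one variable -/

theorem eval_row_ok {del : Bool} {G D U : List ℕ} {s : Store} (h : IsStep del 0 G D)
    (hg : s.g = unary G) (hu : s.u = unary (D ++ U)) (hz : s.z = []) (ha : s.a = [])
    (hb : s.b = []) (ht : s.t = []) :
    (row del).eval s.fn = { s with
      g := unary (newGaps G D), u := unary U, z := List.replicate D.sum true }.fn := by
  have h1 := rowLoop_ok (s := s) (e := 0) h (fun _ => rfl) hu hz ha hb
  rw [← hg] at h1
  have h2 : eval (drain .g (rowTrue del) rowFalse) s.fn = { s with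
      g := [], u := unary U, z := List.replicate (0 + D.sum) true, b := [],
      t := (unary (rowOut 0 G D)).reverse ++ s.t }.fn := h1
  rw [row, eval, h2]
  cases G with
  | nil =>
    cases D with
    | nil => simp [eval, expectEmpty, eval_tally, eval_pour, rowOut, newGaps, numLoop, ht, hb, unary]
    | cons d D => exact h.elim
  | cons g G =>
    cases D with
    | nil => exact h.elim
    | cons d D =>
      rw [rowOut_eq _ _ _ _ _ (by simpa using h.length_eq)]
      simp only [eval, expectEmpty, eval_tally (show Reg.b ≠ Reg.f by decide),
        eval_pour (show Reg.t ≠ Reg.g by decide)]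
      have h3 : ∀ a : ℕ, ∀ m s', numLoop Reg.g (fun s => s) (List.replicate a true ++ m) s' =
          numLoop Reg.g (fun s => s) m s' := by
        intro a m
        induction a with
        | zero => simp
        | succ a ih => intro s'; simp [List.replicate_succ, numLoop, ih, numLoop_update]
      simp [ht, hb, unary, numLoop, h3]

theorem keeps_step (del : Bool) : (step del).keeps .f = true := by cases del <;> decide

theorem isStep_of_eval_row {del : Bool} {G U : List ℕ} {s : Store}
    (hg : s.g = unary G) (hu : s.u = unary U) (hz : s.z = []) (ha : s.a = []) (hb : s.b = [])
    (hf : (row del).eval s.fn .f = []) : ∃ D U', U = D ++ U' ∧ IsStep del 0 G D := by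
  have h1 : eval (drain .g (rowTrue del) rowFalse) s.fn .f = [] := by
    by_contra h
    exact eval_ne_nil (p := seq (expectEmpty .b) (seq (pour .t .g) (num .g skip))) (by decide) _ h hf
  have h2 : eval (drain .g (rowTrue del) rowFalse) s.fn .b = [] := by
    by_contra h
    refine eval_ne_nil (r := .f) (p := seq (pour .t .g) (num .g skip)) (by decide)
      (eval (expectEmpty .b) (eval (drain .g (rowTrue del) rowFalse) s.fn)) ?_ hf
    simp [expectEmpty, eval_tally, h]
  simp only [eval] at h1 h2
  rw [show s.fn .g = unary G from hg] at h1 h2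
  exact (rowLoop_isStep (a := 0) (e := 0) hu hz ha hb h1 h2).2

/-- The stack that represents a parity. -/
def parity (b : Bool) : List Bool := if b then [true] else []

theorem unary_append (l m : List ℕ) : unary (l ++ m) = unary l ++ unary m := by
  induction l with
  | nil => rfl
  | cons a l ih => simp [unary, ih]

theorem eval_peek {r : Reg} {s : Reg → List Bool} (h : s r ≠ []) : (peek r).eval s = s := by
  rcases hs : s r with _ | ⟨_ | _, l⟩
  · exact absurd hs h
  all_goals
    have h1 := Function.update_eq_self r s
    rw [hs] at h1
    simp [peek, eval, hs, h1]

theorem eval_peek_fail {r : Reg} {s : Reg → List Bool} (h : s r = []) :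
    (peek r).eval s .f ≠ [] := by
  simp [peek, fail, eval, h]

theorem unary_cons_ne_nil (a : ℕ) (l : List ℕ) : unary (a :: l) ≠ [] := by simp [unary]

theorem eval_skipExp {N : List ℕ} {a : ℕ} {par : Bool} {s : Store} (hn : s.n = unary (a :: N))
    (hp : s.p = parity par) :
    skipExp.eval s.fn = { s with
      n := unary N, t := (unary [a + 1]).reverse ++ s.t, y := true :: s.y,
      p := parity (!par) }.fn := by
  have h0 : s.fn .n ≠ [] := by rw [Store.fn, hn]; exact unary_cons_ne_nil _ _
  have h1 : s.fn .n = List.replicate a true ++ false :: unary N := hn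
  simp only [skipExp, eval, eval_peek h0]
  have h2 := eval_num_push (q := .t) (by decide) (b := true) h1
  simp only [eval] at h2
  rw [h2]
  cases par <;> simp [toggle, eval, hp, parity, unary, List.replicate_succ, replicate_append_true]

/-- The loop of `chooseExp` moves the exponents before position `c` to `t`, increased by one. -/
theorem skipLoop_ok {U : List Bool} : ∀ {c : ℕ} {N : List ℕ} {par : Bool} {s : Store},
    c ≤ N.length → s.n = unary N → s.p = parity par →
    numLoop .u (eval skipExp) (List.replicate c true ++ false :: U) s.fn = { s with
      u := U, n := unary (N.drop c), t := (unary ((N.take c).map (· + 1))).reverse ++ s.t,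
      y := List.replicate c true ++ s.y, p := parity (par ^^ decide (c % 2 = 1)) }.fn := by
  intro c
  induction c with
  | zero => intro N par s _ hn hp; simp [numLoop, hn, hp, unary]
  | succ c ih =>
    intro N par s hc hn hp
    cases N with
    | nil => simp at hc
    | cons a N =>
      rw [List.replicate_succ, List.cons_append, numLoop, Store.update_fn,
        eval_skipExp (N := N) (a := a) (par := par) (by exact hn) (by exact hp),
        ih (N := N) (par := !par) (by simpa using hc) rfl rfl]
      have h : (!par ^^ decide (c % 2 = 1)) = (par ^^ decide ((c + 1) % 2 = 1)) := by
        rcases Nat.mod_two_eq_zero_or_one c with h | h <;>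
          simp [Nat.add_mod, h]
      simp [h, unary, replicate_append_true]

theorem skipLoop_fail {U : List Bool} : ∀ {c : ℕ} {N : List ℕ} {par : Bool} {s : Store},
    N.length < c → s.n = unary N → s.p = parity par →
    numLoop .u (eval skipExp) (List.replicate c true ++ false :: U) s.fn .f ≠ [] := by
  intro c
  induction c with
  | zero => intro N par s hc; simp at hc
  | succ c ih =>
    intro N par s hc hn hp
    cases N with
    | nil =>
      have h1 : ∀ l s, numLoop Reg.u (eval skipExp) l s =
          eval (num .u skipExp) (Function.update s .u l) := fun l s => by
        simp [eval, numLoop_update]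
      rw [List.replicate_succ, List.cons_append, numLoop, h1]
      refine eval_ne_nil (by decide) _ ?_
      rw [Function.update_of_ne (by decide), skipExp, eval]
      exact eval_ne_nil (by decide) _ (eval_peek_fail (by simp [hn, unary]))
    | cons a N =>
      rw [List.replicate_succ, List.cons_append, numLoop, Store.update_fn,
        eval_skipExp (N := N) (a := a) (par := par) (by exact hn) (by exact hp)]
      exact ih (N := N) (par := !par) (by simpa using hc) rfl rfl

theorem eval_chooseExp_ok {c : ℕ} {N U : List ℕ} {par : Bool} {s : Store}
    (hc : c < N.length) (hu : s.u = unary (c :: U)) (hn : s.n = unary N) (ht : s.t = [])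
    (hp : s.p = parity par) :
    chooseExp.eval s.fn = { s with
      u := unary U, n := unary (newExps N c), z := List.replicate (N.getD c 0) true ++ s.z,
      y := List.replicate c true ++ s.y, p := parity (par ^^ decide (c % 2 = 1)) }.fn := by
  have h0 : s.fn .u ≠ [] := by rw [Store.fn, hu]; exact unary_cons_ne_nil _ _
  have h1 : s.fn .u = List.replicate c true ++ false :: unary U := hu
  simp only [chooseExp, eval, eval_peek h0]
  rw [h1, skipLoop_ok hc.le hn hp]
  have hd : N.drop c = N.getD c 0 :: N.drop (c + 1) := by
    rw [List.drop_eq_getElem_cons hc, List.getD_eq_getElem _ _ hc]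
  rw [hd, eval_peek (unary_cons_ne_nil _ _)]
  have h2 := eval_num_push (r := .n) (q := .z) (by decide) (b := true) (a := N.getD c 0)
    (l := unary (N.drop (c + 1))) (s := Store.fn { s with
      u := unary U, n := unary (N.getD c 0 :: N.drop (c + 1)),
      t := (unary ((N.take c).map (· + 1))).reverse ++ s.t,
      y := List.replicate c true ++ s.y, p := parity (par ^^ decide (c % 2 = 1)) }) rfl
  simp only [eval] at h2
  rw [h2, eval_pour (by decide), eval_pour (by decide)]
  simp [ht, newExps, unary_append]

theorem eval_compare_ok {k : ℕ} {s : Store} (hz : s.z = List.replicate k true)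
    (hy : s.y = List.replicate k true) : compare.eval s.fn = { s with z := [], y := [] }.fn := by
  have key : ∀ (k : ℕ) (s : Store), s.y = List.replicate k true →
      drainLoop .z (eval (pop .y fail skip skip)) (eval skip) (List.replicate k true) s.fn =
        { s with z := [], y := [] }.fn := by
    intro k
    induction k with
    | zero => intro s hs; simp [drainLoop, show s.y = [] from hs]
    | succ k ih =>
      intro s hs
      rw [List.replicate_succ, drainLoop]
      have h1 : eval (pop .y fail skip skip) (Function.update s.fn .z (List.replicate k true)) =
          Function.update (Store.fn { s with y := List.replicate k true }) .z
            (List.replicate k true) := by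
        simp [eval, hs, List.replicate_succ]
      rw [h1, drainLoop_update, ih _ rfl]
  have h := key k s hy
  rw [← hz] at h
  rw [compare, eval, eval, show s.fn .z = s.z from rfl, h]
  simp [expectEmpty, eval_tally]

theorem eval_compare_eq {j k : ℕ} {s : Store} (hz : s.z = List.replicate j true)
    (hy : s.y = List.replicate k true) (hf : compare.eval s.fn .f = []) : j = k := by
  have key : ∀ (j k : ℕ) (s : Store), s.y = List.replicate k true →
      (eval (expectEmpty .y) (drainLoop .z (eval (pop .y fail skip skip)) (eval skip)
        (List.replicate j true) s.fn)) .f = [] → j = k := by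
    intro j
    induction j with
    | zero =>
      intro k s hs hf
      simp [drainLoop, expectEmpty, eval_tally, hs] at hf
      exact hf.1.symm
    | succ j ih =>
      intro k s hs hf
      rw [List.replicate_succ, drainLoop] at hf
      cases k with
      | zero =>
        refine absurd hf (eval_ne_nil (by decide) _ (drainLoop_ne_nil (by decide)
          (eval_ne_nil (p := pop .y fail skip skip) (by decide))
          (eval_ne_nil (p := skip) (by decide)) _ _ ?_))
        simp [eval, hs, fail]
      | succ k =>
        have h1 : eval (pop .y fail skip skip) (Function.update s.fn .z (List.replicate j true)) =
            Function.update (Store.fn { s with y := List.replicate k true }) .z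
              (List.replicate j true) := by
          simp [eval, hs, List.replicate_succ]
        rw [h1, drainLoop_update] at hf
        rw [ih k _ rfl hf]
  refine key j k s hy ?_
  rw [← hz]
  exact hf

theorem chooseExp_exists {N U : List ℕ} {par : Bool} {s : Store}
    (hu : s.u = unary U) (hn : s.n = unary N) (hp : s.p = parity par)
    (hf : chooseExp.eval s.fn .f = []) : ∃ c U', U = c :: U' ∧ c < N.length := by
  cases U with
  | nil =>
    rw [chooseExp, eval] at hf
    exact absurd hf (eval_ne_nil (by decide) _ (eval_peek_fail (by simp [hu, unary])))
  | cons c U =>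
    refine ⟨c, U, rfl, ?_⟩
    have h0 : s.fn .u ≠ [] := by rw [Store.fn, hu]; exact unary_cons_ne_nil _ _
    have h1 : s.fn .u = List.replicate c true ++ false :: unary U := hu
    have h3 : eval (num .u skipExp) s.fn =
        numLoop .u (eval skipExp) (List.replicate c true ++ false :: unary U) s.fn := by
      rw [eval, h1]
    rw [chooseExp, eval, eval_peek h0, eval, h3] at hf
    by_contra hc
    rcases Nat.lt_or_ge N.length c with h2 | h2
    · exact eval_ne_nil (by decide) _ (skipLoop_fail h2 hn hp) hf
    · rw [skipLoop_ok h2 hn hp, eval] at hf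
      refine eval_ne_nil (by decide) _ (eval_peek_fail ?_) hf
      simp [List.drop_eq_nil_of_le (show N.length ≤ c by omega), unary]

/-- The stacks between the treatment of two variables. -/
def mainStore (k : ℕ) (L G N U : List ℕ) (par : Bool) : Store :=
  { c := List.replicate k true, l := unary L, g := unary G, n := unary N, u := unary U,
    p := parity par }

theorem eval_num_l_y (l : ℕ) (L G N U : List ℕ) (k : ℕ) (par : Bool) :
    eval (num .l (push .y true)) (eval (peek .l) (mainStore k (l :: L) G N U par).fn) =
      { mainStore k L G N U par with y := List.replicate l true }.fn := by
  rw [eval_peek (unary_cons_ne_nil l L),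
    eval_num_push (a := l) (l := unary L) (q := .y) (by decide) rfl]
  simp [mainStore]

theorem eval_step_ok {del : Bool} {k l c : ℕ} {L G N D U : List ℕ} {par : Bool}
    (hD : IsStep del 0 G D) (hc : c < N.length) (h : D.sum + N.getD c 0 = l + c) :
    (step del).eval (mainStore k (l :: L) G N (D ++ c :: U) par).fn =
      (mainStore k L (newGaps G D) (newExps N c) U (par ^^ decide (c % 2 = 1))).fn := by
  rw [step, eval, eval, eval_num_l_y, eval,
    eval_row_ok (G := G) (D := D) (U := c :: U) hD rfl rfl rfl rfl rfl rfl, eval,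
    eval_chooseExp_ok (c := c) (N := N) (U := U) (par := par) hc rfl rfl rfl rfl,
    eval_compare_ok (k := l + c)]
  · rfl
  · simp [← h, Nat.add_comm]
  · simp [Nat.add_comm]

/-- If the treatment of a variable succeeds, then the certificate contains a strip and a position. -/
theorem eval_step_exists {del : Bool} {k : ℕ} {L G N U : List ℕ} {par : Bool}
    (hf : (step del).eval (mainStore k L G N U par).fn .f = []) :
    ∃ l L' D c U', L = l :: L' ∧ U = D ++ c :: U' ∧ IsStep del 0 G D ∧ c < N.length ∧
      D.sum + N.getD c 0 = l + c := by
  cases L with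
  | nil =>
    rw [step, eval] at hf
    exact absurd hf (eval_ne_nil (by cases del <;> decide) _ (eval_peek_fail rfl))
  | cons l L =>
    rw [step, eval, eval, eval_num_l_y, eval] at hf
    have h1 : (row del).eval
        { mainStore k L G N U par with y := List.replicate l true }.fn .f = [] := by
      by_contra h
      exact eval_ne_nil (by decide) _ h hf
    obtain ⟨D, U', rfl, hD⟩ := isStep_of_eval_row (G := G) (U := U) rfl rfl rfl rfl rfl h1
    rw [eval_row_ok (G := G) (D := D) (U := U') hD rfl rfl rfl rfl rfl rfl, eval] at hf
    have h2 : chooseExp.eval { mainStore k L G N (D ++ U') par with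
        y := List.replicate l true, g := unary (newGaps G D), u := unary U',
        z := List.replicate D.sum true }.fn .f = [] := by
      by_contra h
      exact eval_ne_nil (by decide) _ h hf
    obtain ⟨c, U, rfl, hc⟩ := chooseExp_exists (U := U') (N := N) (par := par) rfl rfl rfl h2
    rw [eval_chooseExp_ok (c := c) (N := N) (U := U) (par := par) hc rfl rfl rfl rfl] at hf
    have h3 := eval_compare_eq (j := N.getD c 0 + D.sum) (k := c + l) (by simp) (by simp) hf
    exact ⟨l, L, D, c, U, rfl, rfl, hD, hc, by omega⟩

/-- The main part of the verifier accepts exactly the sequences of choices. -/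
theorem eval_main_iff {del odd : Bool} : ∀ {L G N U : List ℕ} {par : Bool},
    eval (seq (drain .c (step del) skip) (finish odd)) (mainStore L.length L G N U par).fn .f = [] ↔
      U ∈ wits del (odd ^^ par) L G N := by
  have hk : (finish odd).keeps .f = true := by cases odd <;> decide
  have hloop : ∀ (s : Store) (m : List Bool),
      Function.update s.fn .c m = { s with c := m }.fn := fun s m => by simp
  intro L
  induction L with
  | nil =>
    intro G N U par
    have h1 : eval (seq (drain .c (step del) skip) (finish odd)) (mainStore 0 [] G N U par).fn =
        eval (finish odd) (mainStore 0 [] G N U par).fn := by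
      simp [eval, drainLoop, mainStore]
    rw [List.length_nil, h1]
    cases U with
    | nil => cases odd <;> cases par <;>
        simp [finish, expectEmpty, eval_tally, eval, mainStore, parity, fail, wits, unary]
    | cons u U =>
      constructor
      · intro hf
        rw [finish, eval] at hf
        refine absurd hf (eval_ne_nil (by cases odd <;> decide) _ ?_)
        rw [expectEmpty, eval_tally (by decide)]
        simp [mainStore, unary]
      · intro h
        cases h2 : (odd ^^ par) <;> rw [h2] at h <;> simp [wits] at h
  | cons l L ih =>
    intro G N U par
    have h1 : eval (seq (drain .c (step del) skip) (finish odd))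
        (mainStore (l :: L).length (l :: L) G N U par).fn =
        eval (finish odd) (drainLoop .c (eval (step del)) (eval skip) (List.replicate L.length true)
          (eval (step del) (mainStore L.length (l :: L) G N U par).fn)) := by
      rw [eval, eval]
      have h2 : (mainStore (l :: L).length (l :: L) G N U par).fn .c =
          true :: List.replicate L.length true := by simp [mainStore, List.replicate_succ]
      rw [h2, drainLoop, hloop]
      rfl
    have h3 : ∀ (G N U : List ℕ) (par : Bool),
        eval (finish odd) (drainLoop .c (eval (step del)) (eval skip)
          (List.replicate L.length true) (mainStore L.length L G N U par).fn) =
        eval (seq (drain .c (step del) skip) (finish odd)) (mainStore L.length L G N U par).fn := by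
      intro G N U par
      rw [eval, eval]
      rfl
    rw [h1, mem_wits_cons]
    constructor
    · intro hf
      have h4 : eval (step del) (mainStore L.length (l :: L) G N U par).fn .f = [] := by
        by_contra h
        exact eval_ne_nil hk _ (drainLoop_ne_nil (by decide) (eval_ne_nil (keeps_step del))
          (eval_ne_nil (p := skip) (by decide)) _ _ h) hf
      obtain ⟨l', L', D, c, U, hL, rfl, hD, hc, h⟩ := eval_step_exists h4
      obtain ⟨rfl, rfl⟩ := List.cons.inj hL
      rw [eval_step_ok hD hc h, h3, ih] at hf
      refine ⟨D, c, U, rfl, hD, hc, h, ?_⟩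
      rwa [Bool.xor_assoc]
    · rintro ⟨D, c, U, rfl, hD, hc, h, hU⟩
      rw [eval_step_ok hD hc h, h3, ih]
      rwa [Bool.xor_assoc] at hU

/-! ### Reading the input -/

/-- The loop of `blockIn` succeeds if and only if there are enough numbers. -/
theorem blockIn_loop {body : Prog Reg}
    (hbody : body = seq (push .d true)
      (pop .w fail (seq (push .x false) (seq (push .x true) (num .w (push .x true))))
        (push .x false))) :
    ∀ {n : ℕ} {M X : List ℕ} {s : Store}, s.w = unary M → s.x = unary X →
      (n ≤ M.length →
        drainLoop .c (eval body) (eval skip) (List.replicate n true) s.fn = { s with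
          c := [], d := List.replicate n true ++ s.d, w := unary (M.drop n),
          x := unary ((M.take n).reverse ++ X) }.fn) ∧
      (M.length < n → drainLoop .c (eval body) (eval skip) (List.replicate n true) s.fn .f ≠ []) := by
  have hkeep : body.keeps .f = true := by subst hbody; decide
  intro n
  induction n with
  | zero =>
    intro M X s hw hx
    refine ⟨fun _ => ?_, fun h => by simp at h⟩
    simp [drainLoop, ← hw, ← hx]
  | succ n ih =>
    intro M X s hw hx
    rw [List.replicate_succ, drainLoop, Store.update_fn]
    cases M with
    | nil =>
      refine ⟨fun h => by simp at h, fun _ => ?_⟩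
      refine drainLoop_ne_nil (by decide) (eval_ne_nil hkeep)
        (eval_ne_nil (p := skip) (by decide)) _ _ ?_
      rw [hbody]
      simp [eval, hw, unary, fail]
    | cons m M =>
      have h1 : eval body (Store.fn (s.set .c (List.replicate n true))) = Store.fn { s with
          c := List.replicate n true, d := true :: s.d, w := unary M, x := unary (m :: X) } := by
        rw [hbody]
        cases m with
        | zero => simp [eval, hw, hx, unary]
        | succ m =>
          have h2 := eval_num_push (r := .w) (q := .x) (b := true) (by decide) (a := m)
            (l := unary M) (s := Store.fn { s with
              c := List.replicate n true, d := true :: s.d,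
              w := List.replicate m true ++ false :: unary M, x := true :: false :: unary X }) rfl
          simp only [eval] at h2
          simp only [eval, hw, hx, unary, List.replicate_succ, Store.update_fn, Store.set, Store.fn,
            List.cons_append]
          refine h2.trans ?_
          simp [replicate_append_true]
      rw [h1]
      obtain ⟨h2, h3⟩ := ih (M := M) (X := m :: X) (s := { s with
          c := List.replicate n true, d := true :: s.d, w := unary M, x := unary (m :: X) }) rfl rfl
      refine ⟨fun h => ?_, fun h => h3 (by simpa using h)⟩
      rw [h2 (by simpa using h)]
      simp [replicate_append_true]

theorem eval_blockIn_ok {n : ℕ} {M : List ℕ} {s : Store} (h : n ≤ M.length) (hw : s.w = unary M)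
    (hx : s.x = []) (hc : s.c = List.replicate n true) (hd : s.d = []) :
    blockIn.eval s.fn = { s with
      w := unary (M.drop n), x := unary (M.take n).reverse }.fn := by
  have h1 := (blockIn_loop rfl (n := n) (X := []) hw hx).1 h
  rw [blockIn, eval, eval, show s.fn .c = List.replicate n true from hc, h1, eval_tally (by decide)]
  simp [hc, hd]

theorem le_length_of_blockIn {n : ℕ} {M : List ℕ} {s : Store} (hw : s.w = unary M)
    (hx : s.x = []) (hc : s.c = List.replicate n true) (hf : blockIn.eval s.fn .f = []) :
    n ≤ M.length := by
  by_contra h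
  have h1 := (blockIn_loop rfl (n := n) (X := []) hw hx).2 (by omega)
  rw [blockIn, eval, eval, show s.fn .c = List.replicate n true from hc] at hf
  exact eval_ne_nil (by decide) _ h1 hf

/-- The body of the loop of `blockOut` at a symbol `true`. -/
abbrev outTrue : Prog Reg :=
  seq (push .z true) (seq (push .b true) (pop .a (push .y true) skip skip))

/-- The body of the loop of `blockOut` at a symbol `false`. -/
abbrev outFalse : Prog Reg :=
  seq (expectEmpty .a) (seq (tally .b .a) (seq (push .z false) (push .y false)))

theorem outTrue_loop (rest : List Bool) : ∀ (r e : ℕ) (s : Store), s.a = List.replicate e true →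
    drainLoop .x (eval outTrue) (eval outFalse) (List.replicate r true ++ rest) s.fn =
      drainLoop .x (eval outTrue) (eval outFalse) rest { s with
        z := List.replicate r true ++ s.z, b := List.replicate r true ++ s.b,
        a := List.replicate (e - r) true, y := List.replicate (r - e) true ++ s.y }.fn := by
  intro r
  induction r with
  | zero => intro e s ha; simp [← ha]
  | succ r ih =>
    intro e s ha
    rw [List.replicate_succ, List.cons_append, drainLoop]
    cases e with
    | zero =>
      have h1 : eval outTrue (Function.update s.fn .x (List.replicate r true ++ rest)) =
          Function.update (Store.fn { s with
            z := true :: s.z, b := true :: s.b, y := true :: s.y, a := [] }) .x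
              (List.replicate r true ++ rest) := by
        simp [eval, ha]
      rw [h1, drainLoop_update, ih 0 _ rfl]
      simp [replicate_append_true, List.replicate_succ]
    | succ e =>
      have h1 : eval outTrue (Function.update s.fn .x (List.replicate r true ++ rest)) =
          Function.update (Store.fn { s with
            z := true :: s.z, b := true :: s.b, a := List.replicate e true }) .x
              (List.replicate r true ++ rest) := by
        simp [eval, ha, List.replicate_succ]
      rw [h1, drainLoop_update, ih e _ rfl]
      simp [replicate_append_true]

/-- Treatment of one number in `blockOut`, where `a` holds the number `e` that was read before: the
stack `y` gets the difference, and if the difference is negative, a failure is recorded. -/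
theorem out_number (rest : List Bool) (r e : ℕ) (s : Store) (ha : s.a = List.replicate e true)
    (hb : s.b = []) :
    drainLoop .x (eval outTrue) (eval outFalse) (List.replicate r true ++ false :: rest) s.fn =
      drainLoop .x (eval outTrue) (eval outFalse) rest { s with
        z := false :: (List.replicate r true ++ s.z), a := List.replicate r true,
        y := false :: (List.replicate (r - e) true ++ s.y),
        f := List.replicate (e - r) true ++ s.f }.fn := by
  rw [outTrue_loop _ r e s ha, drainLoop]
  have h1 : eval outFalse (Function.update (Store.fn { s with
        z := List.replicate r true ++ s.z, b := List.replicate r true ++ s.b,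
        a := List.replicate (e - r) true, y := List.replicate (r - e) true ++ s.y }) .x rest) =
      Function.update (Store.fn { s with
        z := false :: (List.replicate r true ++ s.z), a := List.replicate r true,
        y := false :: (List.replicate (r - e) true ++ s.y),
        f := List.replicate (e - r) true ++ s.f }) .x rest := by
    simp [eval, expectEmpty, eval_tally, hb]
  rw [h1, drainLoop_update]

theorem out_loop : ∀ {R Z : List ℕ} {s : Store}, s.a = List.replicate (Z.headD 0) true →
    s.b = [] → s.z = false :: unary Z → s.y = false :: unary (gapsOf Z) → Decr Z →
    (Decr (R.reverse ++ Z) →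
      drainLoop .x (eval outTrue) (eval outFalse) (unary R) s.fn = { s with
        x := [], z := false :: unary (R.reverse ++ Z), y := false :: unary (gapsOf (R.reverse ++ Z)),
        a := List.replicate ((R.reverse ++ Z).headD 0) true }.fn) ∧
    (drainLoop .x (eval outTrue) (eval outFalse) (unary R) s.fn .f = [] →
      Decr (R.reverse ++ Z)) := by
  intro R
  induction R with
  | nil =>
    intro Z s ha hb hz hy hZ
    refine ⟨fun _ => ?_, fun _ => hZ⟩
    simp only [unary, drainLoop, List.reverse_nil, List.nil_append, ← ha, ← hz, ← hy]
    simp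
  | cons r R ih =>
    intro Z s ha hb hz hy hZ
    rw [unary, out_number _ r _ s ha hb, List.reverse_cons, List.append_assoc,
      List.singleton_append]
    by_cases h : Z.headD 0 ≤ r
    · have h0 : Z.headD 0 - r = 0 := by omega
      obtain ⟨h1, h2⟩ := ih (Z := r :: Z) (s := { s with
        z := false :: (List.replicate r true ++ s.z), a := List.replicate r true,
        y := false :: (List.replicate (r - Z.headD 0) true ++ s.y),
        f := List.replicate (Z.headD 0 - r) true ++ s.f }) rfl hb (by simp [hz, unary])
        (by simp [hy, unary, gapsOf]) ⟨h, hZ⟩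
      refine ⟨fun h3 => ?_, h2⟩
      rw [h1 h3]
      simp only [h0, List.replicate_zero, List.nil_append]
    · refine ⟨fun h3 => absurd (Decr.of_append h3).1 h, fun h3 => absurd h3 ?_⟩
      refine drainLoop_ne_nil (by decide) (eval_ne_nil (by decide)) (eval_ne_nil (by decide)) _ _ ?_
      intro h4
      have h5 : List.replicate (Z.headD 0 - r) true ++ s.f = [] := h4
      have h6 := congrArg List.length h5
      simp only [List.length_append, List.length_replicate, List.length_nil] at h6
      omega

theorem eval_blockOut {R : List ℕ} {s : Store} (hx : s.x = unary R) (ha : s.a = [])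
    (hb : s.b = []) (hy : s.y = []) (hz : s.z = []) :
    (Decr R.reverse → blockOut.eval s.fn = { s with
      x := [], z := unary R.reverse, y := unary (gapsOf R.reverse) }.fn) ∧
    (blockOut.eval s.fn .f = [] → Decr R.reverse) := by
  obtain ⟨h1, h2⟩ := out_loop (R := R) (Z := []) (s := { s with z := [false], y := [false] })
    ha hb rfl rfl trivial
  have h0 : blockOut.eval s.fn =
      eval (seq (clear .a) (seq (num .z skip) (num .y skip)))
        (drainLoop .x (eval outTrue) (eval outFalse) (unary R)
          (Store.fn { s with z := [false], y := [false] })) := by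
    rw [← hx]
    simp [blockOut, eval, hy, hz]
  rw [List.append_nil] at h1 h2
  rw [h0]
  refine ⟨fun h => ?_, fun h => h2 ?_⟩
  · rw [h1 h]
    simp [eval, eval_clear, numLoop, ha]
  · by_contra h3
    exact eval_ne_nil (by decide) _ h3 h

/-- A partition can be read from the stack `w`. -/
def Readable (n : ℕ) (M : List ℕ) : Prop := n ≤ M.length ∧ Decr (M.take n)

theorem eval_block {n : ℕ} {M : List ℕ} {s : Store} (hw : s.w = unary M) (hx : s.x = [])
    (hc : s.c = List.replicate n true) (hd : s.d = []) (ha : s.a = [])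
    (hb : s.b = []) (hy : s.y = []) (hz : s.z = []) :
    (Readable n M → block.eval s.fn = { s with
      w := unary (M.drop n), z := unary (M.take n), y := unary (gapsOf (M.take n)) }.fn) ∧
    (block.eval s.fn .f = [] → Readable n M) := by
  constructor
  · rintro ⟨h1, h2⟩
    obtain ⟨h3, -⟩ := eval_blockOut (R := (M.take n).reverse)
      (s := { s with w := unary (M.drop n), x := unary (M.take n).reverse }) rfl ha hb hy hz
    rw [block, eval, eval_blockIn_ok h1 hw hx hc hd, h3 (by simpa using h2)]
    simp [hx]
  · intro hf
    rw [block, eval] at hf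
    have h1 : n ≤ M.length := le_length_of_blockIn hw hx hc (by
      by_contra h
      exact eval_ne_nil (by decide) _ h hf)
    refine ⟨h1, ?_⟩
    rw [eval_blockIn_ok h1 hw hx hc hd] at hf
    obtain ⟨-, h3⟩ := eval_blockOut (R := (M.take n).reverse)
      (s := { s with w := unary (M.drop n), x := unary (M.take n).reverse }) rfl ha hb hy hz
    simpa using h3 hf

/-- The stacks while the input is read. -/
def parseStore (n : ℕ) (W U : List ℕ) (l g e : List Bool) : Store :=
  { c := List.replicate n true, w := unary W, u := unary U, l := l, g := g, n := e }

theorem eval_readParts_l {n : ℕ} {M U : List ℕ} {g e : List Bool} :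
    (Readable n M → (readParts .l).eval (parseStore n M U [] g e).fn =
      (parseStore n (M.drop n) U (unary (M.take n)) g e).fn) ∧
    ((readParts .l).eval (parseStore n M U [] g e).fn .f = [] → Readable n M) := by
  obtain ⟨h1, h2⟩ := eval_block (s := parseStore n M U [] g e) (n := n) (M := M)
    rfl rfl rfl rfl rfl rfl rfl rfl
  constructor
  · intro h
    rw [readParts, eval, h1 h]
    simp [eval, eval_pour, eval_clear, parseStore]
  · intro hf
    refine h2 ?_
    by_contra h
    exact eval_ne_nil (by decide) _ h hf

theorem eval_readParts_n {n : ℕ} {M U : List ℕ} {l g : List Bool} :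
    (Readable n M → (readParts .n).eval (parseStore n M U l g []).fn =
      (parseStore n (M.drop n) U l g (unary (M.take n))).fn) ∧
    ((readParts .n).eval (parseStore n M U l g []).fn .f = [] → Readable n M) := by
  obtain ⟨h1, h2⟩ := eval_block (s := parseStore n M U l g []) (n := n) (M := M)
    rfl rfl rfl rfl rfl rfl rfl rfl
  constructor
  · intro h
    rw [readParts, eval, h1 h]
    simp [eval, eval_pour, eval_clear, parseStore]
  · intro hf
    refine h2 ?_
    by_contra h
    exact eval_ne_nil (by decide) _ h hf

theorem eval_readGaps {n : ℕ} {M U : List ℕ} {l e : List Bool} :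
    (Readable n M → readGaps.eval (parseStore n M U l [] e).fn =
      (parseStore n (M.drop n) U l (unary (gapsOf (M.take n))) e).fn) ∧
    (readGaps.eval (parseStore n M U l [] e).fn .f = [] → Readable n M) := by
  obtain ⟨h1, h2⟩ := eval_block (s := parseStore n M U l [] e) (n := n) (M := M)
    rfl rfl rfl rfl rfl rfl rfl rfl
  constructor
  · intro h
    rw [readGaps, eval, h1 h]
    simp [eval, eval_pour, eval_clear, parseStore]
  · intro hf
    refine h2 ?_
    by_contra h
    exact eval_ne_nil (by decide) _ h hf

/-- The stacks when the program starts. -/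
def inputStore (w u : Word) : Store := { w0 := w.reverse, u0 := u.reverse }

theorem input_eq (w u : Word) : input .w0 .u0 w u = (inputStore w u).fn := by
  funext r
  cases r <;> rfl

theorem exists_unary (v : Word) : ∃ L, v ++ [false] = unary L := by
  induction v with
  | nil => exact ⟨[0], rfl⟩
  | cons b v ih =>
    obtain ⟨L, hL⟩ := ih
    cases b with
    | false => exact ⟨0 :: L, by simp [unary, hL]⟩
    | true =>
      cases L with
      | nil => simp [unary] at hL
      | cons a L => exact ⟨(a + 1) :: L, by simp [List.replicate_succ, hL, unary]⟩

theorem reverse_unary_cons (a : ℕ) (L : List ℕ) : ∃ v, (unary (a :: L)).reverse = false :: v := by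
  induction L generalizing a with
  | nil => exact ⟨List.replicate a true, by simp [unary]⟩
  | cons b L ih =>
    obtain ⟨v, hv⟩ := ih b
    exact ⟨v ++ ((List.replicate a true) ++ [false]).reverse, by
      rw [unary]
      simp [hv]⟩

theorem eval_check {r : Reg} {a : Prog Reg} {s : Reg → List Bool} {v : List Bool}
    (h : s r = false :: v) : eval (pop r a fail (push r false)) s = s := by
  have h1 := Function.update_eq_self r s
  rw [h] at h1
  simp [eval, h, h1]

theorem check_fail {r : Reg} {a : Prog Reg} {s : Reg → List Bool} {v : List Bool}
    (h : s r = true :: v) : eval (pop r a fail (push r false)) s .f ≠ [] := by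
  simp [eval, h, fail]

theorem eval_num_zeros {k : ℕ} {m : List Bool} {s : Store}
    (hs : s.w = List.replicate k true ++ false :: m) :
    eval (num .w (seq (push .c true) (push .n false))) s.fn = { s with
      w := m, c := List.replicate k true ++ s.c, n := List.replicate k false ++ s.n }.fn := by
  have key : ∀ (k : ℕ) (s : Store),
      numLoop .w (eval (seq (push .c true) (push .n false)))
        (List.replicate k true ++ false :: m) s.fn = { s with
          w := m, c := List.replicate k true ++ s.c, n := List.replicate k false ++ s.n }.fn := by
    intro k
    induction k with
    | zero => intro s; simp [numLoop]
    | succ k ih =>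
      intro s
      rw [List.replicate_succ, List.cons_append, numLoop]
      have h1 : eval (seq (push .c true) (push .n false))
          (Function.update s.fn .w (List.replicate k true ++ false :: m)) =
          Store.fn { s with
            w := List.replicate k true ++ false :: m, c := true :: s.c, n := false :: s.n } := by
        simp [eval]
      have h2 : List.replicate k false ++ false :: s.n =
          false :: (List.replicate k false ++ s.n) := by
        rw [← List.singleton_append, ← List.append_assoc, ← List.replicate_succ',
          List.replicate_succ, List.cons_append]
      rw [h1, ih]
      simp [replicate_append_true, h2, List.replicate_succ]
  rw [eval, show s.fn .w = List.replicate k true ++ false :: m from hs, key]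

theorem unary_replicate_zero (n : ℕ) : unary (List.replicate n 0) = List.replicate n false := by
  induction n with
  | zero => rfl
  | succ n ih => simp [List.replicate_succ, unary, ih]

theorem eval_start_ok (del : Bool) (n : ℕ) (M U : List ℕ) :
    (start del).eval (inputStore (unary (n :: M)) (unary U)).fn =
      (parseStore n M U [] [] (if del then unary (List.replicate n 0) else [])).fn := by
  obtain ⟨v, hv⟩ := reverse_unary_cons n M
  have h1 : eval (pop .u0 skip fail (push .u0 false))
      (inputStore (unary (n :: M)) (unary U)).fn = (inputStore (unary (n :: M)) (unary U)).fn := by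
    cases U with
    | nil => simp [eval, inputStore, unary]
    | cons m U =>
      obtain ⟨v', hv'⟩ := reverse_unary_cons m U
      exact eval_check (v := v') hv'
  rw [start, eval, eval_check (v := v) hv, eval, h1, eval, eval_pour (by decide), eval,
    eval_pour (by decide)]
  have h2 : Function.update (Function.update (Function.update
      (Function.update (inputStore (unary (n :: M)) (unary U)).fn .w0 []) .w
        ((inputStore (unary (n :: M)) (unary U)).fn .w0).reverse) .u0 []) .u
        (((inputStore (unary (n :: M)) (unary U)).fn .u0).reverse) =
      (Store.fn { w := unary (n :: M), u := unary U }) := by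
    simp [inputStore]
  cases del
  · have h4 := eval_num_push (r := .w) (q := .c) (b := true) (by decide) (a := n) (l := unary M)
      (s := Store.fn { w := unary (n :: M), u := unary U }) rfl
    simp [inputStore, parseStore] at h4 ⊢
    exact h4
  · have h4 := eval_num_zeros (k := n) (m := unary M)
      (s := { w := unary (n :: M), u := unary U }) rfl
    simp [inputStore, parseStore, unary_replicate_zero] at h4 ⊢
    exact h4

/-- If the first check succeeds, then both words consist of unary numbers. -/
theorem start_exists {del : Bool} {w u : Word} (hf : (start del).eval (inputStore w u).fn .f = []) :
    ∃ n M U, w = unary (n :: M) ∧ u = unary U := by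
  have hlast : ∀ v : Word, v.reverse = [] ∨ (∃ v', v.reverse = true :: v') ∨
      ∃ v', v.reverse = false :: v' ∧ ∃ L, v = unary L := by
    intro v
    rcases hv : v.reverse with _ | ⟨_ | _, v'⟩
    · exact Or.inl rfl
    · refine Or.inr (Or.inr ⟨v', rfl, ?_⟩)
      obtain ⟨L, hL⟩ := exists_unary v'.reverse
      refine ⟨L, ?_⟩
      rw [← hL, ← List.reverse_reverse v, hv, List.reverse_cons]
    · exact Or.inr (Or.inl ⟨v', rfl⟩)
  rw [start, eval] at hf
  rcases hlast w with hw | ⟨v', hw⟩ | ⟨v', hw, L, rfl⟩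
  · refine absurd hf (eval_ne_nil (by cases del <;> decide) _ ?_)
    simp [eval, inputStore, hw, fail]
  · exact absurd hf (eval_ne_nil (by cases del <;> decide) _ (check_fail (v := v') hw))
  · rw [eval_check (v := v') hw, eval] at hf
    cases L with
    | nil => simp [unary] at hw
    | cons n M =>
      rcases hlast u with hu | ⟨v', hu⟩ | ⟨v', hu, U, rfl⟩
      · exact ⟨n, M, [], rfl, List.reverse_eq_nil_iff.1 hu⟩
      · exact absurd hf (eval_ne_nil (by cases del <;> decide) _ (check_fail (v := v') hu))
      · exact ⟨n, M, U, rfl, rfl⟩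

/-! ### What the verifier accepts -/

/-- Started on `s`, the program fails unless `P` holds, and its result is `s'` if `P` holds. -/
def Exact (p : Prog Reg) (s : Reg → List Bool) (P : Prop) (s' : Reg → List Bool) : Prop :=
  (P → p.eval s = s') ∧ (p.eval s .f = [] → P)

theorem Exact.seq {p q : Prog Reg} {s s' s'' : Reg → List Bool} {P Q : Prop}
    (hp : Exact p s P s') (hk : q.keeps .f = true) (hq : P → Exact q s' Q s'') :
    Exact (.seq p q) s (P ∧ Q) s'' := by
  refine ⟨fun h => ?_, fun h => ?_⟩
  · rw [eval, hp.1 h.1, (hq h.1).1 h.2]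
  · rw [eval] at h
    have h1 : P := hp.2 (by by_contra h2; exact eval_ne_nil hk _ h2 h)
    rw [hp.1 h1] at h
    exact ⟨h1, (hq h1).2 h⟩

theorem exact_expectEmpty_w {n : ℕ} {W U : List ℕ} {l g e : List Bool} :
    Exact (expectEmpty .w) (parseStore n W U l g e).fn (W = []) (parseStore n [] U l g e).fn := by
  constructor
  · rintro rfl
    simp [expectEmpty, eval_tally, parseStore, unary]
  · intro h
    rw [expectEmpty, eval_tally (by decide)] at h
    cases W with
    | nil => rfl
    | cons a W => simp [parseStore, unary] at h

theorem keeps_main (del odd : Bool) :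
    (seq (drain .c (step del) skip) (finish odd)).keeps .f = true := by
  cases del <;> cases odd <;> decide

/-- The verifier succeeds if reading the input succeeds and the certificate is a sequence of choices.
Here `p` is the part of `parse` that follows `start`. -/
theorem verifier_iff {del odd : Bool} {p : Prog Reg} (hk : p.keeps .f = true)
    (hp : parse del = seq (start del) p) {P : ℕ → List ℕ → Prop} {L G N : ℕ → List ℕ → List ℕ}
    (hL : ∀ n M, P n M → (L n M).length = n)
    (h : ∀ n M U, Exact p (parseStore n M U [] []
      (if del then unary (List.replicate n 0) else [])).fn (P n M)
      (mainStore n (L n M) (G n M) (N n M) U false).fn) (w u : Word) :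
    (verifier del odd).eval (input .w0 .u0 w u) .f = [] ↔
      ∃ (n : ℕ) (M U : List ℕ), P n M ∧ w = unary (n :: M) ∧ u = unary U ∧
        U ∈ wits del odd (L n M) (G n M) (N n M) := by
  have he : ∀ n M U, (parse del).eval (inputStore (unary (n :: M)) (unary U)).fn =
      p.eval (parseStore n M U [] [] (if del then unary (List.replicate n 0) else [])).fn :=
    fun n M U => by rw [hp, eval, eval_start_ok]
  rw [input_eq, verifier, eval]
  constructor
  · intro hf
    have h1 : (parse del).eval (inputStore w u).fn .f = [] := by
      by_contra h
      exact eval_ne_nil (keeps_main del odd) _ h hf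
    have h2 : (start del).eval (inputStore w u).fn .f = [] := by
      by_contra h
      rw [hp, eval] at h1
      exact eval_ne_nil hk _ h h1
    obtain ⟨n, M, U, rfl, rfl⟩ := start_exists h2
    rw [he] at h1 hf
    have h3 := (h n M U).2 h1
    rw [(h n M U).1 h3] at hf
    have h4 := eval_main_iff (del := del) (odd := odd) (L := L n M) (G := G n M) (N := N n M)
      (U := U) (par := false)
    rw [hL n M h3, Bool.xor_false] at h4
    exact ⟨n, M, U, h3, rfl, rfl, h4.1 hf⟩
  · rintro ⟨n, M, U, h3, rfl, rfl, hU⟩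
    rw [he, (h n M U).1 h3]
    have h4 := eval_main_iff (del := del) (odd := odd) (L := L n M) (G := G n M) (N := N n M)
      (U := U) (par := false)
    rw [hL n M h3, Bool.xor_false] at h4
    exact h4.2 hU

/-- The verifier for inverse Kostka numbers. -/
theorem verifier_true_iff (odd : Bool) (w u : Word) :
    (verifier true odd).eval (input .w0 .u0 w u) .f = [] ↔
      ∃ (n : ℕ) (K M U : List ℕ), K.length = n ∧ M.length = n ∧ Decr K ∧ Decr M ∧
        w = unary (n :: (K ++ M)) ∧ u = unary U ∧
          U ∈ wits true odd M (gapsOf K) (List.replicate n 0) := by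
  rw [verifier_iff (p := seq (seq readGaps (readParts .l)) (expectEmpty .w)) (by decide) rfl
    (P := fun n M => (Readable n M ∧ Readable n (M.drop n)) ∧ (M.drop n).drop n = [])
    (L := fun n M => (M.drop n).take n) (G := fun n M => gapsOf (M.take n))
    (N := fun n _ => List.replicate n 0) (fun n M h => by simpa using h.1.2.1)]
  · constructor
    · rintro ⟨n, M, U, ⟨⟨h1, h2⟩, h3⟩, hw, hu, hU⟩
      have h4 : M = M.take n ++ (M.drop n).take n := by
        conv_lhs => rw [← List.take_append_drop n M, ← List.take_append_drop n (M.drop n), h3]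
        simp
      exact ⟨n, M.take n, (M.drop n).take n, U, List.length_take_of_le h1.1,
        List.length_take_of_le h2.1, h1.2, h2.2, by rw [← h4]; exact hw, hu, hU⟩
    · rintro ⟨n, K, M, U, rfl, hM, hdK, hdM, hw, hu, hU⟩
      have h5 : M.take K.length = M := by rw [← hM, List.take_length]
      have h6 : M.drop K.length = [] := by rw [← hM, List.drop_length]
      refine ⟨K.length, K ++ M, U, ?_, hw, hu, ?_⟩
      · simp [Readable, h5, h6, hM, hdK, hdM]
      · simpa [h5] using hU
  · intro n M U
    refine Exact.seq (Exact.seq eval_readGaps (by decide) fun _ => eval_readParts_l) (by decide)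
      fun _ => ?_
    exact exact_expectEmpty_w

/-- The verifier for Littlewood–Richardson coefficients. -/
theorem verifier_false_iff (odd : Bool) (w u : Word) :
    (verifier false odd).eval (input .w0 .u0 w u) .f = [] ↔
      ∃ (n : ℕ) (K M N U : List ℕ), K.length = n ∧ M.length = n ∧ N.length = n ∧
        Decr K ∧ Decr M ∧ Decr N ∧ w = unary (n :: (K ++ (M ++ N))) ∧ u = unary U ∧
          U ∈ wits false odd K (gapsOf M) N := by
  rw [verifier_iff (p := seq (seq (readParts .l) (seq readGaps (readParts .n))) (expectEmpty .w))
    (by decide) rfl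
    (P := fun n M => (Readable n M ∧ Readable n (M.drop n) ∧ Readable n ((M.drop n).drop n)) ∧
      ((M.drop n).drop n).drop n = [])
    (L := fun n M => M.take n) (G := fun n M => gapsOf ((M.drop n).take n))
    (N := fun n M => ((M.drop n).drop n).take n) (fun n M h => by simpa using h.1.1.1)]
  · constructor
    · rintro ⟨n, M, U, ⟨⟨h1, h2, h3⟩, h0⟩, hw, hu, hU⟩
      have h4 : M = M.take n ++ ((M.drop n).take n ++ ((M.drop n).drop n).take n) := by
        conv_lhs => rw [← List.take_append_drop n M, ← List.take_append_drop n (M.drop n),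
          ← List.take_append_drop n ((M.drop n).drop n), h0]
        simp
      exact ⟨n, M.take n, (M.drop n).take n, ((M.drop n).drop n).take n, U,
        List.length_take_of_le h1.1, List.length_take_of_le h2.1, List.length_take_of_le h3.1,
        h1.2, h2.2, h3.2, by rw [← h4]; exact hw, hu, hU⟩
    · rintro ⟨n, K, M, N, U, rfl, hM, hN, hdK, hdM, hdN, hw, hu, hU⟩
      have h5 : N.take K.length = N := by rw [← hN, List.take_length]
      have h6 : N.drop K.length = [] := by rw [← hN, List.drop_length]
      have h7 : (K ++ (M ++ N)).drop K.length = M ++ N := List.drop_left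
      have h8 : (M ++ N).drop K.length = N := by rw [← hM]; exact List.drop_left
      have h9 : (K ++ (M ++ N)).take K.length = K := List.take_left
      have h10 : (M ++ N).take K.length = M := by rw [← hM]; exact List.take_left
      refine ⟨K.length, K ++ (M ++ N), U, ?_, hw, hu, ?_⟩
      · simp only [Readable, h5, h6, h7, h8, h9, h10, hdK, hdM, hdN, hM, hN, List.length_append]
        simp
      · simpa only [h5, h7, h8, h9, h10] using hU
  · intro n M U
    refine Exact.seq (Exact.seq eval_readParts_l (by decide) fun _ =>
      Exact.seq eval_readGaps (by decide) fun _ => eval_readParts_n) (by decide) fun _ => ?_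
    exact exact_expectEmpty_w

/-! ### Signed counts are in `GapP` -/

/-- The number of words that are accepted together with a given word. -/
noncomputable def accCount (del odd : Bool) (w : Word) : ℕ :=
  Nat.card {u : Word // (verifier del odd).eval (input .w0 .u0 w u) .f = []}

theorem verifier_bound {del odd : Bool} {w u : Word}
    (h : (verifier del odd).eval (input .w0 .u0 w u) .f = []) :
    u.length ≤ w.length + w.length * (w.length + w.length + 1) := by
  cases del
  · obtain ⟨n, K, M, N, U, hK, hM, hN, dK, dM, dN, rfl, rfl, hU⟩ := (verifier_false_iff _ _ _).1 h
    have h1 := wits_bound hU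
    rw [gapSize_gapsOf dM, length_gapsOf, hK, hM, hN] at h1
    rw [length_unary U]
    refine h1.trans ?_
    rw [length_unary]
    simp only [List.sum_cons, List.sum_append, List.length_cons, List.length_append]
    gcongr <;> omega
  · obtain ⟨n, K, M, U, hK, hM, dK, dM, rfl, rfl, hU⟩ := (verifier_true_iff _ _ _).1 h
    have h1 := wits_bound hU
    rw [gapSize_gapsOf dK, length_gapsOf, hK, hM, List.length_replicate] at h1
    rw [length_unary U]
    refine h1.trans ?_
    rw [length_unary]
    simp only [List.sum_cons, List.sum_append, List.length_cons, List.length_append]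
    gcongr <;> omega

theorem isSharpP_accCount (del odd : Bool) : IsSharpP (accCount del odd) := by
  refine ⟨{z | (verifier del odd).eval (input .w0 .u0 z.1 z.2) .f = []},
    polyTimeDecidable (wf_verifier del odd) (frugal_verifier del odd) (by decide) .f,
    ⟨.X + .X * (.X + .X + 1), fun w u h => ?_⟩, fun _ => rfl⟩
  simpa using verifier_bound h

theorem accCount_eq_card {del odd : Bool} {w : Word} {S : Finset (List ℕ)}
    (h : ∀ u, (verifier del odd).eval (input .w0 .u0 w u) .f = [] ↔ ∃ U ∈ S, u = unary U) :
    accCount del odd w = S.card := by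
  have h1 : {u | (verifier del odd).eval (input .w0 .u0 w u) .f = []} = unary '' (S : Set _) := by
    ext u
    simp [h, eq_comm]
  rw [accCount, ← Set.ncard_coe_finset, ← Set.ncard_image_of_injective _ unary_injective, ← h1]
  rfl

theorem accCount_eq_zero {del odd : Bool} {w : Word}
    (h : ∀ u, (verifier del odd).eval (input .w0 .u0 w u) .f ≠ []) : accCount del odd w = 0 := by
  have : IsEmpty {u : Word // (verifier del odd).eval (input .w0 .u0 w u) .f = []} :=
    ⟨fun u => h u.1 u.2⟩
  exact Nat.card_of_isEmpty

theorem inGapP_of_accCount {del : Bool} {α : Type} {e : α ↪ Word} {f : α → ℤ}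
    {S : α → Bool → Finset (List ℕ)}
    (h : ∀ x odd u, (verifier del odd).eval (input .w0 .u0 (e x) u) .f = [] ↔
      ∃ U ∈ S x odd, u = unary U)
    (hf : ∀ x, f x = ((S x false).card : ℤ) - (S x true).card)
    (hr : ∀ w odd u, (verifier del odd).eval (input .w0 .u0 w u) .f = [] → w ∈ Set.range e) :
    InGapP e f := by
  refine ⟨fun w => (accCount del false w : ℤ) - accCount del true w,
    ⟨_, _, isSharpP_accCount del false, isSharpP_accCount del true, fun _ => rfl⟩,
    fun x => ?_, fun w hw => ?_⟩
  · simp only [accCount_eq_card (h x _), hf]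
  · simp only [accCount_eq_zero fun u hu => hw (hr w _ u hu), sub_self]

theorem tupleList_two (x : Σ n : ℕ, Fin 2 → PartSeq n) :
    tupleList x = x.1 :: (List.ofFn (x.2 0).1 ++ List.ofFn (x.2 1).1) := by
  simp [tupleList]

theorem tupleList_three (x : Σ n : ℕ, Fin 3 → PartSeq n) : tupleList x =
    x.1 :: (List.ofFn (x.2 0).1 ++ (List.ofFn (x.2 1).1 ++ List.ofFn (x.2 2).1)) := by
  simp [tupleList]

theorem inGapP_sgnCount_true : InGapP (tupleCode 2) fun x =>
    sgnCount true (List.ofFn (x.2 1).1) (gapsOf (List.ofFn (x.2 0).1))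
      (List.replicate x.1 0) := by
  refine inGapP_of_accCount (del := true) (S := fun x odd => wits true odd (List.ofFn (x.2 1).1)
    (gapsOf (List.ofFn (x.2 0).1)) (List.replicate x.1 0)) (fun x odd u => ?_)
    (fun x => (card_wits_sub _ _ _ _).symm) fun w odd u h => ?_
  · rw [verifier_true_iff]
    constructor
    · rintro ⟨n, K, M, U, hK, hM, dK, dM, hw, rfl, hU⟩
      have h1 := unary_injective hw
      rw [tupleList_two, List.cons.injEq] at h1
      obtain ⟨rfl, h1⟩ := h1
      obtain ⟨rfl, rfl⟩ := List.append_inj h1 (by simp [hK])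
      exact ⟨U, hU, rfl⟩
    · rintro ⟨U, hU, rfl⟩
      exact ⟨_, _, _, U, by simp, by simp, decr_ofFn.2 (x.2 0).2, decr_ofFn.2 (x.2 1).2,
        congrArg unary (tupleList_two x), rfl, hU⟩
  · obtain ⟨n, K, M, U, hK, hM, dK, dM, rfl, -, -⟩ := (verifier_true_iff _ _ _).1 h
    obtain ⟨κ, rfl⟩ := dK.exists_ofFn hK
    obtain ⟨μ, rfl⟩ := dM.exists_ofFn hM
    exact ⟨⟨n, ![κ, μ]⟩, congrArg unary (tupleList_two _)⟩

theorem inGapP_sgnCount_false : InGapP (tupleCode 3) fun x =>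
    sgnCount false (List.ofFn (x.2 0).1) (gapsOf (List.ofFn (x.2 1).1))
      (List.ofFn (x.2 2).1) := by
  refine inGapP_of_accCount (del := false) (S := fun x odd => wits false odd
    (List.ofFn (x.2 0).1) (gapsOf (List.ofFn (x.2 1).1)) (List.ofFn (x.2 2).1))
    (fun x odd u => ?_) (fun x => (card_wits_sub _ _ _ _).symm) fun w odd u h => ?_
  · rw [verifier_false_iff]
    constructor
    · rintro ⟨n, K, M, N, U, hK, hM, hN, dK, dM, dN, hw, rfl, hU⟩
      have h1 := unary_injective hw
      rw [tupleList_three, List.cons.injEq] at h1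
      obtain ⟨rfl, h1⟩ := h1
      obtain ⟨rfl, h2⟩ := List.append_inj h1 (by simp [hK])
      obtain ⟨rfl, rfl⟩ := List.append_inj h2 (by simp [hM])
      exact ⟨U, hU, rfl⟩
    · rintro ⟨U, hU, rfl⟩
      exact ⟨_, _, _, _, U, by simp, by simp, by simp, decr_ofFn.2 (x.2 0).2,
        decr_ofFn.2 (x.2 1).2, decr_ofFn.2 (x.2 2).2, congrArg unary (tupleList_three x), rfl, hU⟩
  · obtain ⟨n, K, M, N, U, hK, hM, hN, dK, dM, dN, rfl, -, -⟩ := (verifier_false_iff _ _ _).1 h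
    obtain ⟨κ, rfl⟩ := dK.exists_ofFn hK
    obtain ⟨μ, rfl⟩ := dM.exists_ofFn hM
    obtain ⟨ν, rfl⟩ := dN.exists_ofFn hN
    exact ⟨⟨n, ![κ, μ, ν]⟩, congrArg unary (tupleList_three _)⟩

end Prog

open MvPolynomial

/-! ### Polynomials built from strips, and alternants -/

/-- The polynomial in `k` variables that a partition with gaps `G` gives rise to if for each variable
in turn a strip is removed, the number of its cells being the exponent of the variable. -/
noncomputable def stripPoly (del : Bool) : (k : ℕ) → List ℕ → MvPolynomial (Fin k) ℂ
  | 0, _ => 1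
  | k + 1, G => ∑ d ∈ steps del 0 G, X 0 ^ d.sum * rename Fin.succ (stripPoly del k (newGaps G d))

/-- The alternant `det (xᵢ ^ eⱼ)`. -/
noncomputable def alternant {k : ℕ} (e : Fin k → ℕ) : MvPolynomial (Fin k) ℂ :=
  (Matrix.of fun i j => MvPolynomial.X i ^ e j).det

/-- The sum of a sequence and the staircase `(k - 1, …, 1, 0)`. -/
def stair (a : ℕ → ℕ) (k : ℕ) (j : Fin k) : ℕ := a j + j.rev

/-- A tuple as an exponent of a monomial. -/
noncomputable def expo {k : ℕ} (e : Fin k → ℕ) : Fin k →₀ ℕ := Finsupp.equivFunOnFinite.symm e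

theorem expo_injective {k : ℕ} : Function.Injective (expo : (Fin k → ℕ) → Fin k →₀ ℕ) :=
  Finsupp.equivFunOnFinite.symm.injective

theorem finSuccEquiv_rename_succ {k : ℕ} (P : MvPolynomial (Fin k) ℂ) :
    finSuccEquiv ℂ k (rename Fin.succ P) = Polynomial.C P := by
  induction P using MvPolynomial.induction_on with
  | C a => simp [finSuccEquiv_apply]
  | add p q hp hq => simp [hp, hq]
  | mul_X p i hp => simp [hp, finSuccEquiv_X_succ]

theorem coeff_cons_X_pow_mul_rename {k : ℕ} (l a : ℕ) (e : Fin k → ℕ)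
    (P : MvPolynomial (Fin k) ℂ) :
    coeff (expo (Fin.cons l e)) (X 0 ^ a * rename Fin.succ P) =
      if a = l then coeff (expo e) P else 0 := by
  have h1 : expo (Fin.cons l e) = Finsupp.cons l (expo e) := rfl
  rw [h1, ← finSuccEquiv_coeff_coeff, map_mul, map_pow, finSuccEquiv_X_zero,
    finSuccEquiv_rename_succ, mul_comm, Polynomial.coeff_C_mul, Polynomial.coeff_X_pow]
  split_ifs with h2 h3 h3
  · simp
  · exact absurd h2.symm h3
  · exact absurd h3.symm h2
  · simp

theorem rename_succ_alternant {k : ℕ} (e : Fin k → ℕ) : rename Fin.succ (alternant e) =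
    (Matrix.of fun i j => X (Fin.succ i) ^ e j : Matrix _ _ (MvPolynomial (Fin (k + 1)) ℂ)).det := by
  rw [alternant, AlgHom.map_det]
  congr 1
  ext1 i j
  simp

theorem alternant_succ {k : ℕ} (e : Fin (k + 1) → ℕ) : alternant e =
    ∑ c : Fin (k + 1), (-1) ^ (c : ℕ) *
      (X 0 ^ e c * rename Fin.succ (alternant (e ∘ c.succAbove))) := by
  rw [alternant, Matrix.det_succ_row_zero]
  refine Finset.sum_congr rfl fun c _ => ?_
  rw [rename_succ_alternant, mul_assoc]
  rfl

theorem stair_cons (l : ℕ) (L : List ℕ) (k : ℕ) :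
    stair (fun i => (l :: L).getD i 0) (k + 1) =
      Fin.cons (l + k) (stair (fun i => L.getD i 0) k) := by
  funext j
  refine Fin.cases ?_ (fun j => ?_) j
  · simp [stair]
  · simp only [stair, Fin.val_succ, List.getD_cons_succ, Fin.cons_succ, Fin.val_rev]
    omega

theorem stair_succAbove {N : List ℕ} {k : ℕ} (hN : N.length = k + 1) (c : Fin (k + 1)) :
    stair (fun i => N.getD i 0) (k + 1) ∘ c.succAbove =
      stair (fun i => (newExps N c).getD i 0) k := by
  funext j
  have hj := j.2
  have hc := c.2
  simp only [Function.comp_apply, stair, Fin.val_rev, newExps, List.getD_eq_getElem?_getD]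
  by_cases h : (j : ℕ) < c
  · rw [Fin.succAbove_of_castSucc_lt _ _ h, List.getElem?_append_left (by simp; omega)]
    rw [List.getElem?_eq_getElem (by simp; omega), List.getElem?_eq_getElem (by simp; omega)]
    simp
    omega
  · rw [Fin.succAbove_of_le_castSucc _ _ (not_lt.1 h), List.getElem?_append_right (by simp; omega)]
    simp only [Fin.val_succ, List.length_map, List.length_take, List.getElem?_drop]
    rw [min_eq_left (by omega), show (c : ℕ) + 1 + (j - c) = j + 1 by omega]
    omega

/-- Coefficients of products of strip polynomials and alternants are signed counts. -/
theorem coeff_stripPoly_mul_alternant (del : Bool) : ∀ {k : ℕ} {L G N : List ℕ}, L.length = k →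
    G.length = k → N.length = k → coeff (expo (stair (fun i => L.getD i 0) k))
      (stripPoly del k G * alternant (stair (fun i => N.getD i 0) k)) = (sgnCount del L G N : ℂ)
  | 0, L, G, N, hL, hG, hN => by
    rw [List.length_eq_zero_iff.1 hL, sgnCount, Subsingleton.elim (expo _) 0]
    simp [stripPoly, alternant]
  | k + 1, [], G, N, hL, hG, hN => by simp at hL
  | k + 1, l :: L, G, N, hL, hG, hN => by
    rw [stair_cons, stripPoly, alternant_succ, Finset.sum_mul_sum, coeff_sum, sgnCount,
      Int.cast_sum]
    refine Finset.sum_congr rfl fun d hd => ?_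
    have hd' := mem_steps.1 hd
    rw [coeff_sum, Int.cast_sum, hN, Finset.sum_range]
    refine Finset.sum_congr rfl fun c _ => ?_
    have h1 : (-1 : MvPolynomial (Fin (k + 1)) ℂ) ^ (c : ℕ) = C ((-1) ^ (c : ℕ)) := by simp
    have h2 : X 0 ^ d.sum * rename Fin.succ (stripPoly del k (newGaps G d)) *
        ((-1) ^ (c : ℕ) * (X 0 ^ stair (fun i => N.getD i 0) (k + 1) c *
          rename Fin.succ (alternant (stair (fun i => N.getD i 0) (k + 1) ∘ c.succAbove)))) =
        C ((-1) ^ (c : ℕ)) * (X 0 ^ (d.sum + stair (fun i => N.getD i 0) (k + 1) c) *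
          rename Fin.succ (stripPoly del k (newGaps G d) *
            alternant (stair (fun i => (newExps N c).getD i 0) k))) := by
      rw [stair_succAbove hN, h1, map_mul, pow_add]
      ring
    have h3 : d.sum + stair (fun i => N.getD i 0) (k + 1) c = l + k ↔
        d.sum + N.getD c 0 = l + c := by
      have hc := c.2
      simp only [stair, Fin.val_rev]
      omega
    rw [h2, coeff_C_mul, coeff_cons_X_pow_mul_rename, coeff_stripPoly_mul_alternant del
      (by simpa using hL) (by rw [length_newGaps hd'.length_eq, hG]; rfl)
      (by rw [length_newExps (by rw [hN]; exact c.2), hN]; rfl)]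
    simp only [h3]
    split_ifs <;> simp

/-! ### The branching rule for alternants -/

/-- The parts of the partition with gaps `G`. -/
def part (G : List ℕ) (i : ℕ) : ℕ := (G.drop i).sum

theorem part_eq_add (G : List ℕ) (i : ℕ) : part G i = G.getD i 0 + part G (i + 1) := by
  induction G generalizing i with
  | nil => simp [part]
  | cons g G ih =>
    cases i with
    | zero => simp [part]
    | succ i => simpa [part] using ih i

theorem part_of_length_le {G : List ℕ} {i : ℕ} (h : G.length ≤ i) : part G i = 0 := by
  rw [part, List.drop_eq_nil_of_le h, List.sum_nil]

theorem part_antitone (G : List ℕ) : Antitone (part G) :=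
  antitone_nat_of_succ_le fun i => by rw [part_eq_add G i]; omega

theorem part_newGaps {del : Bool} : ∀ {a : ℕ} {G d : List ℕ}, IsStep del a G d → ∀ i,
    part (newGaps G d) i + d.getD i 0 = part G i
  | _, [], [], _, _ => by simp [part, newGaps]
  | _, [g], [d], h, i => by
    have := h.2.1 rfl
    subst this
    cases i <;> simp [newGaps, part]
  | a, g :: g' :: G, d :: d' :: D, h, 0 => by
    have := (gapSize_newGaps h).2
    simpa [part] using this
  | a, g :: g' :: G, d :: d' :: D, h, i + 1 => by
    have h1 := part_newGaps h.2.2.2 i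
    have h2 : newGaps (g :: g' :: G) (d :: d' :: D) =
        (g - d + d') :: newGaps (g' :: G) (d' :: D) := by simp [newGaps]
    rw [h2]
    simpa [part] using h1
  | _, _ :: _ :: _, [_], h, _ => h.2.2.2.elim
  | _, [_], _ :: _ :: _, h, _ => h.2.2.2.elim
  | _, [], _ :: _, h, _ => h.elim
  | _, _ :: _, [], h, _ => h.elim

theorem isStep_false_iff : ∀ {a : ℕ} {G d : List ℕ}, IsStep false a G d ↔ d.length = G.length ∧
    (∀ i, d.getD i 0 ≤ G.getD i 0) ∧ ∀ i, i + 1 = G.length → d.getD i 0 = G.getD i 0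
  | _, [], [] => by simp [IsStep]
  | _, [], _ :: _ => by simp [IsStep]
  | _, _ :: _, [] => by simp [IsStep]
  | a, g :: G, x :: D => by
    rw [IsStep, isStep_false_iff]
    constructor
    · rintro ⟨h1, h2, -, h3, h4, h5⟩
      refine ⟨by simp [h3], fun i => ?_, fun i hi => ?_⟩
      · cases i with
        | zero => simpa using h1
        | succ i => simpa using h4 i
      · cases i with
        | zero => simpa using h2 (List.length_eq_zero_iff.1 (by simpa using hi.symm))
        | succ i => simpa using h5 i (by simpa using hi)
    · rintro ⟨h3, h4, h5⟩
      refine ⟨by simpa using h4 0, ?_, by simp, by simpa using h3, fun i => by simpa using h4 (i + 1),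
        fun i hi => by simpa using h5 (i + 1) (by simpa using hi)⟩
      rintro rfl
      simpa using h5 0

theorem steps_replicate_zero (k a : ℕ) :
    steps false a (List.replicate k 0) = {List.replicate k 0} := by
  ext d
  rw [mem_steps, isStep_false_iff, Finset.mem_singleton]
  constructor
  · rintro ⟨h1, h2, -⟩
    refine List.ext_getElem h1 fun i hi hi' => ?_
    have := h2 i
    rw [List.getD_eq_getElem _ _ hi, List.getD_eq_getElem _ _ hi'] at this
    simpa using this
  · rintro rfl
    simp

theorem part_replicate_zero (k : ℕ) : part (List.replicate k 0) = 0 := by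
  funext i
  simp [part]

theorem newGaps_replicate_zero (k : ℕ) :
    newGaps (List.replicate (k + 1) 0) (List.replicate (k + 1) 0) = List.replicate k 0 := by
  refine List.ext_getElem (by simp [newGaps]) fun i hi hi' => ?_
  simp [newGaps]

theorem det_eq_of_forall_col_eq_smul_add_succ {R : Type*} [CommRing R] {n : ℕ}
    {A B : Matrix (Fin (n + 1)) (Fin (n + 1)) R} (c : Fin n → R)
    (hlast : ∀ i, A i (Fin.last n) = B i (Fin.last n))
    (hcast : ∀ i (j : Fin n), A i j.castSucc = B i j.castSucc + c j * A i j.succ) :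
    A.det = B.det := by
  rw [← Matrix.det_submatrix_equiv_self Fin.revPerm A,
    ← Matrix.det_submatrix_equiv_self Fin.revPerm B]
  refine Matrix.det_eq_of_forall_col_eq_smul_add_pred (fun j => c j.rev) (fun i => ?_) fun i j => ?_
  · simpa using hlast i.rev
  · simpa [Fin.rev_succ, Fin.rev_castSucc] using hcast i.rev j.rev

/-- Multilinear expansion of a determinant whose entries are sums. -/
theorem det_sum_X_pow_mul {k : ℕ} (g E : Fin k → ℕ) :
    (Matrix.of fun i j => ∑ m ∈ Finset.range (g j + 1), X 0 ^ m * X (Fin.succ i) ^ (E j - m) :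
      Matrix _ _ (MvPolynomial (Fin (k + 1)) ℂ)).det =
    ∑ r ∈ Fintype.piFinset fun j => Finset.range (g j + 1),
      X 0 ^ (∑ j, r j) * rename Fin.succ (alternant fun j => E j - r j) := by
  rw [← Matrix.det_transpose]
  have h := (Matrix.detRowAlternating (n := Fin k)
    (R := MvPolynomial (Fin (k + 1)) ℂ)).toMultilinearMap.map_sum_finset
    (fun j m => fun i : Fin k => X 0 ^ m * X (Fin.succ i) ^ (E j - m))
    (fun j => Finset.range (g j + 1))
  have h2 : (Matrix.of fun i j => ∑ m ∈ Finset.range (g j + 1),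
      X 0 ^ m * X (Fin.succ i) ^ (E j - m) :
        Matrix (Fin k) (Fin k) (MvPolynomial (Fin (k + 1)) ℂ)).transpose =
      fun j => ∑ m ∈ Finset.range (g j + 1), fun i => X 0 ^ m * X (Fin.succ i) ^ (E j - m) := by
    ext1 j i
    simp [Finset.sum_apply]
  rw [h2]
  refine h.trans (Finset.sum_congr rfl fun r _ => ?_)
  rw [rename_succ_alternant, ← Matrix.det_transpose (Matrix.of _), ← Finset.prod_pow_eq_pow_sum]
  exact Matrix.det_mul_column (fun j => X 0 ^ r j) _

/-- The branching rule: an alternant is, up to a factor that does not depend on the exponents, a sum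
over strips of alternants in one variable less. -/
theorem alternant_branch {k : ℕ} {G : List ℕ} (hG : G.length = k + 1) :
    alternant (stair (part G) (k + 1)) = ((-1) ^ k * ∏ i : Fin k, (X i.succ - X 0)) *
      ∑ d ∈ steps false 0 G,
        X 0 ^ d.sum * rename Fin.succ (alternant (stair (part (newGaps G d)) k)) := by
  set e := stair (part G) (k + 1) with he
  have hstep : ∀ j : Fin k, e j.castSucc = e j.succ + (G.getD j 0 + 1) := fun j => by
    have h := part_eq_add G j
    simp only [he, stair, Fin.val_rev, Fin.val_castSucc, Fin.val_succ, h]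
    omega
  have hlast : e (Fin.last k) = G.getD k 0 := by
    simp only [he, stair, Fin.val_rev, Fin.val_last, part_eq_add G k,
      part_of_length_le hG.le]
    omega
  let B : Matrix (Fin (k + 1)) (Fin (k + 1)) (MvPolynomial (Fin (k + 1)) ℂ) :=
    Matrix.of fun i => Fin.lastCases (X i ^ e (Fin.last k)) fun j =>
      X i ^ e j.castSucc - X 0 ^ (G.getD j 0 + 1) * X i ^ e j.succ
  -- Subtract from each column a multiple of the next one, so that the first row becomes zero except
  -- for its last entry.
  have h1 : alternant e = B.det := by
    refine det_eq_of_forall_col_eq_smul_add_succ (fun j => X 0 ^ (G.getD j 0 + 1)) (fun i => ?_)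
      fun i j => ?_
    · simp [B]
    · simp [B]
  have h2 : B.det = (-1) ^ k * X 0 ^ G.getD k 0 * (B.submatrix Fin.succ Fin.castSucc).det := by
    rw [Matrix.det_succ_row_zero, Fin.sum_univ_castSucc, Finset.sum_eq_zero, zero_add]
    · simp [B, hlast]
    · intro j _
      have : B 0 j.castSucc = 0 := by
        simp only [B, Matrix.of_apply, Fin.lastCases_castSucc, hstep]
        ring
      rw [this]
      ring
  have h3 : B.submatrix Fin.succ Fin.castSucc = Matrix.of fun i j => (X i.succ - X 0) *
      (Matrix.of fun (i j : Fin k) => ∑ m ∈ Finset.range (G.getD j 0 + 1), X 0 ^ m *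
        X (Fin.succ i) ^ (e j.succ + G.getD j 0 - m) :
          Matrix _ _ (MvPolynomial (Fin (k + 1)) ℂ)) i j := by
    ext1 i j
    have h := geom_sum₂_mul (X 0 : MvPolynomial (Fin (k + 1)) ℂ) (X i.succ) (G.getD j 0 + 1)
    have h' : ∑ m ∈ Finset.range (G.getD j 0 + 1), X 0 ^ m *
        X (Fin.succ i) ^ (e j.succ + G.getD j 0 - m) = X i.succ ^ e j.succ *
        ∑ m ∈ Finset.range (G.getD j 0 + 1), (X 0 : MvPolynomial (Fin (k + 1)) ℂ) ^ m *
          X i.succ ^ (G.getD j 0 + 1 - 1 - m) := by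
      rw [Finset.mul_sum]
      refine Finset.sum_congr rfl fun m hm => ?_
      rw [Finset.mem_range] at hm
      rw [show e j.succ + G.getD j 0 - m = e j.succ + (G.getD j 0 + 1 - 1 - m) by omega, pow_add]
      ring
    simp only [B, Matrix.submatrix_apply, Matrix.of_apply, Fin.lastCases_castSucc, hstep, h']
    rw [pow_add]
    linear_combination (X i.succ ^ e j.succ) * h
  rw [h1, h2, h3, Matrix.det_mul_column, det_sum_X_pow_mul (fun j : Fin k => G.getD j 0)
    (fun j : Fin k => e j.succ + G.getD j 0), Finset.mul_sum, Finset.mul_sum, Finset.mul_sum]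
  have hget : ∀ (r : Fin k → ℕ) (i : ℕ), (List.ofFn r ++ [G.getD k 0]).getD i 0 =
      if h : i < k then r ⟨i, h⟩ else if i = k then G.getD k 0 else 0 := fun r i => by
    rw [List.getD_eq_getElem?_getD]
    rcases lt_trichotomy i k with h | rfl | h
    · rw [List.getElem?_append_left (by simpa), dif_pos h, List.getElem?_eq_getElem (by simpa)]
      simp
    · simp
    · rw [List.getElem?_eq_none (by simp; omega), dif_neg h.not_gt, if_neg h.ne']
      rfl
  have hmem : ∀ r : Fin k → ℕ, (∀ j : Fin k, r j ≤ G.getD j 0) →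
      IsStep false 0 G (List.ofFn r ++ [G.getD k 0]) := fun r hr => by
    refine isStep_false_iff.2 ⟨by simp [hG], fun i => ?_, fun i hi => ?_⟩
    · rw [hget]
      split_ifs with h h'
      · exact hr ⟨i, h⟩
      · rw [h']
      · exact Nat.zero_le _
    · rw [hG, Nat.add_right_cancel_iff] at hi
      rw [hget]
      simp [hi]
  have hle : ∀ r ∈ Fintype.piFinset fun j : Fin k => Finset.range (G.getD j 0 + 1),
      ∀ j : Fin k, r j ≤ G.getD j 0 := fun r hr j => by
    simpa [Nat.lt_succ_iff] using Fintype.mem_piFinset.1 hr j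
  refine Finset.sum_bij (fun r _ => List.ofFn r ++ [G.getD k 0])
    (fun r hr => mem_steps.2 (hmem r (hle r hr))) (fun r _ r' _ h => ?_) (fun d hd => ?_)
    fun r hr => ?_
  · exact List.ofFn_injective (List.append_left_injective _ h)
  · obtain ⟨h4, h5, h6⟩ := isStep_false_iff.1 (mem_steps.1 hd)
    refine ⟨fun j => d.getD j 0, Fintype.mem_piFinset.2 fun j => by
      simpa [Nat.lt_succ_iff] using h5 j, ?_⟩
    refine List.ext_getElem (by simp [h4, hG]) fun i hi hi' => ?_
    rw [← List.getD_eq_getElem _ 0 hi, ← List.getD_eq_getElem _ 0 hi', hget]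
    split_ifs with h h'
    · rfl
    · rw [h', h6 k hG.symm]
    · rw [h4] at hi'
      omega
  · have h7 : (fun j : Fin k => e j.succ + G.getD j 0 - r j) =
        stair (part (newGaps G (List.ofFn r ++ [G.getD k 0]))) k := by
      funext j
      have h8 := part_newGaps (hmem r (hle r hr)) j
      have h9 := part_eq_add G j
      have h10 := hle r hr j
      rw [hget, dif_pos j.2] at h8
      simp only [he, stair, Fin.val_rev, Fin.val_succ]
      simp only [Fin.eta] at h8
      omega
    rw [h7, List.sum_append, List.sum_ofFn, List.sum_singleton, pow_add]
    ring

/-- The polynomials of horizontal strips are quotients of alternants. -/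
theorem stripPoly_mul_alternant : ∀ {k : ℕ} {G : List ℕ}, G.length = k →
    stripPoly false k G * alternant (stair 0 k) = alternant (stair (part G) k)
  | 0, G, hG => by simp [stripPoly, alternant]
  | k + 1, G, hG => by
    have h := alternant_branch (k := k) (G := List.replicate (k + 1) 0) (by simp)
    rw [steps_replicate_zero, Finset.sum_singleton, newGaps_replicate_zero, part_replicate_zero,
      part_replicate_zero] at h
    rw [h, alternant_branch hG, stripPoly, Finset.sum_mul, Finset.mul_sum]
    refine Finset.sum_congr rfl fun d hd => ?_
    rw [← stripPoly_mul_alternant (k := k) (G := newGaps G d)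
      (by rw [length_newGaps (mem_steps.1 hd).length_eq, hG]; rfl), map_mul, List.sum_replicate]
    simp
    ring

/-! ### Coefficients and symmetry -/

theorem monomial_expo {k : ℕ} (e : Fin k → ℕ) :
    (monomial (expo e) 1 : MvPolynomial (Fin k) ℂ) = ∏ i, X i ^ e i := by
  rw [monomial_eq, C_1, one_mul, Finsupp.prod_fintype _ _ fun i => pow_zero _]
  rfl

theorem alternant_eq_sum {k : ℕ} (e : Fin k → ℕ) : alternant e =
    ∑ σ : Equiv.Perm (Fin k), C ((Equiv.Perm.sign σ : ℤ) : ℂ) * monomial (expo (e ∘ σ)) 1 := by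
  rw [alternant, ← Matrix.det_transpose, Matrix.det_apply']
  refine Finset.sum_congr rfl fun σ _ => ?_
  rw [monomial_expo]
  simp

theorem coeff_alternant {k : ℕ} {e e' : Fin k → ℕ} (he : StrictAnti e) (he' : StrictAnti e') :
    coeff (expo e') (alternant e) = if e = e' then 1 else 0 := by
  have key : ∀ σ : Equiv.Perm (Fin k), e ∘ σ = e' → e = e' ∧ σ = 1 := fun σ h => by
    have h1 : e = e' := (he.range_inj he').1 (by rw [← h, σ.surjective.range_comp])
    refine ⟨h1, Equiv.ext fun i => he.injective ?_⟩
    rw [← h1] at h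
    exact congrFun h i
  rw [alternant_eq_sum, coeff_sum, Finset.sum_eq_single 1]
  · simp [coeff_monomial, expo_injective.eq_iff]
  · intro σ _ hσ
    rw [coeff_C_mul, coeff_monomial, if_neg fun h => hσ (key σ (expo_injective h)).2, mul_zero]
  · simp

theorem stair_strictAnti {a : ℕ → ℕ} {k : ℕ} (ha : ∀ i j, i ≤ j → j < k → a j ≤ a i) :
    StrictAnti (stair a k) := fun i j hij => by
  have h := ha i j hij.le j.2
  have hj := j.2
  have hij' : (i : ℕ) < j := hij
  simp only [stair, Fin.val_rev]
  omega

theorem alternant_stair_zero_ne_zero (k : ℕ) : alternant (stair 0 k) ≠ 0 := fun h => by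
  have h0 : StrictAnti (stair 0 k) := stair_strictAnti fun _ _ _ _ => le_rfl
  have h1 := coeff_alternant h0 h0
  rw [h, if_pos rfl, coeff_zero] at h1
  exact zero_ne_one h1

theorem rename_alternant {k : ℕ} (σ : Equiv.Perm (Fin k)) (e : Fin k → ℕ) :
    rename σ (alternant e) = ((Equiv.Perm.sign σ : ℤ) : MvPolynomial (Fin k) ℂ) * alternant e := by
  rw [alternant, ← Matrix.det_permute, AlgHom.map_det]
  congr 1
  ext1 i j
  simp

/-- The polynomials of horizontal strips are symmetric. -/
theorem isSymmetric_stripPoly {k : ℕ} {G : List ℕ} (hG : G.length = k) :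
    (stripPoly false k G).IsSymmetric := fun σ => by
  have h := congrArg (rename σ) (stripPoly_mul_alternant hG)
  rw [map_mul, rename_alternant, rename_alternant, ← stripPoly_mul_alternant hG] at h
  have h1 : ((Equiv.Perm.sign σ : ℤ) : MvPolynomial (Fin k) ℂ) ≠ 0 := by
    rcases Int.units_eq_one_or (Equiv.Perm.sign σ) with h | h <;> simp [h]
  refine mul_right_cancel₀ (mul_ne_zero h1 (alternant_stair_zero_ne_zero k)) (h.trans ?_)
  ring

theorem coeff_comp_perm {k : ℕ} {P : MvPolynomial (Fin k) ℂ} (hP : P.IsSymmetric)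
    (σ : Equiv.Perm (Fin k)) (e : Fin k → ℕ) : coeff (expo (e ∘ σ)) P = coeff (expo e) P := by
  have h : (expo (e ∘ σ)).mapDomain σ = expo e := by
    ext i
    obtain ⟨i, rfl⟩ := σ.surjective i
    rw [Finsupp.mapDomain_apply σ.injective]
    rfl
  rw [← coeff_rename_mapDomain σ σ.injective, h, hP σ]

theorem isHomogeneous_stripPoly (del : Bool) : ∀ {k : ℕ} {G : List ℕ}, G.length = k →
    (stripPoly del k G).IsHomogeneous (gapSize G)
  | 0, G, hG => by
    rw [List.length_eq_zero_iff.1 hG]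
    exact isHomogeneous_one _ _
  | k + 1, G, hG => by
    refine IsHomogeneous.sum _ _ _ fun d hd => ?_
    have hd' := mem_steps.1 hd
    have h := isHomogeneous_stripPoly del (k := k) (G := newGaps G d)
      (by rw [length_newGaps hd'.length_eq, hG]; rfl)
    rw [← (gapSize_newGaps hd').1]
    exact (isHomogeneous_X_pow _ _).mul h.rename_isHomogeneous

theorem degree_expo {k : ℕ} (e : Fin k → ℕ) : (expo e).degree = ∑ i, e i := by
  rw [Finsupp.degree_eq_sum]
  rfl

/-! ### Monomial symmetric polynomials -/

/-- The multiset of the parts of the partition with gaps `G`. -/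
def partSet : List ℕ → Multiset ℕ
  | [] => 0
  | g :: G => (g + G.sum) ::ₘ partSet G

theorem isStep_true_iff_of_pos : ∀ {a : ℕ} {G d : List ℕ}, 0 < a → (IsStep true a G d ↔ d = G)
  | _, [], [], _ => by simp [IsStep]
  | _, [], _ :: _, _ => by simp [IsStep]
  | _, _ :: _, [], _ => by simp [IsStep]
  | a, g :: G, x :: D, ha => by
    rw [IsStep, isStep_true_iff_of_pos (Nat.add_pos_left ha x), List.cons.injEq]
    constructor
    · rintro ⟨-, -, h1, h2⟩
      exact ⟨(h1 rfl).resolve_left (by omega), h2⟩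
    · rintro ⟨rfl, rfl⟩
      exact ⟨le_rfl, fun _ => rfl, fun _ => Or.inr rfl, rfl⟩

theorem isStep_true_self (a : ℕ) (G : List ℕ) : IsStep true a G G := by
  induction G generalizing a with
  | nil => trivial
  | cons g G ih => exact ⟨le_rfl, fun _ => rfl, fun _ => Or.inr rfl, ih _⟩

/-- A deletion step either leaves the first part alone, or deletes it. -/
theorem isStep_true_cons {g : ℕ} {G d : List ℕ} : IsStep true 0 (g :: G) d ↔
    d = g :: G ∨ G ≠ [] ∧ ∃ D, d = 0 :: D ∧ IsStep true 0 G D := by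
  constructor
  · intro h
    rcases d with _ | ⟨x, D⟩
    · exact h.elim
    · obtain ⟨-, h2, h3, h4⟩ := h
      rcases Nat.eq_zero_or_pos x with rfl | hx
      · by_cases hG : G = []
        · subst hG
          rcases D with _ | ⟨y, D⟩
          · exact Or.inl (by rw [h2 rfl])
          · exact h4.elim
        · exact Or.inr ⟨hG, D, rfl, h4⟩
      · have h5 := (h3 rfl).resolve_left (by omega)
        rw [isStep_true_iff_of_pos (by omega)] at h4
        exact Or.inl (by rw [h5, h4])
  · rintro (rfl | ⟨hG, D, rfl, h⟩)
    · exact isStep_true_self _ _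
    · exact ⟨Nat.zero_le _, fun h => absurd h hG, fun _ => Or.inl rfl, h⟩

theorem newGaps_cons_self (g : ℕ) (G : List ℕ) : newGaps (g :: G) (g :: G) = G := by
  refine List.ext_getElem (by simp [newGaps]) fun i hi hi' => ?_
  cases i <;> simp [newGaps]

theorem partSet_newGaps : ∀ {G d : List ℕ}, G ≠ [] → IsStep true 0 G d →
    d.sum ::ₘ partSet (newGaps G d) = partSet G
  | [], _, h, _ => absurd rfl h
  | g :: G, d, _, h => by
    rcases isStep_true_cons.1 h with rfl | ⟨hG, D, rfl, hD⟩
    · rw [newGaps_cons_self, partSet, List.sum_cons]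
    · obtain ⟨y, D', rfl⟩ : ∃ y D', D = y :: D' := List.exists_cons_of_ne_nil fun h0 => by
        have := hD.length_eq
        rw [h0] at this
        exact hG (List.length_eq_zero_iff.1 this.symm)
      obtain ⟨g', G', rfl⟩ := List.exists_cons_of_ne_nil hG
      have h2 : newGaps (g :: g' :: G') (0 :: y :: D') =
          (g + y) :: newGaps (g' :: G') (y :: D') := by simp [newGaps]
      have h3 := (gapSize_newGaps hD).2
      rw [List.headD_cons] at h3
      have h4 : g + y + (newGaps (g' :: G') (y :: D')).sum = g + (g' :: G').sum := by omega
      rw [h2, partSet, partSet, Multiset.cons_swap, h4, List.sum_cons (a := 0), zero_add,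
        partSet_newGaps hG hD]

theorem IsStep.sum_le {G d : List ℕ} (h : IsStep true 0 G d) : d.sum ≤ G.sum := by
  induction G generalizing d with
  | nil =>
    cases d with
    | nil => rfl
    | cons x D => exact h.elim
  | cons g G ih =>
    rcases isStep_true_cons.1 h with rfl | ⟨hG, D, rfl, hD⟩
    · rfl
    · have := ih hD
      simp only [List.sum_cons]
      omega

theorem IsStep.eq_of_sum_eq {G d : List ℕ} (h : IsStep true 0 G d) (hs : d.sum = G.sum) :
    d = G := by
  induction G generalizing d with
  | nil =>
    cases d with
    | nil => rfl
    | cons x D => exact h.elim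
  | cons g G ih =>
    rcases isStep_true_cons.1 h with rfl | ⟨hG, D, rfl, hD⟩
    · rfl
    · have := hD.sum_le
      simp only [List.sum_cons] at hs
      rw [ih hD (by omega), show g = 0 by omega]

/-- The value of the deleted part determines the deletion step. -/
theorem IsStep.unique {G d d' : List ℕ} (h : IsStep true 0 G d) (h' : IsStep true 0 G d')
    (hs : d.sum = d'.sum) : d = d' := by
  induction G generalizing d d' with
  | nil =>
    rw [List.length_eq_zero_iff.1 h.length_eq, List.length_eq_zero_iff.1 h'.length_eq]
  | cons g G ih =>
    rcases isStep_true_cons.1 h with rfl | ⟨hG, D, rfl, hD⟩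
    · exact (h'.eq_of_sum_eq hs.symm).symm
    · rcases isStep_true_cons.1 h' with rfl | ⟨-, D', rfl, hD'⟩
      · exact h.eq_of_sum_eq hs
      · rw [ih hD hD' (by simpa using hs)]

theorem exists_isStep_true {G : List ℕ} {v : ℕ} (h : v ∈ partSet G) :
    ∃ d, IsStep true 0 G d ∧ d.sum = v := by
  induction G with
  | nil => simp [partSet] at h
  | cons g G ih =>
    rw [partSet, Multiset.mem_cons] at h
    rcases h with rfl | h
    · exact ⟨_, isStep_true_self _ _, List.sum_cons⟩
    · obtain ⟨D, hD, rfl⟩ := ih h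
      refine ⟨0 :: D, isStep_true_cons.2 (Or.inr ⟨?_, D, rfl, hD⟩), by simp⟩
      rintro rfl
      simp [partSet] at h

/-- The exponents of the monomials of a polynomial of deletion steps are the rearrangements of the
parts. -/
theorem coeff_stripPoly_true : ∀ {k : ℕ} {G : List ℕ}, G.length = k → ∀ e : Fin k → ℕ,
    coeff (expo e) (stripPoly true k G) = if Finset.univ.val.map e = partSet G then 1 else 0
  | 0, G, hG, e => by
    rw [List.length_eq_zero_iff.1 hG, Subsingleton.elim (expo e) 0]
    simp [stripPoly, partSet]
  | k + 1, G, hG, e => by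
    have hG0 : G ≠ [] := by
      rintro rfl
      simp at hG
    obtain ⟨v, e, rfl⟩ : ∃ v e', e = Fin.cons v e' := ⟨_, _, (Fin.cons_self_tail e).symm⟩
    have h1 : (Finset.univ.val.map (Fin.cons v e : Fin (k + 1) → ℕ) : Multiset ℕ) =
        v ::ₘ Finset.univ.val.map e := by
      rw [Fin.univ_succ]
      simp [Function.comp_def]
    have h2 : ∀ d ∈ steps true 0 G, coeff (expo (Fin.cons v e))
        (X 0 ^ d.sum * rename Fin.succ (stripPoly true k (newGaps G d))) =
          if d.sum = v ∧ v ::ₘ Finset.univ.val.map e = partSet G then 1 else 0 := fun d hd => by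
      have hd' := mem_steps.1 hd
      rw [coeff_cons_X_pow_mul_rename, coeff_stripPoly_true (k := k) (G := newGaps G d)
        (by rw [length_newGaps hd'.length_eq, hG]; rfl), ← partSet_newGaps hG0 hd', ite_and]
      by_cases h : d.sum = v
      · simp only [h, if_true, Multiset.cons_inj_right]
      · simp [h]
    rw [h1, stripPoly, coeff_sum, Finset.sum_congr rfl h2]
    split_ifs with h
    · obtain ⟨d, hd, hdv⟩ := exists_isStep_true (v := v) (G := G) (by rw [← h]; simp)
      rw [Finset.sum_eq_single_of_mem d (mem_steps.2 hd) fun d' hd' hne => if_neg fun h3 =>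
        hne ((mem_steps.1 hd').unique hd (h3.1.trans hdv.symm)), if_pos ⟨hdv, h⟩]
    · exact Finset.sum_eq_zero fun d _ => if_neg fun h3 => h h3.2

theorem partSet_gapsOf {K : List ℕ} (h : Decr K) : partSet (gapsOf K) = K := by
  induction K with
  | nil => rfl
  | cons a l ih =>
    have h1 := h.1
    rw [gapsOf, partSet, sum_gapsOf h.2, ih h.2, Multiset.cons_coe]
    congr 2
    omega

/-- The gaps of a partition. -/
def PartSeq.gaps {n : ℕ} (κ : PartSeq n) : List ℕ := gapsOf (List.ofFn κ.1)

theorem PartSeq.length_gaps {n : ℕ} (κ : PartSeq n) : κ.gaps.length = n := by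
  rw [PartSeq.gaps, length_gapsOf, List.length_ofFn]

theorem exists_perm_comp_eq {n : ℕ} {e e' : Fin n → ℕ}
    (h : Finset.univ.val.map e = Finset.univ.val.map e') : ∃ σ : Equiv.Perm (Fin n), e' ∘ σ = e := by
  have h1 : (List.ofFn e).Perm (List.ofFn e') := by
    rwa [Fin.univ_val_map, Fin.univ_val_map, Multiset.coe_eq_coe] at h
  have h2 : e ∘ Tuple.sort e = e' ∘ Tuple.sort e' := List.ofFn_injective <|
    ((((Tuple.sort e).ofFn_comp_perm e).trans h1).trans
      ((Tuple.sort e').ofFn_comp_perm e').symm).eq_of_pairwise'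
      (Tuple.monotone_sort e).sortedLE_ofFn.pairwise (Tuple.monotone_sort e').sortedLE_ofFn.pairwise
  refine ⟨(Tuple.sort e).symm.trans (Tuple.sort e'), funext fun i => ?_⟩
  have h3 := congrFun h2 ((Tuple.sort e).symm i)
  simpa using h3.symm

theorem coeff_monomialSymm {n : ℕ} (κ : PartSeq n) (e : Fin n → ℕ) : coeff (expo e)
    (monomialSymm κ) = if ∃ σ : Equiv.Perm (Fin n), κ.1 ∘ σ = e then 1 else 0 := by
  have h : ∀ a : Fin n → ℕ, coeff (expo e)
      (monomial (Finsupp.equivFunOnFinite.symm a) (1 : ℂ)) = if e = a then 1 else 0 := fun a => by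
    rw [coeff_monomial]
    exact if_congr (expo_injective.eq_iff.trans eq_comm) rfl rfl
  rw [monomialSymm, coeff_sum, Finset.sum_congr rfl fun a _ => h a, Finset.sum_ite_eq]
  simp

theorem monomialSymm_eq_stripPoly {n : ℕ} (κ : PartSeq n) :
    monomialSymm κ = stripPoly true n κ.gaps := by
  ext m
  obtain ⟨e, rfl⟩ : ∃ e, m = expo e := ⟨m, Finsupp.ext fun _ => rfl⟩
  rw [coeff_monomialSymm, coeff_stripPoly_true κ.length_gaps, PartSeq.gaps,
    partSet_gapsOf (decr_ofFn.2 κ.2)]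
  have h : ((List.ofFn κ.1 : List ℕ) : Multiset ℕ) = Finset.univ.val.map κ.1 := by
    rw [Fin.univ_val_map]
  rw [h]
  refine if_congr ⟨?_, exists_perm_comp_eq⟩ rfl rfl
  rintro ⟨σ, rfl⟩
  rw [← Multiset.map_map]
  congr 1
  exact congrArg Finset.val (Finset.map_univ_equiv σ)

/-! ### Kostka numbers as coefficients -/

/-- The number of entries `t` in the first `k` rows of a filling `T` of the diagram with row
lengths `K`. -/
def countEntry (K : ℕ → ℕ) (k : ℕ) (T : ℕ → ℕ → ℕ) (t : ℕ) : ℕ :=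
  ∑ i ∈ Finset.range k, ((Finset.range (K i)).filter fun j => T i j = t).card

/-- `T` is a semistandard tableau of the shape with row lengths `K`, with entries less than `k` and
with `c t` entries `t` for `t < k`. The shape is meant to have at most `k` rows. -/
structure IsTab (k : ℕ) (K : ℕ → ℕ) (c : ℕ → ℕ) (T : ℕ → ℕ → ℕ) : Prop where
  zero : ∀ i j, K i ≤ j → T i j = 0
  row : ∀ i j₁ j₂, j₁ < j₂ → j₂ < K i → T i j₁ ≤ T i j₂
  col : ∀ i₁ i₂ j, i₁ < i₂ → j < K i₂ → T i₁ j < T i₂ j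
  lt : ∀ i j, j < K i → T i j < k
  count : ∀ t, t < k → countEntry K k T t = c t

/-- The filling `T`, with the entry `k` in the cells of `K` that are not in `K'`. -/
def fillStrip (k : ℕ) (K' K : ℕ → ℕ) (T : ℕ → ℕ → ℕ) (i j : ℕ) : ℕ :=
  if K' i ≤ j ∧ j < K i then k else T i j

section FillStrip

variable {k : ℕ} {K K' : ℕ → ℕ} {T : ℕ → ℕ → ℕ}

theorem countEntry_fillStrip_of_lt {t : ℕ} (hK : ∀ i, K' i ≤ K i) (hk : K' k = 0) (ht : t < k) :
    countEntry K (k + 1) (fillStrip k K' K T) t = countEntry K' k T t := by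
  have h : ∀ i, (Finset.range (K i)).filter (fun j => fillStrip k K' K T i j = t) =
      (Finset.range (K' i)).filter fun j => T i j = t := fun i => by
    ext j
    have := hK i
    rw [Finset.mem_filter, Finset.mem_filter, Finset.mem_range, Finset.mem_range, fillStrip]
    split_ifs <;> omega
  rw [countEntry, Finset.sum_range_succ, h k, hk, countEntry]
  simp [h]

theorem countEntry_fillStrip_self (hT : ∀ i j, j < K' i → T i j < k) :
    countEntry K (k + 1) (fillStrip k K' K T) k = ∑ i ∈ Finset.range (k + 1), (K i - K' i) := by
  refine Finset.sum_congr rfl fun i _ => ?_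
  rw [← Nat.card_Ico]
  congr 1
  ext j
  have := hT i j
  rw [Finset.mem_filter, Finset.mem_range, fillStrip, Finset.mem_Ico]
  split_ifs <;> omega

end FillStrip

theorem exists_threshold {f : ℕ → ℕ} {n k : ℕ} (hf : ∀ j₁ j₂, j₁ < j₂ → j₂ < n → f j₁ ≤ f j₂)
    (hk : ∀ j, j < n → f j < k + 1) : ∃ m, m ≤ n ∧ ∀ j, j < n → (f j = k ↔ m ≤ j) := by
  have hex : ∃ m, n ≤ m ∨ f m = k := ⟨n, Or.inl le_rfl⟩
  refine ⟨Nat.find hex, Nat.find_min' hex (Or.inl le_rfl), fun j hj =>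
    ⟨fun h => Nat.find_min' hex (Or.inr h), fun h => ?_⟩⟩
  rcases Nat.find_spec hex with h1 | h1
  · omega
  · rcases h.eq_or_lt with h2 | h2
    · rwa [h2] at h1
    · have h3 := hf _ _ h2 hj
      have h4 := hk j hj
      omega

theorem sum_eq_sum_range_getD {d : List ℕ} {n : ℕ} (h : d.length = n) :
    d.sum = ∑ i ∈ Finset.range n, d.getD i 0 := by
  subst h
  induction d with
  | nil => rfl
  | cons a d ih => simp [Finset.sum_range_succ', ih, add_comm]

theorem IsTab.le_entry {k : ℕ} {K c : ℕ → ℕ} {T : ℕ → ℕ → ℕ} (h : IsTab k K c T) (hK : Antitone K)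
    {i j : ℕ} (hj : j < K i) : i ≤ T i j := by
  induction i with
  | zero => exact Nat.zero_le _
  | succ i ih =>
    have h1 := ih (hj.trans_le (hK (Nat.le_succ i)))
    have h2 := h.col i (i + 1) j (Nat.lt_succ_self i) hj
    omega

/-- The entries `k` of a tableau with entries at most `k` form a horizontal strip. -/
theorem isTab_succ_iff {k : ℕ} {G : List ℕ} (hG : G.length = k + 1) {c : ℕ → ℕ} {T : ℕ → ℕ → ℕ} :
    IsTab (k + 1) (part G) c T ↔ ∃ d T', IsStep false 0 G d ∧ d.sum = c k ∧
      IsTab k (part (newGaps G d)) c T' ∧ T = fillStrip k (part (newGaps G d)) (part G) T' := by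
  have hanti := part_antitone G
  have hsum : ∀ {d}, IsStep false 0 G d →
      ∑ i ∈ Finset.range (k + 1), (part G i - part (newGaps G d) i) = d.sum := fun {d} hd => by
    rw [sum_eq_sum_range_getD (hd.length_eq.trans hG)]
    refine Finset.sum_congr rfl fun i _ => ?_
    have := part_newGaps hd i
    omega
  have hlast : ∀ {d}, IsStep false 0 G d → part (newGaps G d) k = 0 := fun hd =>
    part_of_length_le (by rw [length_newGaps hd.length_eq, hG]; rfl)
  constructor
  · intro h
    -- The entries `k` of row `i` start in column `m i`.
    choose m hm hmk using fun i => exists_threshold (h.row i) (h.lt i)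
    have hmk0 : m k = 0 := by
      rcases Nat.eq_zero_or_pos (part G k) with h0 | h0
      · have := hm k
        omega
      · have h1 := h.le_entry hanti h0
        have h2 := h.lt k 0 h0
        have h3 := (hmk k 0 h0).1 (by omega)
        omega
    have hlow : ∀ i, part G (i + 1) ≤ m i := fun i => by
      by_contra hlt
      rw [not_le] at hlt
      have h1 := h.col i (i + 1) (m i) (Nat.lt_succ_self i) hlt
      have h2 := h.lt _ _ hlt
      have h3 := (hmk i (m i) (hlt.trans_le (hanti (Nat.le_succ i)))).2 le_rfl
      omega
    have hget : ∀ i, (List.ofFn fun i : Fin (k + 1) => part G i - m i).getD i 0 =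
        part G i - m i := fun i => by
      rw [List.getD_eq_getElem?_getD, List.getElem?_ofFn]
      split_ifs with hi
      · rfl
      · have := part_of_length_le (G := G) (i := i) (by omega)
        simp [this]
    have hd : IsStep false 0 G (List.ofFn fun i : Fin (k + 1) => part G i - m i) := by
      refine isStep_false_iff.2 ⟨by simp [hG], fun i => ?_, fun i hi => ?_⟩
      · have h1 := hlow i
        have h2 := part_eq_add G i
        rw [hget]
        omega
      · obtain rfl : i = k := by omega
        have h1 := part_of_length_le hG.le
        have h2 := part_eq_add G i
        rw [hget]
        omega
    have hnew : ∀ i, part (newGaps G (List.ofFn fun i : Fin (k + 1) => part G i - m i)) i = m i :=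
      fun i => by
        have h1 := part_newGaps hd i
        have h2 := hm i
        rw [hget] at h1
        omega
    set d := List.ofFn fun i : Fin (k + 1) => part G i - m i with hdef
    have hT : T = fillStrip k (part (newGaps G d)) (part G)
        fun i j => if part (newGaps G d) i ≤ j then 0 else T i j := by
      funext i j
      simp only [fillStrip, hnew]
      by_cases h1 : j < part G i
      · have h2 := hmk i j h1
        split_ifs with h3 h4
        · exact h2.2 h3.1
        · exact absurd ⟨h4, h1⟩ h3
        · rfl
      · have h2 := hm i
        rw [if_neg (by omega), if_pos (by omega)]
        exact h.zero i j (not_lt.1 h1)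
    have hlt : ∀ i j, j < part (newGaps G d) i →
        (if part (newGaps G d) i ≤ j then 0 else T i j) < k := fun i j hj => by
      rw [if_neg (not_le.2 hj)]
      rw [hnew] at hj
      have h1 := hm i
      have h2 := h.lt i j (by omega)
      have h3 := hmk i j (by omega)
      omega
    have hle : ∀ i, part (newGaps G d) i ≤ part G i := fun i => by
      rw [hnew]
      exact hm i
    refine ⟨d, _, hd, ?_, ⟨fun i j hj => if_pos hj, fun i j₁ j₂ hj hj₂ => ?_,
      fun i₁ i₂ j hi hj => ?_, hlt, fun t ht => ?_⟩, hT⟩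
    · rw [← h.count k (Nat.lt_succ_self k), hT, countEntry_fillStrip_self hlt, hsum hd]
    · rw [if_neg (by omega), if_neg (by omega)]
      exact h.row i j₁ j₂ hj (hj₂.trans_le (hle i))
    · have := part_antitone (newGaps G d) hi.le
      rw [if_neg (by omega), if_neg (by omega)]
      exact h.col i₁ i₂ j hi (hj.trans_le (hle i₂))
    · rw [← h.count t (by omega), hT, countEntry_fillStrip_of_lt hle (hlast hd) ht, ← hT]
  · rintro ⟨d, T', hd, hdc, h, rfl⟩
    have hle : ∀ i, part (newGaps G d) i ≤ part G i := fun i => by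
      have := part_newGaps hd i
      omega
    have hlow : ∀ i, part G (i + 1) ≤ part (newGaps G d) i := fun i => by
      have h1 := part_newGaps hd i
      have h2 := part_eq_add G i
      have h3 := (isStep_false_iff.1 hd).2.1 i
      omega
    refine ⟨fun i j hj => ?_, fun i j₁ j₂ hj hj₂ => ?_, fun i₁ i₂ j hi hj => ?_,
      fun i j hj => ?_, fun t ht => ?_⟩
    · rw [fillStrip, if_neg (by omega)]
      exact h.zero i j ((hle i).trans hj)
    · have h1 := h.row i j₁ j₂ hj
      have h2 := h.lt i j₁
      simp only [fillStrip]
      split_ifs <;> omega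
    · have h1 := h.col i₁ i₂ j hi
      have h2 := h.lt i₁ j
      have h3 := hlow i₁
      have h4 : part G i₂ ≤ part G (i₁ + 1) := hanti hi
      simp only [fillStrip]
      split_ifs <;> omega
    · have h2 := h.lt i j
      simp only [fillStrip]
      split_ifs <;> omega
    · rcases Nat.lt_succ_iff_lt_or_eq.1 ht with ht | rfl
      · rw [countEntry_fillStrip_of_lt hle (hlast hd) ht, h.count t ht]
      · rw [countEntry_fillStrip_self h.lt, hsum hd, hdc]

open Classical in
/-- The tableaux with gaps `G` and content `c`, built up strip by strip. -/
noncomputable def tabs (c : ℕ → ℕ) : ℕ → List ℕ → Finset (ℕ → ℕ → ℕ)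
  | 0, _ => {fun _ _ => 0}
  | k + 1, G => ((steps false 0 G).filter fun d => d.sum = c k).biUnion fun d =>
      (tabs c k (newGaps G d)).image (fillStrip k (part (newGaps G d)) (part G))

theorem mem_tabs {c : ℕ → ℕ} : ∀ {k : ℕ} {G : List ℕ}, G.length = k → ∀ {T : ℕ → ℕ → ℕ},
    T ∈ tabs c k G ↔ IsTab k (part G) c T
  | 0, G, hG, T => by
    rw [List.length_eq_zero_iff.1 hG, tabs, Finset.mem_singleton]
    constructor
    · rintro rfl
      constructor <;> simp [part]
    · intro h
      funext i j
      exact h.zero i j (by simp [part])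
  | k + 1, G, hG, T => by
    rw [isTab_succ_iff hG, tabs]
    simp only [Finset.mem_biUnion, Finset.mem_filter, mem_steps, Finset.mem_image]
    constructor
    · rintro ⟨d, ⟨h1, h2⟩, T', h3, rfl⟩
      exact ⟨d, T', h1, h2, (mem_tabs (by rw [length_newGaps h1.length_eq, hG]; rfl)).1 h3, rfl⟩
    · rintro ⟨d, T', h1, h2, h3, rfl⟩
      exact ⟨d, ⟨h1, h2⟩, T', (mem_tabs (by rw [length_newGaps h1.length_eq, hG]; rfl)).2 h3, rfl⟩

theorem card_tabs {c : ℕ → ℕ} : ∀ {k : ℕ} {G : List ℕ}, G.length = k →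
    ((tabs c k G).card : ℂ) = coeff (expo fun i : Fin k => c i.rev) (stripPoly false k G)
  | 0, G, hG => by
    rw [Subsingleton.elim (expo _) 0]
    simp [tabs, stripPoly]
  | k + 1, G, hG => by
    classical
    have hlen : ∀ {d}, IsStep false 0 G d → (newGaps G d).length = k := fun hd => by
      rw [length_newGaps hd.length_eq, hG]
      rfl
    have hcons : (fun i : Fin (k + 1) => c i.rev) = Fin.cons (c k) fun i : Fin k => c i.rev := by
      funext i
      refine Fin.cases ?_ (fun i => ?_) i
      · simp
      · simp [Fin.val_rev]
    rw [tabs, Finset.card_biUnion, hcons, stripPoly, coeff_sum, Nat.cast_sum, Finset.sum_filter]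
    · refine Finset.sum_congr rfl fun d hd => ?_
      have hd' := mem_steps.1 hd
      rw [coeff_cons_X_pow_mul_rename, ← card_tabs (hlen hd'), Finset.card_image_of_injOn]
      intro T hT T' hT' hTT'
      rw [Finset.mem_coe, mem_tabs (hlen hd')] at hT hT'
      funext i j
      have h := congrFun (congrFun hTT' i) j
      simp only [fillStrip] at h
      split_ifs at h with h1
      · rw [hT.zero i j h1.1, hT'.zero i j h1.1]
      · exact h
    · intro d hd d' hd' hne
      simp only [Finset.mem_coe, Finset.mem_filter, mem_steps] at hd hd'
      rw [Function.onFun, Finset.disjoint_left]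
      intro T hT hT'
      simp only [Finset.mem_image] at hT hT'
      obtain ⟨T₁, h₁, rfl⟩ := hT
      obtain ⟨T₂, h₂, h⟩ := hT'
      rw [mem_tabs (hlen hd.1)] at h₁
      rw [mem_tabs (hlen hd'.1)] at h₂
      have hpart : ∀ i, part (newGaps G d) i = part (newGaps G d') i := fun i => by
        have e₁ := part_newGaps hd.1 i
        have e₂ := part_newGaps hd'.1 i
        by_contra hne
        -- The cell at the end of the shorter of the two rows tells the strips apart.
        have h3 := congrFun (congrFun h i) (min (part (newGaps G d) i) (part (newGaps G d') i))
        have h4 := h₁.lt i (min (part (newGaps G d) i) (part (newGaps G d') i))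
        have h5 := h₂.lt i (min (part (newGaps G d) i) (part (newGaps G d') i))
        simp only [fillStrip] at h3
        split_ifs at h3 <;> omega
      refine hne (List.ext_getElem (hd.1.length_eq.trans hd'.1.length_eq.symm) fun i hi hi' => ?_)
      have e₁ := part_newGaps hd.1 i
      have e₂ := part_newGaps hd'.1 i
      have e₃ := hpart i
      rw [List.getD_eq_getElem _ _ hi] at e₁
      rw [List.getD_eq_getElem _ _ hi'] at e₂
      omega

theorem part_gapsOf {K : List ℕ} (h : Decr K) (i : ℕ) :
    part (gapsOf K) i = K.getD i 0 := by
  induction K generalizing i with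
  | nil => simp [part, gapsOf]
  | cons a l ih =>
    cases i with
    | zero =>
      have := h.1
      have h2 := sum_gapsOf h
      simpa [part] using h2
    | succ i => simpa [part, gapsOf] using ih h.2 i

theorem PartSeq.part_gaps {n : ℕ} (κ : PartSeq n) (i : ℕ) :
    part κ.gaps i = if h : i < n then κ.1 ⟨i, h⟩ else 0 := by
  rw [PartSeq.gaps, part_gapsOf (decr_ofFn.2 κ.2), List.getD_eq_getElem?_getD,
    List.getElem?_ofFn]
  split_ifs <;> rfl

theorem PartSeq.mem_diagram {n : ℕ} {κ : PartSeq n} {i j : ℕ} :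
    (i, j) ∈ κ.diagram ↔ j < part κ.gaps i := by
  rw [PartSeq.diagram, YoungDiagram.mem_ofRowLens, PartSeq.part_gaps]
  by_cases h : i < n <;> simp [h]

theorem card_filter_diagram {n : ℕ} (κ : PartSeq n) (T : ℕ → ℕ → ℕ) (t : ℕ) :
    (κ.diagram.cells.filter fun x => T x.1 x.2 = t).card = countEntry (part κ.gaps) n T t := by
  have hmem : ∀ x : ℕ × ℕ, x ∈ κ.diagram.cells ↔ x.2 < part κ.gaps x.1 := fun x =>
    (YoungDiagram.mem_cells _).trans PartSeq.mem_diagram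
  rw [Finset.card_eq_sum_card_fiberwise (f := Prod.fst) (t := Finset.range n)]
  · refine Finset.sum_congr rfl fun i _ => ?_
    refine Finset.card_nbij' Prod.snd (fun j => (i, j)) ?_ ?_ ?_ ?_
    · rintro ⟨i', j⟩ h
      simp only [Finset.mem_coe, Finset.mem_filter, hmem] at h
      obtain ⟨⟨h1, h2⟩, rfl⟩ := h
      simpa using ⟨h1, h2⟩
    · intro j h
      simpa [hmem] using h
    · rintro ⟨i', j⟩ h
      simp only [Finset.mem_coe, Finset.mem_filter] at h
      rw [← h.2]
    · intro j _
      rfl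
  · rintro ⟨i, j⟩ h
    simp only [Finset.mem_coe, Finset.mem_filter, hmem] at h
    have h1 := h.1
    rw [PartSeq.part_gaps] at h1
    rw [Finset.mem_coe, Finset.mem_range]
    by_contra h2
    simp [h2] at h1

theorem kostka_eq_card_tabs {n : ℕ} (κ μ : PartSeq n) :
    kostka κ μ = (tabs (fun t => if h : t < n then μ.1 ⟨t, h⟩ else 0) n κ.gaps).card := by
  rw [kostka, ← Fintype.card_coe, ← Nat.card_eq_fintype_card]
  refine Nat.card_congr ⟨fun T => ⟨T.1, (mem_tabs κ.length_gaps).2 ?_⟩, fun T => ⟨⟨T.1, ?_, ?_, ?_⟩, ?_⟩,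
    fun _ => rfl, fun _ => rfl⟩
  · have hT := T.2
    simp only [card_filter_diagram] at hT
    refine ⟨fun i j h => T.1.zeros fun h' => (PartSeq.mem_diagram.1 h').not_ge h,
      fun i j₁ j₂ hj h => T.1.row_weak hj (PartSeq.mem_diagram.2 h),
      fun i₁ i₂ j hi h => T.1.col_strict hi (PartSeq.mem_diagram.2 h), fun i j h => ?_,
      fun t _ => hT t⟩
    by_contra h1
    have h2 := T.2 (T.1 i j)
    rw [dif_neg h1, Finset.card_eq_zero, Finset.filter_eq_empty_iff] at h2
    exact h2 ((YoungDiagram.mem_cells _).2 (PartSeq.mem_diagram.2 h) : (i, j) ∈ _) rfl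
  · have hT := (mem_tabs κ.length_gaps).1 T.2
    exact fun {_ _ _} hj h => hT.row _ _ _ hj (PartSeq.mem_diagram.1 h)
  · have hT := (mem_tabs κ.length_gaps).1 T.2
    exact fun {_ _ _} hi h => hT.col _ _ _ hi (PartSeq.mem_diagram.1 h)
  · have hT := (mem_tabs κ.length_gaps).1 T.2
    exact fun {_ _} h => hT.zero _ _ (not_lt.1 fun h' => h (PartSeq.mem_diagram.2 h'))
  · have hT := (mem_tabs κ.length_gaps).1 T.2
    intro t
    by_cases ht : t < n
    · exact (card_filter_diagram κ T.1 t).trans (hT.count t ht)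
    · rw [dif_neg ht, Finset.card_eq_zero, Finset.filter_eq_empty_iff]
      rintro ⟨i, j⟩ hc rfl
      exact ht (hT.lt i j (PartSeq.mem_diagram.1 ((YoungDiagram.mem_cells _).1 hc)))

/-- The Kostka numbers are the coefficients of the polynomials of horizontal strips. -/
theorem kostka_eq_coeff {n : ℕ} (κ μ : PartSeq n) :
    (kostka κ μ : ℂ) = coeff (expo μ.1) (stripPoly false n κ.gaps) := by
  rw [kostka_eq_card_tabs, card_tabs κ.length_gaps,
    ← coeff_comp_perm (isSymmetric_stripPoly κ.length_gaps) Fin.revPerm μ.1]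
  have h : (fun i : Fin n => if h : (i.rev : ℕ) < n then μ.1 ⟨i.rev, h⟩ else 0) =
      μ.1 ∘ Fin.revPerm := by
    funext i
    rw [dif_pos i.rev.2]
    rfl
  rw [h]

/-! ### Schur polynomials -/

theorem PartSeq.gapSize_gaps {n : ℕ} (κ : PartSeq n) : gapSize κ.gaps = κ.size := by
  rw [PartSeq.gaps, gapSize_gapsOf (decr_ofFn.2 κ.2), List.sum_ofFn]
  rfl

theorem PartSeq.getD_ofFn {n : ℕ} (κ : PartSeq n) :
    (fun i => (List.ofFn κ.1).getD i 0) = part κ.gaps :=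
  funext fun i => (part_gapsOf (decr_ofFn.2 κ.2) i).symm

/-- A symmetric form is determined by its coefficients at partitions. -/
theorem eq_sum_monomialSymm {n k : ℕ} {P : MvPolynomial (Fin n) ℂ} (hP : P.IsSymmetric)
    (hk : P.IsHomogeneous k) :
    P = ∑ μ : PartSeqOf n k, coeff (expo μ.1.1) P • monomialSymm μ.1 := by
  ext m
  obtain ⟨e, rfl⟩ : ∃ e, m = expo e := ⟨m, Finsupp.ext fun _ => rfl⟩
  simp only [coeff_sum, coeff_smul, coeff_monomialSymm, smul_eq_mul]
  by_cases he : ∑ i, e i = k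
  · have hanti : Antitone (e ∘ ⇑(Fin.revPerm.trans (Tuple.sort e))) := fun i j hij =>
      Tuple.monotone_sort e (Fin.rev_le_rev.2 hij)
    have hsize : PartSeq.size ⟨_, hanti⟩ = k :=
      (Equiv.sum_comp (Fin.revPerm.trans (Tuple.sort e)) e).trans he
    rw [Finset.sum_eq_single (⟨⟨_, hanti⟩, hsize⟩ : PartSeqOf n k)]
    · rw [if_pos ⟨(Fin.revPerm.trans (Tuple.sort e)).symm, by funext i; simp⟩, mul_one,
        coeff_comp_perm hP]
    · intro μ _ hμ
      rw [if_neg, mul_zero]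
      rintro ⟨σ, hσ⟩
      refine hμ (Subtype.ext (Subtype.ext ?_))
      have h1 : μ.1.1 ∘ ⇑(1 : Equiv.Perm (Fin n)) =
          μ.1.1 ∘ ⇑((Fin.revPerm.trans (Tuple.sort e)).trans σ) :=
        Tuple.unique_antitone μ.1.2 (by
          rw [Equiv.coe_trans, ← Function.comp_assoc, hσ]
          exact hanti)
      simpa [← hσ, Function.comp_assoc] using h1
    · simp
  · rw [hk.coeff_eq_zero (by rwa [degree_expo]), Finset.sum_eq_zero]
    intro μ _
    rw [if_neg, mul_zero]
    rintro ⟨σ, hσ⟩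
    rw [← hσ] at he
    exact he ((Equiv.sum_comp σ μ.1.1).trans μ.2)

theorem schur_eq_stripPoly {n : ℕ} (κ : PartSeq n) : schur κ = stripPoly false n κ.gaps := by
  have h := isHomogeneous_stripPoly false κ.length_gaps
  rw [κ.gapSize_gaps] at h
  rw [eq_sum_monomialSymm (isSymmetric_stripPoly κ.length_gaps) h, schur]
  simp only [kostka_eq_coeff]

/-- The coefficient of the monomial with exponents `κ + (n - 1, …, 1, 0)` in the product of a
polynomial with the Vandermonde determinant. On symmetric polynomials, this is the coefficient of
the Schur polynomial of `κ`. -/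
noncomputable def schurCoeff {n : ℕ} (κ : PartSeq n) : MvPolynomial (Fin n) ℂ →ₗ[ℂ] ℂ :=
  lcoeff ℂ (expo (stair (part κ.gaps) n)) ∘ₗ LinearMap.mulRight ℂ (alternant (stair 0 n))

theorem schurCoeff_apply {n : ℕ} (κ : PartSeq n) (P : MvPolynomial (Fin n) ℂ) :
    schurCoeff κ P = coeff (expo (stair (part κ.gaps) n)) (P * alternant (stair 0 n)) := rfl

theorem PartSeq.strictAnti_stair {n : ℕ} (κ : PartSeq n) : StrictAnti (stair (part κ.gaps) n) :=
  stair_strictAnti fun _ _ hij _ => part_antitone _ hij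

theorem PartSeq.stair_injective {n : ℕ} {κ μ : PartSeq n}
    (h : stair (part κ.gaps) n = stair (part μ.gaps) n) : κ = μ := by
  refine Subtype.ext (funext fun i => ?_)
  have h1 := congrFun h i
  simpa [stair, PartSeq.part_gaps] using h1

theorem schur_mul_alternant {n : ℕ} (κ : PartSeq n) :
    schur κ * alternant (stair 0 n) = alternant (stair (part κ.gaps) n) := by
  rw [schur_eq_stripPoly, stripPoly_mul_alternant κ.length_gaps]

theorem schurCoeff_schur {n : ℕ} (κ μ : PartSeq n) :
    schurCoeff μ (schur κ) = if κ = μ then 1 else 0 := by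
  rw [schurCoeff_apply, schur_mul_alternant, coeff_alternant κ.strictAnti_stair μ.strictAnti_stair]
  exact if_congr ⟨PartSeq.stair_injective, fun h => by rw [h]⟩ rfl rfl

theorem schurCoeff_monomialSymm {n : ℕ} (κ μ : PartSeq n) : schurCoeff μ (monomialSymm κ) =
    (sgnCount true (List.ofFn μ.1) κ.gaps (List.replicate n 0) : ℂ) := by
  have h := coeff_stripPoly_mul_alternant true (k := n) (L := List.ofFn μ.1) (G := κ.gaps)
    (N := List.replicate n 0) (by simp) κ.length_gaps (by simp)
  have h0 : (fun i => (List.replicate n 0).getD i 0) = 0 := by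
    funext i
    simp
  rw [h0, PartSeq.getD_ofFn] at h
  rw [schurCoeff_apply, monomialSymm_eq_stripPoly, h]

theorem schurCoeff_mul {n : ℕ} (κ μ ν : PartSeq n) : schurCoeff κ (schur μ * schur ν) =
    (sgnCount false (List.ofFn κ.1) μ.gaps (List.ofFn ν.1) : ℂ) := by
  rw [schurCoeff_apply, mul_assoc, schur_mul_alternant, schur_eq_stripPoly,
    ← coeff_stripPoly_mul_alternant false (k := n) (by simp) μ.length_gaps (by simp),
    PartSeq.getD_ofFn, PartSeq.getD_ofFn]

/-! ### The inverse Kostka matrix -/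

/-- The matrix of the coefficients of the monomial symmetric polynomials with respect to the Schur
polynomials. -/
def monomialToSchur (n k : ℕ) : Matrix (PartSeqOf n k) (PartSeqOf n k) ℤ :=
  Matrix.of fun κ μ => sgnCount true (List.ofFn μ.1.1) κ.1.gaps (List.replicate n 0)

theorem schur_eq_sum {n k : ℕ} (κ : PartSeqOf n k) :
    schur κ.1 = ∑ μ, (kostkaMatrix n k κ μ : ℂ) • monomialSymm μ.1 := by
  obtain ⟨κ, rfl⟩ := κ
  simp [schur, kostkaMatrix]

theorem kostkaMatrix_mul_monomialToSchur (n k : ℕ) :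
    kostkaMatrix n k * monomialToSchur n k = 1 := by
  ext κ ν
  have h := congrArg (schurCoeff ν.1) (schur_eq_sum κ)
  rw [schurCoeff_schur, map_sum] at h
  simp only [map_smul, schurCoeff_monomialSymm, smul_eq_mul] at h
  rw [Matrix.mul_apply, Matrix.one_apply]
  have h1 : κ.1 = ν.1 ↔ κ = ν := Subtype.ext_iff.symm
  simp only [h1] at h
  exact_mod_cast h.symm

theorem monomialSymm_eq_sum {n k : ℕ} (κ : PartSeqOf n k) :
    monomialSymm κ.1 = ∑ μ, (monomialToSchur n k κ μ : ℂ) • schur μ.1 := by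
  have h : ∀ ν, ∑ μ, (monomialToSchur n k κ μ : ℂ) * (kostkaMatrix n k μ ν : ℂ) =
      if κ = ν then 1 else 0 := fun ν => by
    have h1 := Matrix.ext_iff.2 (mul_eq_one_comm.1 (kostkaMatrix_mul_monomialToSchur n k)) κ ν
    rw [Matrix.mul_apply, Matrix.one_apply] at h1
    exact_mod_cast h1
  simp only [schur_eq_sum, Finset.smul_sum, smul_smul]
  rw [Finset.sum_comm]
  simp only [← Finset.sum_smul, h, ite_smul, one_smul, zero_smul, Finset.sum_ite_eq,
    Finset.mem_univ, if_true]

theorem isUnit_det_kostkaMatrix (n k : ℕ) : IsUnit (kostkaMatrix n k).det :=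
  Matrix.isUnit_det_of_right_inverse (kostkaMatrix_mul_monomialToSchur n k)

/-- Inverse Kostka numbers are signed counts. -/
theorem invKostka_eq {n : ℕ} (κ μ : PartSeq n) :
    invKostka κ μ = sgnCount true (List.ofFn μ.1) κ.gaps (List.replicate n 0) := by
  rw [invKostka]
  split_ifs with h
  · rw [Matrix.inv_eq_right_inv (kostkaMatrix_mul_monomialToSchur n μ.size)]
    rfl
  · refine (sgnCount_eq_zero (by simp [κ.length_gaps]) (by simp) ?_).symm
    rw [κ.gapSize_gaps, List.sum_ofFn]
    simpa [PartSeq.size] using h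

/-! ### Littlewood–Richardson coefficients -/

theorem linearIndependent_schur (n : ℕ) : LinearIndependent ℂ fun κ : PartSeq n => schur κ := by
  rw [linearIndependent_iff']
  intro s g hg κ hκ
  have h := congrArg (schurCoeff κ) hg
  simp only [map_sum, map_smul, schurCoeff_schur, map_zero, smul_eq_mul, mul_ite, mul_one,
    mul_zero, Finset.sum_ite_eq', hκ, if_true] at h
  exact h

/-- A symmetric form is a linear combination of Schur polynomials. -/
theorem eq_sum_schur {n k : ℕ} {P : MvPolynomial (Fin n) ℂ} (hP : P.IsSymmetric)
    (hk : P.IsHomogeneous k) : P = ∑ κ : PartSeqOf n k, schurCoeff κ.1 P • schur κ.1 := by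
  obtain ⟨a, ha⟩ : ∃ a : PartSeqOf n k → ℂ, P = ∑ κ, a κ • schur κ.1 := by
    refine ⟨fun κ => ∑ μ : PartSeqOf n k, coeff (expo μ.1.1) P * (monomialToSchur n k μ κ : ℂ), ?_⟩
    conv_lhs => rw [eq_sum_monomialSymm hP hk]
    simp only [monomialSymm_eq_sum, Finset.smul_sum, smul_smul, Finset.sum_smul]
    exact Finset.sum_comm
  conv_lhs => rw [ha]
  refine Finset.sum_congr rfl fun κ _ => ?_
  have h1 : ∀ μ : PartSeqOf n k, μ.1 = κ.1 ↔ μ = κ := fun μ => Subtype.ext_iff.symm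
  rw [ha, map_sum]
  simp only [map_smul, schurCoeff_schur, h1]
  simp

theorem schur_mul_schur {n : ℕ} (μ ν : PartSeq n) : schur μ * schur ν =
    ∑ κ : PartSeqOf n (μ.size + ν.size),
      (sgnCount false (List.ofFn κ.1.1) μ.gaps (List.ofFn ν.1) : ℂ) • schur κ.1 := by
  have hs : ∀ κ : PartSeq n, (schur κ).IsSymmetric := fun κ => by
    rw [schur_eq_stripPoly]
    exact isSymmetric_stripPoly κ.length_gaps
  have hh : ∀ κ : PartSeq n, (schur κ).IsHomogeneous κ.size := fun κ => by
    rw [schur_eq_stripPoly, ← κ.gapSize_gaps]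
    exact isHomogeneous_stripPoly false κ.length_gaps
  simp only [← schurCoeff_mul]
  exact eq_sum_schur ((hs μ).mul (hs ν)) ((hh μ).mul (hh ν))

theorem isLittlewoodRichardson_sgnCount : IsLittlewoodRichardson fun _ κ μ ν =>
    sgnCount false (List.ofFn κ.1) μ.gaps (List.ofFn ν.1) := by
  intro n μ ν
  let S : Finset (PartSeq n) :=
    Finset.univ.map (Function.Embedding.subtype fun κ : PartSeq n => κ.size = μ.size + ν.size)
  have hS : ∀ κ, κ ∉ S → sgnCount false (List.ofFn κ.1) μ.gaps (List.ofFn ν.1) = 0 := fun κ hκ => by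
    refine sgnCount_eq_zero (by simp [μ.length_gaps]) (by simp) fun h => hκ ?_
    rw [μ.gapSize_gaps, List.sum_ofFn, List.sum_ofFn] at h
    exact Finset.mem_map.2 ⟨⟨κ, h.symm⟩, Finset.mem_univ _, rfl⟩
  have hfin : (Function.support fun κ : PartSeq n =>
      sgnCount false (List.ofFn κ.1) μ.gaps (List.ofFn ν.1)).Finite :=
    S.finite_toSet.subset fun κ hκ => by_contra fun h => hκ (hS κ h)
  refine ⟨hfin, ?_⟩
  rw [schur_mul_schur, Finset.sum_subset (s₂ := S) (fun κ hκ => ?_) fun κ _ hκ => ?_]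
  · rw [Finset.sum_map]
    rfl
  · exact by_contra fun h => (hfin.mem_toFinset.1 hκ) (hS κ h)
  · rw [hfin.mem_toFinset, Function.mem_support, not_not] at hκ
    simp [hκ]

/-- Littlewood–Richardson coefficients are signed counts. -/
theorem IsLittlewoodRichardson.eq_sgnCount {c : ∀ n : ℕ, PartSeq n → PartSeq n → PartSeq n → ℤ}
    (hc : IsLittlewoodRichardson c) {n : ℕ} (κ μ ν : PartSeq n) :
    c n κ μ ν = sgnCount false (List.ofFn κ.1) μ.gaps (List.ofFn ν.1) := by
  obtain ⟨hfin, h⟩ := hc n μ ν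
  have h1 := congrArg (schurCoeff κ) h
  rw [schurCoeff_mul, map_sum] at h1
  simp only [map_smul, schurCoeff_schur, smul_eq_mul, mul_ite, mul_one, mul_zero,
    Finset.sum_ite_eq', Set.Finite.mem_toFinset, Function.mem_support] at h1
  have h2 : (c n κ μ ν : ℂ) = sgnCount false (List.ofFn κ.1) μ.gaps (List.ofFn ν.1) := by
    rw [h1]
    split_ifs with h0
    · rfl
    · rw [not_not.1 h0, Int.cast_zero]
  exact_mod_cast h2

end KostkaLR

theorem proposition4p1 :
    ((∀ n k : ℕ, IsUnit (kostkaMatrix n k).det) ∧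
      InGapP (tupleCode 2) (fun x => invKostka (x.2 0) (x.2 1))) ∧
    ((∀ n : ℕ, LinearIndependent ℂ (fun κ : PartSeq n => schur κ)) ∧
      (∃ c : ∀ n : ℕ, PartSeq n → PartSeq n → PartSeq n → ℤ, IsLittlewoodRichardson c) ∧
      ∀ c : ∀ n : ℕ, PartSeq n → PartSeq n → PartSeq n → ℤ, IsLittlewoodRichardson c →
        InGapP (tupleCode 3) (fun x => c x.1 (x.2 0) (x.2 1) (x.2 2))) := by
  refine ⟨⟨isUnit_det_kostkaMatrix, ?_⟩, linearIndependent_schur,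
    ⟨_, isLittlewoodRichardson_sgnCount⟩, fun c hc => ?_⟩
  · simp only [invKostka_eq]
    exact Prog.inGapP_sgnCount_true
  · simp only [hc.eq_sgnCount]
    exact Prog.inGapP_sgnCount_false
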